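/- Let $n\ge 1$, let $\Omega\subset\mathbb R^n$ be open, and let $\varphi:\Omega\times[0,\infty)\to[0,\infty]$ be a weak $\Phi$-function, $\varphi\in\Phi_w(\Omega)$. That is: $x\mapsto\varphi(x,|f(x)|)$ is measurable for every measurable $f:\Omega\to[-\infty,\infty]$ (with $\varphi(x,\infty):=\infty$); for every $x\in\Omega$ the function $\varphi(x,\cdot)$ is non-decreasing, $\varphi(x,0)=\lim_{t\to0^+}\varphi(x,t)=0$ and $\lim_{t\to\infty}\varphi(x,t)=\infty$; and there is $L\ge1$ with $\varphi(x,s)/s\le L\,\varphi(x,t)/t$ for all $x\in\Omega$ and $0<s\le t$. **Spaces.** For measurable $f$ on $\Omega$ let $\varrho_\varphi(f)=\int_\Omega\varphi(x,|f(x)|)\,dx$ and $\|f\|_\varphi=\inf\{\lambda>0:\varrho_\varphi(f/\lambda)\le1\}$. Let $L^\varphi(\Omega)$ be the set of measurable $f$ with $\lim_{\lambda\to0^+}\varrho_\varphi(\lambda f)=0$, and let $W^{1,\varphi}(\Omega)$ be the set of $u\in L^\varphi(\Omega)$ whose weak partial derivatives exist and belong to $L^\varphi(\Omega)$, with $\|u\|_{1,\varphi}=\|u\|_\varphi+\|\,|\nabla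 u|\,\|_\varphi$. **Modulus.** Let $\Gamma_{rect}(\Omega)$ be the family of rectifiable curves in $\Omega$, parametrized by arc length on $[0,\ell(\gamma)]$. For $\Gamma\subset\Gamma_{rect}(\Omega)$ let $M_\varphi(\Gamma)=\inf\|w\|_\varphi$ over all Borel functions $w:\Omega\to[0,\infty]$ with $\int_\gamma w\,ds\ge1$ for every $\gamma\in\Gamma$ ($\inf\emptyset=\infty$). **Absolute continuity.** For $u:\Omega\to\mathbb R$ write $u\in ACL(\Omega)$ if for every $k\in\{1,\dots,n\}$ and for almost every line parallel to the $k$-th coordinate axis (with respect to $(n-1)$-dimensional Lebesgue measure) $u$ is absolutely continuous on every compact segment of that line that lies in $\Omega$. Write $u\in ACC(\Omega)$ if the family of those $\gamma\in\Gamma_{rect}(\Omega)$ for which $u\circ\gamma$ is not absolutely continuous on $[0,\ell(\gamma)]$ has $\varphi$-modulus zero. Let $ACL^\varphi(\Omega)$ and $ACC^\varphi(\Omega)$ be the sets of those $u$ in $ACL(\Omega)$ and in $ACC(\Omega)$, respectively, for which $|\nabla u|\in L^\varphi(\Omega)$, where $\nabla u$ is the vector of classical partial derivatives (a partial derivative is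 set to $0$ where it does not exist). **Hypotheses.** Assume one of the following. 1. There is $\beta>0$ with $\varphi(x,\beta)\ge1$ for almost every $x\in\Omega$, and $C^1(\Omega)\cap W^{1,\varphi}(\Omega)$ is dense in $W^{1,\varphi}(\Omega)$ with respect to $\|\cdot\|_{1,\varphi}$. 2. $\varphi$ satisfies the following four conditions, where $\varphi^{-1}(x,\tau)=\inf\{t\ge0:\varphi(x,t)\ge\tau\}$. - (A0): there is $\beta\in(0,1)$ with $\varphi(x,\beta)\le1\le\varphi(x,1/\beta)$ for a.e. $x\in\Omega$. - (A1): there is $\beta\in(0,1)$ such that for every ball $B$ and a.e. $x,y\in B\cap\Omega$ we have $\beta\varphi^{-1}(x,t)\le\varphi^{-1}(y,t)$ for all $t\in[1,1/|B|]$. - (A2): for every $s>0$ there are $\beta\in(0,1]$ and $h\in L^1(\Omega)\cap L^\infty(\Omega)$ such that for a.e. $x,y\in\Omega$ we have $\beta\varphi^{-1}(x,t)\le\varphi^{-1}(y,t)$ for all $t\in[h(x)+h(y),s]$. - (aDec): there are $q>1$ and $L\ge1$ such that for a.e. $x\in\Omega$ we have $\varphi(x,t)/t^q\le L\,\varphi(x,s)/s^q$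 for all $0<s\le t$. **Conclusion.** For every measurable $u\in ACL(\Omega)\cup ACC(\Omega)$ the classical partial derivatives exist almost everywhere in $\Omega$, and $$ACC^\varphi(\Omega)\cap L^\varphi(\Omega)=ACL^\varphi(\Omega)\cap L^\varphi(\Omega)=W^{1,\varphi}(\Omega)$$ as sets of functions modulo equality almost everywhere; that is, a class belongs to $ACC^\varphi(\Omega)$ or $ACL^\varphi(\Omega)$ if some representative of it does. -/

import Mathlib

open MeasureTheory Filter Topology Set
open scoped NNReal ENNReal ContDiff

noncomputable section

namespace GenOrlicz

/-- Euclidean space of dimension `n + 1`, so that the dimension is at least one. -/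
abbrev Space (n : ℕ) := EuclideanSpace ℝ (Fin (n + 1))

/-! ### Weak Φ-functions -/

/-- The value `φ(x, t)` for `t ∈ [0, ∞]`, with `φ(x, ∞) = lim_{t → ∞} φ(x, t) = ∞`. -/
def extendPhi {n : ℕ} (φ : Space n → ℝ≥0 → ℝ≥0∞) (x : Space n) (t : ℝ≥0∞) : ℝ≥0∞ :=
  if t = ⊤ then ⊤ else φ x t.toNNReal

/-- `φ ∈ Φ_w(Ω)`: `φ` is a weak Φ-function on `Ω`. Only the values `φ x t` with `x ∈ Ω` matter.
Lebesgue measurability on `Ω` is a.e.-measurability for Lebesgue measure restricted to `Ω`. In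
`measurable`, the function `f` stands for `|f|`. -/
structure IsWeakPhi {n : ℕ} (Ω : Set (Space n)) (φ : Space n → ℝ≥0 → ℝ≥0∞) : Prop where
  measurable : ∀ f : Space n → ℝ≥0∞, AEMeasurable f (volume.restrict Ω) →
    AEMeasurable (fun x => extendPhi φ x (f x)) (volume.restrict Ω)
  mono : ∀ x ∈ Ω, Monotone (φ x)
  zero : ∀ x ∈ Ω, φ x 0 = 0
  tendsto_zero : ∀ x ∈ Ω, Tendsto (φ x) (𝓝[>] 0) (𝓝 0)
  tendsto_top : ∀ x ∈ Ω, Tendsto (φ x) atTop (𝓝 ⊤)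
  almostInc : ∃ L : ℝ≥0, 1 ≤ L ∧ ∀ x ∈ Ω, ∀ s t : ℝ≥0, 0 < s → s ≤ t →
    φ x s / s ≤ L * (φ x t / t)

/-- The left-inverse `φ⁻¹(x, τ) = inf {t ≥ 0 : φ(x, t) ≥ τ}`. -/
def leftInv {n : ℕ} (φ : Space n → ℝ≥0 → ℝ≥0∞) (x : Space n) (τ : ℝ≥0∞) : ℝ≥0∞ :=
  ⨅ (t : ℝ≥0) (_ : τ ≤ φ x t), (t : ℝ≥0∞)

/-- There is `β > 0` with `φ(x, β) ≥ 1` for almost every `x ∈ Ω`. -/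
def WeakA0 {n : ℕ} (Ω : Set (Space n)) (φ : Space n → ℝ≥0 → ℝ≥0∞) : Prop :=
  ∃ β : ℝ≥0, 0 < β ∧ ∀ᵐ x ∂(volume.restrict Ω), 1 ≤ φ x β

/-- Assumption (A0). -/
def A0 {n : ℕ} (Ω : Set (Space n)) (φ : Space n → ℝ≥0 → ℝ≥0∞) : Prop :=
  ∃ β : ℝ≥0, 0 < β ∧ β < 1 ∧ ∀ᵐ x ∂(volume.restrict Ω), φ x β ≤ 1 ∧ 1 ≤ φ x (1 / β)

/-- Assumption (A1). -/
def A1 {n : ℕ} (Ω : Set (Space n)) (φ : Space n → ℝ≥0 → ℝ≥0∞) : Prop :=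
  ∃ β : ℝ≥0, 0 < β ∧ β < 1 ∧ ∀ (c : Space n) (r : ℝ), 0 < r →
    ∀ᵐ x ∂(volume.restrict (Metric.ball c r ∩ Ω)), ∀ᵐ y ∂(volume.restrict (Metric.ball c r ∩ Ω)),
      ∀ t : ℝ≥0∞, 1 ≤ t → t ≤ 1 / volume (Metric.ball c r) →
        β * leftInv φ x t ≤ leftInv φ y t

/-- Assumption (A2). -/
def A2 {n : ℕ} (Ω : Set (Space n)) (φ : Space n → ℝ≥0 → ℝ≥0∞) : Prop :=
  ∀ s : ℝ, 0 < s → ∃ (β : ℝ≥0) (h : Space n → ℝ), 0 < β ∧ β ≤ 1 ∧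
    MemLp h 1 (volume.restrict Ω) ∧ MemLp h ⊤ (volume.restrict Ω) ∧
    ∀ᵐ x ∂(volume.restrict Ω), ∀ᵐ y ∂(volume.restrict Ω), ∀ t : ℝ, h x + h y ≤ t → t ≤ s →
      β * leftInv φ x (ENNReal.ofReal t) ≤ leftInv φ y (ENNReal.ofReal t)

/-- Assumption (aDec): for some `q > 1`, the function `t ↦ φ(x, t) / t ^ q` is `L`-almost
decreasing on `(0, ∞)`, with `L` independent of `x`. -/
def ADec {n : ℕ} (Ω : Set (Space n)) (φ : Space n → ℝ≥0 → ℝ≥0∞) : Prop :=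
  ∃ (q : ℝ) (L : ℝ≥0), 1 < q ∧ 1 ≤ L ∧ ∀ᵐ x ∂(volume.restrict Ω), ∀ s t : ℝ≥0, 0 < s → s ≤ t →
    φ x t / (t : ℝ≥0∞) ^ q ≤ L * (φ x s / (s : ℝ≥0∞) ^ q)

/-! ### Generalized Orlicz spaces -/

/-- The modular `ϱ_φ(f) = ∫_Ω φ(x, f(x)) dx` of a `[0, ∞]`-valued function. -/
def modular {n : ℕ} (Ω : Set (Space n)) (φ : Space n → ℝ≥0 → ℝ≥0∞) (f : Space n → ℝ≥0∞) : ℝ≥0∞ :=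
  ∫⁻ x in Ω, extendPhi φ x (f x)

/-- The Luxemburg norm `inf {l > 0 : ϱ_φ(f / l) ≤ 1}` of a `[0, ∞]`-valued function, equal to `∞`
if there is no such `l`. -/
def luxNorm {n : ℕ} (Ω : Set (Space n)) (φ : Space n → ℝ≥0 → ℝ≥0∞) (f : Space n → ℝ≥0∞) : ℝ≥0∞ :=
  ⨅ (l : ℝ≥0) (_ : 0 < l) (_ : modular Ω φ (fun x => f x / l) ≤ 1), (l : ℝ≥0∞)

/-- `f` is measurable on `Ω` and `lim_{l → 0+} ϱ_φ(l f) = 0`. -/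
def MemLphi {n : ℕ} (Ω : Set (Space n)) (φ : Space n → ℝ≥0 → ℝ≥0∞) (f : Space n → ℝ) : Prop :=
  AEMeasurable f (volume.restrict Ω) ∧
    Tendsto (fun l : ℝ≥0 => modular Ω φ (fun x => l * ‖f x‖ₑ)) (𝓝[>] 0) (𝓝 0)

/-! ### Orlicz–Sobolev spaces -/

/-- `u` and `g` are locally integrable in `Ω` and `g` is the weak gradient of `u` in `Ω`: its `k`-th
component is the weak `k`-th partial derivative of `u`. -/
def IsWeakGradient {n : ℕ} (Ω : Set (Space n)) (u : Space n → ℝ) (g : Space n → Space n) : Prop :=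
  LocallyIntegrableOn u Ω ∧ LocallyIntegrableOn g Ω ∧
    ∀ (k : Fin (n + 1)) (ψ : Space n → ℝ), ContDiff ℝ ∞ ψ → HasCompactSupport ψ → tsupport ψ ⊆ Ω →
      ∫ x in Ω, u x * fderiv ℝ ψ x (EuclideanSpace.single k 1) = - ∫ x in Ω, g x k * ψ x

/-- `u ∈ L^φ(Ω)` has weak partial derivatives, which all belong to `L^φ(Ω)`. -/
def MemSobolev {n : ℕ} (Ω : Set (Space n)) (φ : Space n → ℝ≥0 → ℝ≥0∞) (u : Space n → ℝ) : Prop :=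
  MemLphi Ω φ u ∧ ∃ g : Space n → Space n, IsWeakGradient Ω u g ∧
    ∀ k : Fin (n + 1), MemLphi Ω φ (fun x => g x k)

/-- The norm `‖u‖_φ + ‖ |∇u| ‖_φ`, with `∇u` the weak gradient. The weak gradient is unique up to a
null set, so the infimum is over a single value (and it is `∞` if there is no weak gradient). -/
def sobolevNorm {n : ℕ} (Ω : Set (Space n)) (φ : Space n → ℝ≥0 → ℝ≥0∞) (u : Space n → ℝ) : ℝ≥0∞ :=
  ⨅ (g : Space n → Space n) (_ : IsWeakGradient Ω u g),
    luxNorm Ω φ (fun x => ‖u x‖ₑ) + luxNorm Ω φ (fun x => ‖g x‖ₑ)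

/-- `C¹(Ω) ∩ W^{1,φ}(Ω)` is dense in `W^{1,φ}(Ω)`. -/
def C1Dense {n : ℕ} (Ω : Set (Space n)) (φ : Space n → ℝ≥0 → ℝ≥0∞) : Prop :=
  ∀ u, MemSobolev Ω φ u → ∀ ε : ℝ≥0∞, 0 < ε →
    ∃ v, ContDiffOn ℝ 1 v Ω ∧ MemSobolev Ω φ v ∧ sobolevNorm Ω φ (u - v) < ε

/-! ### Curves and modulus -/

/-- A rectifiable curve in `Ω`, parametrized by arc length on `[0, len]`. The values of `toFun`
outside `[0, len]` are irrelevant. -/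
structure RectCurve {n : ℕ} (Ω : Set (Space n)) where
  len : ℝ
  len_nonneg : 0 ≤ len
  toFun : ℝ → Space n
  unitSpeed : HasUnitSpeedOn toFun (Icc 0 len)
  mapsTo : MapsTo toFun (Icc 0 len) Ω

/-- The integral `∫_γ w ds` with respect to arc length. -/
def RectCurve.integral {n : ℕ} {Ω : Set (Space n)} (γ : RectCurve Ω) (w : Space n → ℝ≥0∞) : ℝ≥0∞ :=
  ∫⁻ t in Icc 0 γ.len, w (γ.toFun t)

/-- `w` is a Borel function with `∫_γ w ds ≥ 1` for all `γ ∈ Γ`. -/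
def Admissible {n : ℕ} {Ω : Set (Space n)} (Γ : Set (RectCurve Ω)) (w : Space n → ℝ≥0∞) : Prop :=
  Measurable (Ω.domRestrict w) ∧ ∀ γ ∈ Γ, 1 ≤ γ.integral w

/-- The `φ`-modulus of a family of rectifiable curves. -/
def modulus {n : ℕ} {Ω : Set (Space n)} (φ : Space n → ℝ≥0 → ℝ≥0∞) (Γ : Set (RectCurve Ω)) : ℝ≥0∞ :=
  ⨅ (w : Space n → ℝ≥0∞) (_ : Admissible Γ w), luxNorm Ω φ w

/-! ### Absolute continuity on lines and on curves -/

/-- The point `(y, z)_k`, obtained from `y` by inserting `z` as the `k`-th coordinate. -/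
def insertCoord {n : ℕ} (k : Fin (n + 1)) (y : Fin n → ℝ) (z : ℝ) : Space n :=
  WithLp.toLp 2 (k.insertNth z y)

/-- `ACL(Ω)`. For `y` outside the projection of `Ω` along the `k`-th axis, the condition on the
intervals is void. -/
def ACL {n : ℕ} (Ω : Set (Space n)) : Set (Space n → ℝ) :=
  {u | ∀ k : Fin (n + 1), ∀ᵐ y : Fin n → ℝ, ∀ a b : ℝ, a ≤ b →
    (∀ z ∈ Icc a b, insertCoord k y z ∈ Ω) →
      AbsolutelyContinuousOnInterval (fun z => u (insertCoord k y z)) a b}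

/-- The curves `γ` in `Ω` for which `u ∘ γ` is not absolutely continuous on `[0, ℓ(γ)]`. -/
def curvesNAC {n : ℕ} (Ω : Set (Space n)) (u : Space n → ℝ) : Set (RectCurve Ω) :=
  {γ | ¬ AbsolutelyContinuousOnInterval (u ∘ γ.toFun) 0 γ.len}

/-- `ACC(Ω)`. -/
def ACC {n : ℕ} (Ω : Set (Space n)) (φ : Space n → ℝ≥0 → ℝ≥0∞) : Set (Space n → ℝ) :=
  {u | modulus φ (curvesNAC Ω u) = 0}

/-- The classical partial derivatives of `u` exist almost everywhere in `Ω`. -/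
def HasGradientAE {n : ℕ} (Ω : Set (Space n)) (u : Space n → ℝ) : Prop :=
  ∀ᵐ x ∂(volume.restrict Ω), ∀ k : Fin (n + 1),
    LineDifferentiableAt ℝ u x (EuclideanSpace.single k 1)

/-- The vector of classical partial derivatives of `u` at `x`. -/
def classicalGradient {n : ℕ} (u : Space n → ℝ) (x : Space n) : Space n :=
  WithLp.toLp 2 (fun k => lineDeriv ℝ u x (EuclideanSpace.single k 1))

/-- `ACL^φ(Ω)`. -/
def ACLphi {n : ℕ} (Ω : Set (Space n)) (φ : Space n → ℝ≥0 → ℝ≥0∞) : Set (Space n → ℝ) :=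
  {u | u ∈ ACL Ω ∧ MemLphi Ω φ (fun x => ‖classicalGradient u x‖)}

/-- `ACC^φ(Ω)`. -/
def ACCphi {n : ℕ} (Ω : Set (Space n)) (φ : Space n → ℝ≥0 → ℝ≥0∞) : Set (Space n → ℝ) :=
  {u | u ∈ ACC Ω φ ∧ MemLphi Ω φ (fun x => ‖classicalGradient u x‖)}

/-! ### Spaces of classes of functions modulo equality almost everywhere in `Ω` -/

/-- Classes of measurable functions on `Ω` modulo equality almost everywhere. -/
abbrev L0 {n : ℕ} (Ω : Set (Space n)) := Space n →ₘ[volume.restrict Ω] ℝ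

/-- The classes that have a representative in `S`. -/
def classes {n : ℕ} (Ω : Set (Space n)) (S : Set (Space n → ℝ)) : Set (L0 Ω) :=
  {f | ∃ v ∈ S, f =ᵐ[volume.restrict Ω] v}

/-- `L^φ(Ω)`, as a set of classes. -/
def Lphi {n : ℕ} (Ω : Set (Space n)) (φ : Space n → ℝ≥0 → ℝ≥0∞) : Set (L0 Ω) :=
  {f | MemLphi Ω φ f}

/-- `W^{1,φ}(Ω)`, as a set of classes. -/
def W1phi {n : ℕ} (Ω : Set (Space n)) (φ : Space n → ℝ≥0 → ℝ≥0∞) : Set (L0 Ω) :=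
  {f | MemSobolev Ω φ f}

end GenOrlicz

end

/-!
Only elementary properties of `φ` enter into most of the proof: since `φ(x, β) ≥ 1` almost
everywhere for some `β`, functions in `L^φ` are locally integrable, and the modular is countably
subadditive up to geometric weights (`modular_tsum_le`).

`ACC ⊆ ACL`: a family of modulus zero has admissible functions of arbitrarily small Luxemburg norm.
A sum of such functions is locally integrable, so by Fubini's theorem it has finite integral on the
segments of almost every line, whereas it has infinite integral along each curve of the family
(`ACC_subset_ACL`). A measurable function in `ACL` has classical partial derivatives almost
everywhere, because an absolutely continuous function of one variable is differentiable almost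
everywhere and the set where this holds is measurable up to a null set (`ACL.hasGradientAE`).
Integration by parts on lines shows that they are the weak ones (`ACL.isWeakGradient`), whence
`ACL^φ ∩ L^φ ⊆ W^{1,φ}`.

`W^{1,φ} ⊆ ACC^φ ∩ L^φ`: this is Fuglede's argument (`exists_mem_ACC_of_approximation`). If `C¹`
functions `v m`, defined on open sets exhausting `Ω`, converge to `u` fast enough, together with
their gradients, then the sum of the absolute values of all consecutive differences has finite
modular. The curves along which this sum has infinite integral form a family of modulus zero, and
along every other curve of positive length `v m` converges to an absolutely continuous function. The
limit is the representative of `u` that is sought, and the same reasoning on segments identifies its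
gradient.

The approximations come from the density of `C¹` functions under the first hypothesis, and from
mollification under the second. Since they need not be defined on all of `Ω`, modular convergence of
mollifications on compact sets suffices, and no maximal operator is needed. The essential estimate
is `exists_extendPhi_lmollify_le`, a Jensen type inequality: by (A1), `φ⁻¹(·, T)` is almost constant,
up to a factor, on a ball `B` for each natural number `T ≤ 1 / |B|`, and if the mean of `φ(y, h y)`
over `B` is at most `T`, then the mean of `h` is at most a constant times that value of `φ⁻¹`.
Dominated convergence with converging bounds then gives modular convergence of a small multiple, and
(aDec) gives it for all multiples (`tendsto_modular_mollify_sub`).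
-/

noncomputable section

namespace GenOrlicz

variable {n : ℕ} {Ω : Set (Space n)} {φ : Space n → ℝ≥0 → ℝ≥0∞}

/-! ### Modulars of weak Φ-functions -/

@[simp] lemma extendPhi_top (x : Space n) : extendPhi φ x ⊤ = ⊤ := if_pos rfl

@[simp] lemma extendPhi_coe (x : Space n) (t : ℝ≥0) : extendPhi φ x t = φ x t := by
  simp [extendPhi]

lemma IsWeakPhi.extendPhi_zero (hφ : IsWeakPhi Ω φ) {x : Space n} (hx : x ∈ Ω) :
    extendPhi φ x 0 = 0 := by
  simp [extendPhi, hφ.zero x hx]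

lemma IsWeakPhi.extendPhi_mono (hφ : IsWeakPhi Ω φ) {x : Space n} (hx : x ∈ Ω) :
    Monotone (extendPhi φ x) := by
  intro s t hst
  rcases eq_or_ne t ⊤ with rfl | ht
  · simp
  · lift t to ℝ≥0 using ht
    lift s to ℝ≥0 using (hst.trans_lt ENNReal.coe_lt_top).ne
    simpa using hφ.mono x hx (by exact_mod_cast hst)

lemma IsWeakPhi.extendPhi_max (hφ : IsWeakPhi Ω φ) {x : Space n} (hx : x ∈ Ω) (s t : ℝ≥0∞) :
    extendPhi φ x (max s t) ≤ extendPhi φ x s + extendPhi φ x t := by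
  rw [(hφ.extendPhi_mono hx).map_max]
  exact max_le le_self_add le_add_self

lemma add_le_max_two_mul (s t : ℝ≥0∞) : s + t ≤ max (2 * s) (2 * t) := by
  rcases le_total s t with h | h
  · exact le_max_of_le_right (by rw [two_mul]; gcongr)
  · exact le_max_of_le_left (by rw [two_mul]; gcongr)

lemma IsWeakPhi.extendPhi_add (hφ : IsWeakPhi Ω φ) {x : Space n} (hx : x ∈ Ω) (s t : ℝ≥0∞) :
    extendPhi φ x (s + t) ≤ extendPhi φ x (2 * s) + extendPhi φ x (2 * t) :=
  (hφ.extendPhi_mono hx (add_le_max_two_mul s t)).trans (hφ.extendPhi_max hx _ _)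

/-- The almost increasing condition as an upper bound under contractions of the argument. -/
lemma IsWeakPhi.exists_extendPhi_mul_le (hφ : IsWeakPhi Ω φ) :
    ∃ L : ℝ≥0, 1 ≤ L ∧ ∀ x ∈ Ω, ∀ c : ℝ≥0, c ≤ 1 → ∀ t : ℝ≥0∞,
      extendPhi φ x (c * t) ≤ L * c * extendPhi φ x t := by
  obtain ⟨L, hL, h⟩ := hφ.almostInc
  refine ⟨L, hL, fun x hx c hc t => ?_⟩
  rcases eq_or_ne c 0 with rfl | hc0
  · simp [hφ.extendPhi_zero hx]
  rcases eq_or_ne t ⊤ with rfl | ht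
  · have : (L : ℝ≥0∞) * c ≠ 0 := by
      have : L ≠ 0 := (zero_lt_one.trans_le hL).ne'
      simp [this, hc0]
    simp [ENNReal.mul_top this]
  lift t to ℝ≥0 using ht
  rcases eq_or_ne t 0 with rfl | ht0
  · simp [hφ.extendPhi_zero hx]
  rw [← ENNReal.coe_mul, extendPhi_coe, extendPhi_coe]
  have h1 := h x hx (c * t) t (by positivity) (mul_le_of_le_one_left' hc)
  have hct : ((c * t : ℝ≥0) : ℝ≥0∞) ≠ 0 := by simp [hc0, ht0]
  calc φ x (c * t) ≤ L * (φ x t / t) * (c * t : ℝ≥0) :=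
        (ENNReal.div_le_iff hct ENNReal.coe_ne_top).1 h1
    _ = L * c * (φ x t / t * t) := by push_cast; ring
    _ = L * c * φ x t := by
        rw [ENNReal.div_mul_cancel (by simpa using ht0) ENNReal.coe_ne_top]

/-- If `φ(x, β) ≥ 1` for almost every `x`, then `φ` grows at least linearly, uniformly in `x`. -/
lemma IsWeakPhi.exists_le_extendPhi (hφ : IsWeakPhi Ω φ) (hΩ : IsOpen Ω) (h0 : WeakA0 Ω φ) :
    ∃ C : ℝ≥0, ∀ᵐ x ∂(volume.restrict Ω), ∀ t : ℝ≥0∞, t ≤ C * (1 + extendPhi φ x t) := by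
  obtain ⟨β, hβ, h0⟩ := h0
  obtain ⟨L, hL, h⟩ := hφ.almostInc
  refine ⟨L * β, ?_⟩
  filter_upwards [h0, ae_restrict_mem hΩ.measurableSet] with x hx hxΩ t
  rcases eq_or_ne t ⊤ with rfl | ht
  · have : ((L * β : ℝ≥0) : ℝ≥0∞) ≠ 0 := by
      have : L ≠ 0 := (zero_lt_one.trans_le hL).ne'
      simp [this, hβ.ne']
    simp [-ENNReal.coe_mul, ENNReal.mul_top this]
  lift t to ℝ≥0 using ht
  rw [extendPhi_coe]
  rcases le_total t β with htβ | htβ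
  · calc (t : ℝ≥0∞) ≤ (L * β : ℝ≥0) := by
          exact_mod_cast htβ.trans (le_mul_of_one_le_left' hL)
      _ ≤ (L * β : ℝ≥0) * (1 + φ x t) := le_mul_of_one_le_right' le_self_add
  · have h1 := h x hxΩ β t hβ htβ
    have hβ' : (β : ℝ≥0∞) ≠ 0 := by simpa using hβ.ne'
    have ht' : (t : ℝ≥0∞) ≠ 0 := by simpa using (hβ.trans_le htβ).ne'
    calc (t : ℝ≥0∞) = t * 1 := (mul_one _).symm
      _ ≤ t * φ x β := by gcongr
      _ ≤ t * (L * (φ x t / t) * β) := by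
          gcongr; exact (ENNReal.div_le_iff hβ' ENNReal.coe_ne_top).1 h1
      _ = (L * β) * (φ x t / t * t) := by ring
      _ = (L * β) * φ x t := by
          rw [ENNReal.div_mul_cancel ht' ENNReal.coe_ne_top]
      _ ≤ (L * β : ℝ≥0) * (1 + φ x t) := by
          push_cast; gcongr; exact le_add_self

lemma modular_mono_ae (hφ : IsWeakPhi Ω φ) (hΩ : IsOpen Ω) {f g : Space n → ℝ≥0∞}
    (h : ∀ᵐ x ∂(volume.restrict Ω), f x ≤ g x) : modular Ω φ f ≤ modular Ω φ g := by
  refine lintegral_mono_ae ?_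
  filter_upwards [h, ae_restrict_mem hΩ.measurableSet] with x hx hxΩ
  exact hφ.extendPhi_mono hxΩ hx

lemma modular_add_le (hφ : IsWeakPhi Ω φ) (hΩ : IsOpen Ω) {f g : Space n → ℝ≥0∞}
    (hf : AEMeasurable f (volume.restrict Ω)) :
    modular Ω φ (fun x => f x + g x) ≤
      modular Ω φ (fun x => 2 * f x) + modular Ω φ (fun x => 2 * g x) := by
  unfold modular
  rw [← lintegral_add_left' (hφ.measurable _ (hf.const_mul _))]
  refine lintegral_mono_ae ?_
  filter_upwards [ae_restrict_mem hΩ.measurableSet] with x hxΩ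
  exact hφ.extendPhi_add hxΩ _ _

lemma modular_mul_le (hφ : IsWeakPhi Ω φ) (hΩ : IsOpen Ω) :
    ∃ L : ℝ≥0, 1 ≤ L ∧ ∀ (c : ℝ≥0), c ≤ 1 → ∀ f : Space n → ℝ≥0∞,
      modular Ω φ (fun x => c * f x) ≤ L * c * modular Ω φ f := by
  obtain ⟨L, hL, h⟩ := hφ.exists_extendPhi_mul_le
  refine ⟨L, hL, fun c hc f => ?_⟩
  unfold modular
  rw [← lintegral_const_mul' _ _ (by finiteness)]
  refine lintegral_mono_ae ?_
  filter_upwards [ae_restrict_mem hΩ.measurableSet] with x hxΩ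
  exact h x hxΩ c hc _

/-- Countable subadditivity of `φ(x, ·)` along weighted sums. With the weights `2 ^ (-(i + 2))`
rather than `2 ^ (-(i + 1))`, the sum stays strictly below the supremum of the terms, which is
needed since `φ(x, ·)` may fail to be left-continuous. -/
lemma extendPhi_tsum_le (hφ : IsWeakPhi Ω φ) {x : Space n} (hx : x ∈ Ω) (a : ℕ → ℝ≥0∞) :
    extendPhi φ x (∑' i, 2⁻¹ ^ (i + 2) * a i) ≤ ∑' i, extendPhi φ x (a i) := by
  have hsum : ∑' i, 2⁻¹ ^ (i + 2) * a i ≤ 2⁻¹ * ⨆ i, a i := by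
    calc ∑' i, 2⁻¹ ^ (i + 2) * a i ≤ ∑' i, 2⁻¹ ^ (i + 1) * (2⁻¹ * ⨆ i, a i) := by
          refine ENNReal.tsum_le_tsum fun i => ?_
          rw [pow_succ _ (i + 1), mul_assoc]
          gcongr
          exact le_iSup a i
      _ = 2⁻¹ * ⨆ i, a i := by
          rw [ENNReal.tsum_mul_right, ENNReal.tsum_geometric_add_one,
            ENNReal.one_sub_inv_two, inv_inv, ENNReal.inv_mul_cancel (by simp) (by simp), one_mul]
  refine (hφ.extendPhi_mono hx hsum).trans ?_
  rcases eq_or_ne (⨆ i, a i) ⊤ with htop | htop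
  · -- the terms are unbounded, so that their values under `φ x` are as well
    suffices h : ∑' i, extendPhi φ x (a i) = ⊤ by simp [h]
    refine ENNReal.eq_top_of_forall_nnreal_le fun r => ?_
    obtain ⟨t, ht⟩ := ((hφ.tendsto_top x hx).eventually
      (le_mem_nhds (ENNReal.coe_lt_top (r := r)))).exists
    obtain ⟨i, hi⟩ := lt_iSup_iff.1 (htop ▸ ENNReal.coe_lt_top : (t : ℝ≥0∞) < ⨆ i, a i)
    calc (r : ℝ≥0∞) ≤ extendPhi φ x t := by simpa using ht
      _ ≤ extendPhi φ x (a i) := hφ.extendPhi_mono hx hi.le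
      _ ≤ _ := ENNReal.le_tsum i
  rcases eq_or_ne (⨆ i, a i) 0 with hz | hz
  · simp [hz, hφ.extendPhi_zero hx]
  obtain ⟨i, hi⟩ : ∃ i, 2⁻¹ * ⨆ i, a i < a i := by
    refine lt_iSup_iff.1 ?_
    rw [mul_comm, ← div_eq_mul_inv]
    exact ENNReal.half_lt_self hz htop
  exact (hφ.extendPhi_mono hx hi.le).trans (ENNReal.le_tsum i)

lemma modular_tsum_le (hφ : IsWeakPhi Ω φ) (hΩ : IsOpen Ω) {a : ℕ → Space n → ℝ≥0∞}
    (ha : ∀ i, AEMeasurable (a i) (volume.restrict Ω)) :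
    modular Ω φ (fun x => ∑' i, 2⁻¹ ^ (i + 2) * a i x) ≤ ∑' i, modular Ω φ (a i) := by
  unfold modular
  rw [← lintegral_tsum fun i => hφ.measurable _ (ha i)]
  refine lintegral_mono_ae ?_
  filter_upwards [ae_restrict_mem hΩ.measurableSet] with x hxΩ
  exact extendPhi_tsum_le hφ hxΩ _

/-- Convergence in the Luxemburg norm implies modular convergence, at every scale. -/
lemma exists_modular_le_of_luxNorm_lt (hφ : IsWeakPhi Ω φ) (hΩ : IsOpen Ω) (A : ℝ≥0) {δ : ℝ≥0}
    (hδ : 0 < δ) :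
    ∃ ε : ℝ≥0∞, 0 < ε ∧ ∀ f, luxNorm Ω φ f < ε → modular Ω φ (fun x => A * f x) ≤ δ := by
  obtain ⟨L, hL, h⟩ := modular_mul_le hφ hΩ
  have hL0 : 0 < L := zero_lt_one.trans_le hL
  refine ⟨min ((A + 1)⁻¹ : ℝ≥0) (δ / (L * (A + 1)) : ℝ≥0), ?_, fun f hf => ?_⟩
  · exact_mod_cast lt_min (by positivity) (by positivity)
  simp only [luxNorm, iInf_lt_iff] at hf
  obtain ⟨l, hl0, hl, hlε⟩ := hf
  rw [lt_min_iff] at hlε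
  have h1 : l < (A + 1)⁻¹ := by exact_mod_cast hlε.1
  have h2 : l < δ / (L * (A + 1)) := by exact_mod_cast hlε.2
  have hA1 : A * l ≤ 1 := by
    calc A * l ≤ (A + 1) * (A + 1)⁻¹ := by gcongr; simp
      _ = 1 := mul_inv_cancel₀ (by positivity)
  have hl0' : (l : ℝ≥0∞) ≠ 0 := by simpa using hl0.ne'
  calc modular Ω φ (fun x => A * f x) = modular Ω φ (fun x => (A * l : ℝ≥0) * (f x / l)) := by
        congr with x
        push_cast
        rw [mul_assoc, ENNReal.mul_div_cancel hl0' ENNReal.coe_ne_top]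
    _ ≤ L * (A * l : ℝ≥0) * modular Ω φ (fun x => f x / l) := h _ hA1 _
    _ ≤ L * (A * l : ℝ≥0) * 1 := by gcongr
    _ ≤ δ := by
        rw [mul_one]
        norm_cast
        calc L * (A * l) ≤ L * ((A + 1) * (δ / (L * (A + 1)))) := by gcongr; simp
          _ = δ := by field_simp

/-- Homogeneity of the Luxemburg norm, as an upper bound. -/
lemma luxNorm_div_le {f : Space n → ℝ≥0∞} {l : ℝ≥0} (hl : 0 < l)
    (h : modular Ω φ (fun x => f x / l) ≤ 1) {N : ℝ≥0} (hN : 0 < N) :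
    luxNorm Ω φ (fun x => f x / N) ≤ (l / N : ℝ≥0) := by
  refine iInf_le_of_le (l / N) (iInf_le_of_le (by positivity) (iInf_le_of_le ?_ le_rfl))
  refine le_of_eq_of_le ?_ h
  congr with x
  beta_reduce
  rw [ENNReal.coe_div hN.ne', div_eq_mul_inv, div_eq_mul_inv, div_eq_mul_inv, div_eq_mul_inv,
    ENNReal.mul_inv (by simp [hl.ne']) (by simp), inv_inv, mul_assoc]
  congr 1
  rw [mul_comm (l : ℝ≥0∞)⁻¹, ← mul_assoc, ENNReal.inv_mul_cancel (by simpa using hN.ne') (by simp),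
    one_mul]

/-! ### The space `L^φ` -/

lemma MemLphi.exists_modular_le {f : Space n → ℝ} (hf : MemLphi Ω φ f) {δ : ℝ≥0∞} (hδ : 0 < δ) :
    ∃ c : ℝ≥0, 0 < c ∧ modular Ω φ (fun x => c * ‖f x‖ₑ) ≤ δ := by
  have h1 := hf.2.eventually (ge_mem_nhds hδ)
  obtain ⟨c, hc, hc'⟩ := (h1.and self_mem_nhdsWithin).exists
  exact ⟨c, hc', hc⟩

lemma MemLphi.mono (hφ : IsWeakPhi Ω φ) (hΩ : IsOpen Ω) {f g : Space n → ℝ}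
    (hg : MemLphi Ω φ g) (hf : AEMeasurable f (volume.restrict Ω))
    (h : ∀ᵐ x ∂(volume.restrict Ω), ‖f x‖ₑ ≤ ‖g x‖ₑ) : MemLphi Ω φ f := by
  refine ⟨hf, tendsto_of_tendsto_of_tendsto_of_le_of_le tendsto_const_nhds hg.2
    (fun _ => zero_le) fun l => modular_mono_ae hφ hΩ ?_⟩
  filter_upwards [h] with x hx
  gcongr

lemma MemLphi.congr (hφ : IsWeakPhi Ω φ) (hΩ : IsOpen Ω) {f g : Space n → ℝ}
    (hg : MemLphi Ω φ g) (h : f =ᵐ[volume.restrict Ω] g) : MemLphi Ω φ f :=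
  hg.mono hφ hΩ (hg.1.congr h.symm) (h.mono fun x hx => by rw [hx])

lemma MemLphi.add (hφ : IsWeakPhi Ω φ) (hΩ : IsOpen Ω) {f g : Space n → ℝ}
    (hf : MemLphi Ω φ f) (hg : MemLphi Ω φ g) : MemLphi Ω φ (fun x => f x + g x) := by
  refine ⟨hf.1.add hg.1, ?_⟩
  have h2 : Tendsto (fun l : ℝ≥0 => 2 * l) (𝓝[>] 0) (𝓝[>] 0) := by
    refine tendsto_nhdsWithin_iff.2 ⟨?_, ?_⟩
    · have : Tendsto (fun l : ℝ≥0 => 2 * l) (𝓝 0) (𝓝 (2 * 0)) := tendsto_id.const_mul 2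
      rw [mul_zero] at this
      exact this.mono_left nhdsWithin_le_nhds
    · filter_upwards [self_mem_nhdsWithin] with l hl
      have : 0 < l := hl
      exact mem_Ioi.2 (by positivity)
  have h := (hf.2.comp h2).add (hg.2.comp h2)
  rw [add_zero] at h
  refine tendsto_of_tendsto_of_tendsto_of_le_of_le tendsto_const_nhds h (fun _ => zero_le) ?_
  intro l
  calc modular Ω φ (fun x => l * ‖f x + g x‖ₑ)
      ≤ modular Ω φ (fun x => l * ‖f x‖ₑ + l * ‖g x‖ₑ) := by
        refine modular_mono_ae hφ hΩ (Eventually.of_forall fun x => ?_)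
        rw [← mul_add]
        gcongr
        exact enorm_add_le _ _
    _ ≤ modular Ω φ (fun x => 2 * (l * ‖f x‖ₑ)) + modular Ω φ (fun x => 2 * (l * ‖g x‖ₑ)) :=
        modular_add_le hφ hΩ (hf.1.enorm.const_mul _)
    _ = _ := by simp [mul_assoc]

lemma memLphi_zero (hφ : IsWeakPhi Ω φ) (hΩ : IsOpen Ω) : MemLphi Ω φ (fun _ => 0) := by
  refine ⟨aemeasurable_const, ?_⟩
  have : ∀ l : ℝ≥0, modular Ω φ (fun _ => l * ‖(0 : ℝ)‖ₑ) = 0 := by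
    intro l
    refine le_antisymm ?_ zero_le
    calc _ ≤ ∫⁻ x in Ω, 0 := by
          refine lintegral_mono_ae ?_
          filter_upwards [ae_restrict_mem hΩ.measurableSet] with x hx
          simp [hφ.extendPhi_zero hx]
      _ = 0 := by simp
  simp only [this]
  exact tendsto_const_nhds

lemma MemLphi.sum (hφ : IsWeakPhi Ω φ) (hΩ : IsOpen Ω) {ι : Type*} (s : Finset ι)
    {f : ι → Space n → ℝ} (hf : ∀ i ∈ s, MemLphi Ω φ (f i)) :
    MemLphi Ω φ (fun x => ∑ i ∈ s, f i x) := by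
  classical
  induction s using Finset.induction_on with
  | empty => simpa using memLphi_zero hφ hΩ
  | insert i s hi ih =>
    simp only [Finset.sum_insert hi]
    exact (hf i (by simp)).add hφ hΩ (ih fun j hj => hf j (by simp [hj]))

lemma MemLphi.abs (hφ : IsWeakPhi Ω φ) (hΩ : IsOpen Ω) {f : Space n → ℝ}
    (hf : MemLphi Ω φ f) : MemLphi Ω φ (fun x => |f x|) :=
  hf.mono hφ hΩ (by simpa using hf.1.norm) (Eventually.of_forall fun x => by simp)

lemma sum_smul_single (v : Space n) : ∑ k, v k • EuclideanSpace.single k (1 : ℝ) = v := by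
  ext j
  simp [Finset.sum_apply, Pi.single_apply]

lemma norm_le_sum_abs (v : Space n) : ‖v‖ ≤ ∑ k, |v k| := by
  calc ‖v‖ = ‖∑ k, v k • EuclideanSpace.single k (1 : ℝ)‖ := by
        rw [sum_smul_single]
    _ ≤ ∑ k, ‖v k • EuclideanSpace.single k (1 : ℝ)‖ := norm_sum_le _ _
    _ = ∑ k, |v k| := by simp [norm_smul]

lemma memLphi_norm_iff (hφ : IsWeakPhi Ω φ) (hΩ : IsOpen Ω) {g : Space n → Space n}
    (hg : AEMeasurable g (volume.restrict Ω)) :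
    MemLphi Ω φ (fun x => ‖g x‖) ↔ ∀ k, MemLphi Ω φ (fun x => g x k) := by
  have hgk : ∀ k, AEMeasurable (fun x => g x k) (volume.restrict Ω) := fun k =>
    (EuclideanSpace.proj k : Space n →L[ℝ] ℝ).measurable.comp_aemeasurable hg
  constructor
  · intro h k
    refine h.mono hφ hΩ (hgk k) (Eventually.of_forall fun x => ?_)
    rw [enorm_norm]
    exact enorm_le_iff_norm_le.2 (PiLp.norm_apply_le (g x) k)
  · intro h
    have := MemLphi.sum hφ hΩ Finset.univ (f := fun k x => |g x k|) fun k _ => (h k).abs hφ hΩ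
    refine this.mono hφ hΩ hg.norm (Eventually.of_forall fun x => ?_)
    refine enorm_le_iff_norm_le.2 ?_
    rw [norm_norm, Real.norm_of_nonneg (by positivity)]
    exact norm_le_sum_abs _

lemma setLIntegral_le_modular {C : ℝ≥0}
    (hC : ∀ᵐ x ∂(volume.restrict Ω), ∀ t : ℝ≥0∞, t ≤ C * (1 + extendPhi φ x t))
    {S : Set (Space n)} (hS : S ⊆ Ω) (f : Space n → ℝ≥0∞) :
    ∫⁻ x in S, f x ≤ C * (volume S + modular Ω φ f) := by
  calc ∫⁻ x in S, f x ≤ ∫⁻ x in S, C * (1 + extendPhi φ x (f x)) := by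
        refine lintegral_mono_ae ?_
        filter_upwards [ae_restrict_of_ae_restrict_of_subset hS hC] with x hx
        exact hx _
    _ = C * (volume S + ∫⁻ x in S, extendPhi φ x (f x)) := by
        rw [lintegral_const_mul' _ _ ENNReal.coe_ne_top, lintegral_add_left measurable_const]
        simp
    _ ≤ _ := by gcongr; exact lintegral_mono_set hS

/-- Functions in `L^φ(Ω)` are integrable on bounded sets. -/
lemma MemLphi.locallyIntegrableOn (hφ : IsWeakPhi Ω φ) (hΩ : IsOpen Ω) (h0 : WeakA0 Ω φ)
    {f : Space n → ℝ} (hf : MemLphi Ω φ f) : LocallyIntegrableOn f Ω := by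
  obtain ⟨C, hC⟩ := hφ.exists_le_extendPhi hΩ h0
  obtain ⟨c, hc, hc1⟩ := hf.exists_modular_le one_pos
  intro x hx
  refine ⟨Metric.ball x 1 ∩ Ω, inter_mem
    (mem_nhdsWithin_of_mem_nhds (Metric.ball_mem_nhds x one_pos)) self_mem_nhdsWithin, ?_, ?_⟩
  · exact (hf.1.mono_measure (Measure.restrict_mono inter_subset_right le_rfl)).aestronglyMeasurable
  · have h1 := setLIntegral_le_modular hC (inter_subset_right (s := Metric.ball x 1) (t := Ω))
      (fun x => c * ‖f x‖ₑ)
    rw [lintegral_const_mul' _ _ ENNReal.coe_ne_top] at h1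
    have h2 : (C : ℝ≥0∞) *
        (volume (Metric.ball x 1 ∩ Ω) + modular Ω φ (fun x => c * ‖f x‖ₑ)) < ⊤ := by
      refine ENNReal.mul_lt_top ENNReal.coe_lt_top
        (ENNReal.add_lt_top.2 ⟨?_, hc1.trans_lt (by simp)⟩)
      exact (measure_mono inter_subset_left).trans_lt measure_ball_lt_top
    rw [HasFiniteIntegral]
    exact ENNReal.lt_top_of_mul_ne_top_right (h1.trans_lt h2).ne (by simpa using hc.ne')

lemma locallyIntegrableOn_of_components {g : Space n → Space n}
    (h : ∀ k, LocallyIntegrableOn (fun x => g x k) Ω) : LocallyIntegrableOn g Ω := by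
  have hsum : LocallyIntegrableOn
      (fun x => ∑ k, g x k • EuclideanSpace.single k (1 : ℝ)) Ω := by
    intro x hx
    choose U hU hUi using fun k => h k x hx
    refine ⟨⋂ k, U k, iInter_mem.2 hU, ?_⟩
    refine integrable_finsetSum _ fun k _ => ?_
    exact ((hUi k).mono_set (iInter_subset U k)).smul_const _
  refine hsum.congr (Eventually.of_forall fun x => sum_smul_single (g x))

/-! ### Lines parallel to the coordinate axes -/

lemma measurePreserving_insertCoord (k : Fin (n + 1)) :
    MeasurePreserving (fun p : (Fin n → ℝ) × ℝ => insertCoord k p.1 p.2)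
      (volume.prod volume) volume := by
  have h1 := (volume_preserving_piFinSuccAbove (fun _ : Fin (n + 1) => ℝ) k).symm
  have h2 := PiLp.volume_preserving_toLp (Fin (n + 1))
  have h3 : MeasurePreserving (Prod.swap : (Fin n → ℝ) × ℝ → ℝ × (Fin n → ℝ))
    (volume.prod volume) (volume.prod volume) := Measure.measurePreserving_swap
  exact (h2.comp h1).comp h3

lemma measurable_insertCoord (k : Fin (n + 1)) :
    Measurable (fun p : (Fin n → ℝ) × ℝ => insertCoord k p.1 p.2) :=
  (measurePreserving_insertCoord k).measurable

lemma insertCoord_add (k : Fin (n + 1)) (y : Fin n → ℝ) (z t : ℝ) :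
    insertCoord k y (z + t) = insertCoord k y z + t • EuclideanSpace.single k 1 := by
  ext j
  rcases eq_or_ne j k with rfl | hj
  · simp [insertCoord]
  · obtain ⟨i, rfl⟩ := Fin.exists_succAbove_eq hj
    simp [insertCoord]

lemma isometry_insertCoord (k : Fin (n + 1)) (y : Fin n → ℝ) : Isometry (insertCoord k y) := by
  refine Isometry.of_dist_eq fun s t => ?_
  have : insertCoord k y s = insertCoord k y t + (s - t) • EuclideanSpace.single k 1 := by
    rw [← insertCoord_add]; congr 1; ring
  rw [this, dist_eq_norm, Real.dist_eq]
  simp [norm_smul]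

lemma insertCoord_removeNth (k : Fin (n + 1)) (x : Space n) :
    insertCoord k (k.removeNth x.ofLp) (x k) = x := by
  simp [insertCoord]

lemma ae_ae_insertCoord (k : Fin (n + 1)) {p : Space n → Prop} (h : ∀ᵐ x, p x) :
    ∀ᵐ y : Fin n → ℝ, ∀ᵐ z : ℝ, p (insertCoord k y z) :=
  Measure.ae_ae_of_ae_prod ((measurePreserving_insertCoord k).quasiMeasurePreserving.ae h)

lemma lintegral_insertCoord (k : Fin (n + 1)) {f : Space n → ℝ≥0∞} (hf : Measurable f) :
    ∫⁻ x, f x = ∫⁻ y : Fin n → ℝ, ∫⁻ z : ℝ, f (insertCoord k y z) := by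
  rw [← (measurePreserving_insertCoord k).lintegral_comp hf]
  exact lintegral_prod _ (hf.comp (measurable_insertCoord k)).aemeasurable

/-- A Borel set meeting almost every line in a null set is a null set. -/
lemma ae_of_ae_ae_insertCoord (k : Fin (n + 1)) {p : Space n → Prop}
    (hp : MeasurableSet {x | p x})
    (h : ∀ᵐ y : Fin n → ℝ, ∀ᵐ z : ℝ, p (insertCoord k y z)) : ∀ᵐ x, p x := by
  have h1 := lintegral_insertCoord k (measurable_one.indicator hp.compl)
  rw [lintegral_indicator_one hp.compl] at h1
  rw [ae_iff, show {x | ¬ p x} = {x | p x}ᶜ from rfl, h1]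
  refine lintegral_eq_zero_of_ae_eq_zero ?_
  filter_upwards [h] with y hy
  refine lintegral_eq_zero_of_ae_eq_zero ?_
  filter_upwards [hy] with z hz
  simp [indicator, hz]

/-- Almost every point lies on a line taken from a set of almost all lines. -/
lemma ae_removeNth (k : Fin (n + 1)) {p : (Fin n → ℝ) → Prop} (h : ∀ᵐ y, p y) :
    ∀ᵐ x : Space n, p (k.removeNth x.ofLp) := by
  have h1 : ∀ᵐ q : ℝ × (Fin n → ℝ), p q.2 := Measure.quasiMeasurePreserving_snd.ae h
  have h2 := ((volume_preserving_piFinSuccAbove (fun _ : Fin (n + 1) => ℝ) k).comp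
    (PiLp.volume_preserving_ofLp (Fin (n + 1)))).quasiMeasurePreserving.ae h1
  exact h2

lemma exists_Icc_insertCoord_subset (hΩ : IsOpen Ω) (k : Fin (n + 1)) {y : Fin n → ℝ} {z : ℝ}
    (hz : insertCoord k y z ∈ Ω) :
    ∃ a b : ℚ, (a : ℝ) < z ∧ z < b ∧ ∀ s ∈ Icc (a : ℝ) b, insertCoord k y s ∈ Ω := by
  have h : insertCoord k y ⁻¹' Ω ∈ 𝓝 z :=
    (hΩ.preimage (isometry_insertCoord k y).continuous).mem_nhds hz
  obtain ⟨l, u, ⟨hl, hu⟩, hlu⟩ := mem_nhds_iff_exists_Ioo_subset.1 h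
  obtain ⟨a, ha, ha'⟩ := exists_rat_btwn hl
  obtain ⟨b, hb, hb'⟩ := exists_rat_btwn hu
  exact ⟨a, b, ha', hb, fun s hs => hlu ⟨ha.trans_le hs.1, hs.2.trans_lt hb'⟩⟩

lemma lineDeriv_insertCoord {u : Space n → ℝ} {k : Fin (n + 1)} {y : Fin n → ℝ} {z : ℝ} :
    lineDeriv ℝ u (insertCoord k y z) (EuclideanSpace.single k 1) =
      deriv (fun s => u (insertCoord k y s)) z := by
  unfold lineDeriv
  simp only [← insertCoord_add]
  have := deriv_comp_const_add (𝕜 := ℝ) (fun s => u (insertCoord k y s)) z 0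
  simpa using this

/-! ### Segments as curves, and families of modulus zero -/

/-- The segment from `(y, a)_k` to `(y, b)_k`, as a curve parametrized by arc length. -/
def segmentCurve (k : Fin (n + 1)) (y : Fin n → ℝ) (a b : ℝ) (hab : a ≤ b)
    (h : ∀ z ∈ Icc a b, insertCoord k y z ∈ Ω) : RectCurve Ω where
  len := b - a
  len_nonneg := sub_nonneg.2 hab
  toFun t := insertCoord k y (a + t)
  unitSpeed := by
    refine hasConstantSpeedOnWith_iff_ordered.2 fun s hs t ht hst => ?_
    have hiso : Isometry fun t => insertCoord k y (a + t) :=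
      (isometry_insertCoord k y).comp (isometry_add_left a)
    rw [inter_eq_self_of_subset_right (Icc_subset_Icc hs.1 ht.2)]
    have := eVariationOn_id_Icc s t
    simp only [eVariationOn, hiso.edist_eq, id] at this ⊢
    simpa using this
  mapsTo t ht := h _ ⟨by linarith [ht.1], by linarith [ht.2]⟩

lemma segmentCurve_integral (k : Fin (n + 1)) (y : Fin n → ℝ) (a b : ℝ) (hab : a ≤ b)
    (h : ∀ z ∈ Icc a b, insertCoord k y z ∈ Ω) (w : Space n → ℝ≥0∞) :
    (segmentCurve k y a b hab h).integral w = ∫⁻ z in Icc a b, w (insertCoord k y z) := by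
  have := (measurePreserving_add_left (volume : Measure ℝ) a).setLIntegral_comp_preimage_emb
    (measurableEmbedding_addLeft a) (fun z => w (insertCoord k y z)) (Icc a b)
  rw [← this]
  simp [RectCurve.integral, segmentCurve]

/-- A locally integrable function is integrable on the segments of almost every line. -/
lemma ae_lintegral_segment_lt_top (k : Fin (n + 1)) {w : Space n → ℝ≥0∞} (hw : Measurable w)
    (h : ∀ m : ℕ, ∫⁻ x in Metric.ball 0 m, w x < ⊤) :
    ∀ᵐ y : Fin n → ℝ, ∀ a b : ℝ, ∫⁻ z in Icc a b, w (insertCoord k y z) < ⊤ := by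
  have h1 : ∀ᵐ y : Fin n → ℝ, ∀ m : ℕ,
      ∫⁻ z, (Metric.ball (0 : Space n) m).indicator w (insertCoord k y z) < ⊤ := by
    refine ae_all_iff.2 fun m => ?_
    have hm : Measurable ((Metric.ball (0 : Space n) m).indicator w) :=
      hw.indicator measurableSet_ball
    refine ae_lt_top (hm.comp (measurable_insertCoord k)).lintegral_prod_right' ?_
    rw [← lintegral_insertCoord k hm, lintegral_indicator measurableSet_ball]
    exact (h m).ne
  filter_upwards [h1] with y hy a b
  have hc : IsCompact (insertCoord k y '' Icc a b) :=
    isCompact_Icc.image (isometry_insertCoord k y).continuous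
  obtain ⟨r, hr⟩ := hc.isBounded.subset_ball 0
  obtain ⟨m, hm⟩ := exists_nat_ge r
  refine lt_of_le_of_lt ?_ (hy m)
  rw [← lintegral_indicator measurableSet_Icc]
  refine lintegral_mono (indicator_le fun z hz => ?_)
  rw [indicator_of_mem (Metric.ball_subset_ball hm (hr (mem_image_of_mem _ hz)))]

lemma measurable_indicator_of_domRestrict (hΩ : IsOpen Ω) {w : Space n → ℝ≥0∞}
    (hw : Measurable (Ω.domRestrict w)) : Measurable (Ω.indicator w) := by
  refine measurable_of_restrict_of_restrict_compl hΩ.measurableSet ?_ ?_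
  · convert hw using 1
    ext x
    simp [domRestrict]
  · convert (measurable_const : Measurable fun _ : (Ωᶜ : Set (Space n)) => (0 : ℝ≥0∞)) using 1
    ext x
    exact indicator_of_notMem x.2 w

/-- A curve family of modulus zero contains no segment of almost every line. -/
lemma ae_segmentCurve_notMem (hφ : IsWeakPhi Ω φ) (hΩ : IsOpen Ω) (h0 : WeakA0 Ω φ)
    {Γ : Set (RectCurve Ω)} (hΓ : modulus φ Γ = 0) (k : Fin (n + 1)) :
    ∀ᵐ y : Fin n → ℝ, ∀ (a b : ℝ) (hab : a ≤ b) (h : ∀ z ∈ Icc a b, insertCoord k y z ∈ Ω),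
      segmentCurve k y a b hab h ∉ Γ := by
  obtain ⟨C, hC⟩ := hφ.exists_le_extendPhi hΩ h0
  have hw : ∀ j : ℕ, ∃ w : Space n → ℝ≥0∞, Admissible Γ w ∧ ∃ l : ℝ≥0, 0 < l ∧
      modular Ω φ (fun x => w x / l) ≤ 1 ∧ (l : ℝ≥0∞) < 2⁻¹ ^ j := by
    intro j
    have : modulus φ Γ < 2⁻¹ ^ j := by rw [hΓ]; exact ENNReal.pow_pos (by simp) j
    simp only [modulus, luxNorm, iInf_lt_iff] at this
    obtain ⟨w, hw, l, hl, hl1, hlt⟩ := this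
    exact ⟨w, hw, l, hl, hl1, hlt⟩
  choose w hw l hl hl1 hlt using hw
  have hm : ∀ j, Measurable (Ω.indicator (w j)) := fun j =>
    measurable_indicator_of_domRestrict hΩ (hw j).1
  have hW := ae_lintegral_segment_lt_top k (Measurable.tsum hm) fun m => by
    set S := Metric.ball (0 : Space n) m
    have hS : volume S < ⊤ := measure_ball_lt_top
    calc ∫⁻ x in S, ∑' j, Ω.indicator (w j) x = ∑' j, ∫⁻ x in S, Ω.indicator (w j) x :=
          lintegral_tsum fun j => (hm j).aemeasurable
      _ ≤ ∑' j, 2⁻¹ ^ j * (C * (volume S + 1)) := by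
          refine ENNReal.tsum_le_tsum fun j => ?_
          have hl0 : (l j : ℝ≥0∞) ≠ 0 := by simpa using (hl j).ne'
          calc ∫⁻ x in S, Ω.indicator (w j) x = ∫⁻ x in Ω ∩ S, l j * (w j x / l j) := by
                rw [setLIntegral_indicator hΩ.measurableSet]
                simp_rw [ENNReal.mul_div_cancel hl0 ENNReal.coe_ne_top]
            _ = l j * ∫⁻ x in Ω ∩ S, w j x / l j :=
                lintegral_const_mul' _ _ ENNReal.coe_ne_top
            _ ≤ 2⁻¹ ^ j * (C * (volume S + 1)) := by
                gcongr
                · exact (hlt j).le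
                · refine (setLIntegral_le_modular hC inter_subset_left _).trans ?_
                  gcongr
                  · exact inter_subset_right
                  · exact hl1 j
      _ < ⊤ := by
          rw [ENNReal.tsum_mul_right, ENNReal.tsum_geometric, ENNReal.one_sub_inv_two, inv_inv]
          finiteness
  filter_upwards [hW] with y hy a b hab h hmem
  refine (hy a b).ne ?_
  have hmy : ∀ j, Measurable fun z => Ω.indicator (w j) (insertCoord k y z) := fun j =>
    (hm j).comp (isometry_insertCoord k y).continuous.measurable
  rw [lintegral_tsum fun j => (hmy j).aemeasurable]
  refine top_unique ?_
  calc (⊤ : ℝ≥0∞) = ∑' _ : ℕ, 1 := (ENNReal.tsum_const_eq_top_of_ne_zero one_ne_zero).symm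
    _ ≤ _ := ENNReal.tsum_le_tsum fun j => ?_
  have := (hw j).2 _ hmem
  rw [segmentCurve_integral] at this
  refine this.trans (setLIntegral_mono' measurableSet_Icc fun z hz => ?_)
  rw [indicator_of_mem (h z hz)]

/-- Absolute continuity on almost every curve implies absolute continuity on lines. -/
lemma ACC_subset_ACL (hφ : IsWeakPhi Ω φ) (hΩ : IsOpen Ω) (h0 : WeakA0 Ω φ) :
    ACC Ω φ ⊆ ACL Ω := by
  intro u hu k
  filter_upwards [ae_segmentCurve_notMem hφ hΩ h0 hu k] with y hy a b hab h
  have h1 := hy a b hab h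
  simp only [curvesNAC, mem_ofPred_eq, not_not] at h1
  rw [absolutelyContinuousOnInterval_iff] at h1 ⊢
  intro ε hε
  obtain ⟨δ, hδ, H⟩ := h1 ε hε
  refine ⟨δ, hδ, fun E hE hEδ => ?_⟩
  have := H (E.1, fun i => ((E.2 i).1 - a, (E.2 i).2 - a)) ?_ ?_
  · simpa [segmentCurve] using this
  · refine ⟨fun i hi => ?_, fun i hi j hj hij => ?_⟩
    · have := hE.1 i hi
      rw [uIcc_of_le hab] at this
      rw [uIcc_of_le (segmentCurve k y a b hab h).len_nonneg]
      simp only [segmentCurve, mem_Icc] at this ⊢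
      refine ⟨⟨?_, ?_⟩, ?_, ?_⟩ <;> linarith [this.1.1, this.1.2, this.2.1, this.2.2]
    · have := hE.2 hi hj hij
      simp only [Function.onFun] at this ⊢
      rw [Set.disjoint_left] at this ⊢
      intro t ht ht'
      refine @this (t + a) ?_ ?_
      · simp only [mem_uIoc] at ht ⊢
        grind
      · simp only [mem_uIoc] at ht' ⊢
        grind
  · simpa using hEδ

/-! ### Classical partial derivatives of functions in `ACL` -/

/-- The filter of rational numbers tending to `0` without being equal to it. -/
def ratNhds : Filter ℚ := comap (fun r : ℚ => (r : ℝ)) (𝓝[≠] 0)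

instance : ratNhds.IsCountablyGenerated := by unfold ratNhds; infer_instance

lemma tendsto_ratNhds : Tendsto (fun r : ℚ => (r : ℝ)) ratNhds (𝓝[≠] 0) := tendsto_comap

/-- For a function that is continuous near a point, rational difference quotients decide
differentiability. -/
lemma hasDerivAt_of_tendsto_rat {g : ℝ → ℝ} {c : ℝ} (hg : ∀ᶠ t in 𝓝 0, ContinuousAt g t)
    (h : Tendsto (fun r : ℚ => (r : ℝ)⁻¹ * (g r - g 0)) ratNhds (𝓝 c)) : HasDerivAt g c 0 := by
  rw [hasDerivAt_iff_tendsto_slope_zero]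
  refine Metric.tendsto_nhds.2 fun ε hε => ?_
  have h1 := (Metric.tendsto_nhds.1 h) (ε / 2) (half_pos hε)
  rw [ratNhds, eventually_comap, eventually_nhdsWithin_iff] at h1
  rw [eventually_nhdsWithin_iff]
  filter_upwards [hg, h1.eventually_nhds] with t ht ht1 ht0
  have ht0 : t ≠ 0 := ht0
  have hcont : ContinuousAt (fun s => s⁻¹ * (g s - g 0)) t :=
    (continuousAt_inv₀ ht0).mul (ht.sub continuousAt_const)
  have hfreq : ∃ᶠ s in 𝓝 t, s⁻¹ * (g s - g 0) ∈ Metric.closedBall c (ε / 2) := by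
    have hr : ∃ᶠ s in 𝓝 t, s ∈ range ((↑) : ℚ → ℝ) :=
      mem_closure_iff_frequently.1 (Rat.denseRange_cast (𝕜 := ℝ) t)
    refine (hr.and_eventually (ht1.and (isOpen_ne.mem_nhds ht0))).mono ?_
    rintro s ⟨⟨r, rfl⟩, hs, hs0⟩
    exact (hs hs0 r rfl).le
  have := Metric.isClosed_closedBall.mem_of_frequently_of_tendsto hfreq hcont
  simp only [zero_add, smul_eq_mul]
  exact (Metric.mem_closedBall.1 this).trans_lt (half_lt_self hε)

/-- Almost everywhere in `Ω`, all rational translates along an axis avoid a given null set. -/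
lemma ae_rat_translate (hΩ : IsOpen Ω) {u v : Space n → ℝ} (h : u =ᵐ[volume.restrict Ω] v)
    (e : Space n) : ∀ᵐ x, ∀ r : ℚ, x + (r : ℝ) • e ∈ Ω →
      u (x + (r : ℝ) • e) = v (x + (r : ℝ) • e) := by
  rw [EventuallyEq, ae_restrict_iff' hΩ.measurableSet] at h
  exact ae_all_iff.2 fun r =>
    (measurePreserving_add_right volume ((r : ℝ) • e)).quasiMeasurePreserving.ae h

lemma ACL.ae_continuousAt (hΩ : IsOpen Ω) {u : Space n → ℝ} (hu : u ∈ ACL Ω) (k : Fin (n + 1)) :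
    ∀ᵐ y : Fin n → ℝ, ∀ z, insertCoord k y z ∈ Ω →
      ContinuousAt (fun s => u (insertCoord k y s)) z := by
  filter_upwards [hu k] with y hy z hz
  obtain ⟨a, b, haz, hzb, hab⟩ := exists_Icc_insertCoord_subset hΩ k hz
  have hab' : (a : ℝ) ≤ b := (haz.trans hzb).le
  have := (hy a b hab' hab).continuousOn
  rw [uIcc_of_le hab'] at this
  exact this.continuousAt (Icc_mem_nhds haz hzb)

lemma ACL.ae_differentiableAt (hΩ : IsOpen Ω) {u : Space n → ℝ} (hu : u ∈ ACL Ω)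
    (k : Fin (n + 1)) : ∀ᵐ y : Fin n → ℝ, ∀ᵐ z : ℝ, insertCoord k y z ∈ Ω →
      DifferentiableAt ℝ (fun s => u (insertCoord k y s)) z := by
  filter_upwards [hu k] with y hy
  have h1 : ∀ a b : ℚ, ∀ᵐ z : ℝ, (a : ℝ) ≤ b → (∀ s ∈ Icc (a : ℝ) b, insertCoord k y s ∈ Ω) →
      z ∈ Icc (a : ℝ) b → DifferentiableAt ℝ (fun s => u (insertCoord k y s)) z := by
    intro a b
    by_cases hab : (a : ℝ) ≤ b ∧ ∀ s ∈ Icc (a : ℝ) b, insertCoord k y s ∈ Ω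
    · filter_upwards [(hy a b hab.1 hab.2).ae_differentiableAt] with z hz _ _ hzab
      exact hz (by rwa [uIcc_of_le hab.1])
    · exact Eventually.of_forall fun z h h' => absurd ⟨h, h'⟩ hab
  filter_upwards [ae_all_iff.2 fun a => ae_all_iff.2 fun b => h1 a b] with z hz hzΩ
  obtain ⟨a, b, haz, hzb, hab⟩ := exists_Icc_insertCoord_subset hΩ k hzΩ
  exact hz a b (haz.trans hzb).le hab ⟨haz.le, hzb.le⟩

/-- A measurable function in `ACL(Ω)` has partial derivatives almost everywhere. The exceptional
set need not be visibly measurable, so that Fubini's theorem is applied to the set where the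
rational difference quotients of a Borel version converge; on a line on which the function is
continuous this is the same condition. -/
lemma ACL.hasGradientAE (hΩ : IsOpen Ω) {u : Space n → ℝ} (hu : u ∈ ACL Ω)
    (hm : AEMeasurable u (volume.restrict Ω)) : HasGradientAE Ω u := by
  rw [HasGradientAE, ae_restrict_iff' hΩ.measurableSet]
  suffices h : ∀ k : Fin (n + 1), ∀ᵐ x : Space n, x ∈ Ω →
      LineDifferentiableAt ℝ u x (EuclideanSpace.single k 1) by
    filter_upwards [ae_all_iff.2 h] with x hx hxΩ k using hx k hxΩ
  intro k
  set e : Space n := EuclideanSpace.single k 1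
  set v := hm.mk u
  have hv : Measurable v := hm.measurable_mk
  have huv := ae_rat_translate hΩ hm.ae_eq_mk e
  set q : ℚ → Space n → ℝ := fun r x => (r : ℝ)⁻¹ * (v (x + (r : ℝ) • e) - v x)
  have hq : ∀ r, Measurable (q r) := fun r =>
    ((hv.comp (measurable_id.add_const _)).sub hv).const_mul _
  have hconv : ∀ᵐ x, x ∈ Ω → ∃ c, Tendsto (fun r => q r x) ratNhds (𝓝 c) := by
    refine ae_of_ae_ae_insertCoord k ?_ ?_
    · have := hΩ.measurableSet.compl.union (measurableSet_exists_tendsto (l := ratNhds) hq)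
      convert this using 1
      ext x
      simp [imp_iff_not_or]
    · filter_upwards [ACL.ae_differentiableAt hΩ hu k, ae_ae_insertCoord k huv] with y hy hy1
      filter_upwards [hy, hy1] with z hz hz1 hzΩ
      refine ⟨deriv (fun s => u (insertCoord k y s)) z, ?_⟩
      have hd := (hz hzΩ).hasDerivAt
      rw [hasDerivAt_iff_tendsto_slope_zero] at hd
      have hd := hd.comp tendsto_ratNhds
      refine hd.congr' ?_
      have hev : ∀ᶠ t : ℝ in 𝓝[≠] 0, insertCoord k y z + t • e ∈ Ω := by
        have hc : Continuous fun t : ℝ => insertCoord k y z + t • e := by fun_prop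
        refine mem_nhdsWithin_of_mem_nhds ((hΩ.preimage hc).mem_nhds ?_)
        simpa using hzΩ
      filter_upwards [tendsto_ratNhds.eventually hev] with r hr
      have h0 := hz1 0
      simp only [Rat.cast_zero, zero_smul, add_zero] at h0
      simp only [Function.comp_apply, insertCoord_add, smul_eq_mul, q]
      rw [hz1 r hr, h0 hzΩ]
  filter_upwards [hconv, huv, ae_removeNth k (ACL.ae_continuousAt hΩ hu k)] with x hx hx1 hx2 hxΩ
  obtain ⟨c, hc⟩ := hx hxΩ
  have hline : Continuous fun t : ℝ => x + t • e := by fun_prop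
  have hev : ∀ᶠ t : ℝ in 𝓝 0, x + t • e ∈ Ω :=
    (hΩ.preimage hline).mem_nhds (by simpa using hxΩ)
  have hrep : ∀ t : ℝ, insertCoord k (k.removeNth x.ofLp) (x k + t) = x + t • e := fun t => by
    rw [insertCoord_add, insertCoord_removeNth]
  have hder : HasDerivAt (fun t : ℝ => u (x + t • e)) c 0 := by
    refine hasDerivAt_of_tendsto_rat ?_ (hc.congr' ?_)
    · filter_upwards [hev] with t ht
      have h3 := hx2 (x k + t) (by rwa [hrep])
      have h4 : ContinuousAt (fun s : ℝ => x k + s) t := by fun_prop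
      have h5 := ContinuousAt.comp (f := fun s : ℝ => x k + s) h3 h4
      simpa only [Function.comp_def, hrep] using h5
    · filter_upwards [tendsto_ratNhds.eventually (mem_nhdsWithin_of_mem_nhds hev)] with r hr
      have h0 := hx1 0
      simp only [Rat.cast_zero, zero_smul, add_zero] at h0
      simp only [q, zero_smul, add_zero]
      rw [hx1 r hr, h0 hxΩ]
  exact hder.differentiableAt

lemma aemeasurable_classicalGradient (hΩ : IsOpen Ω) {u : Space n → ℝ}
    (hm : AEMeasurable u (volume.restrict Ω)) (hu : HasGradientAE Ω u) :
    AEMeasurable (classicalGradient u) (volume.restrict Ω) := by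
  suffices h : ∀ k : Fin (n + 1), AEMeasurable
      (fun x => lineDeriv ℝ u x (EuclideanSpace.single k 1)) (volume.restrict Ω) from
    (WithLp.measurable_toLp 2 _).comp_aemeasurable (aemeasurable_pi_lambda _ h)
  intro k
  set e : Space n := EuclideanSpace.single k 1
  set v := hm.mk u
  have hv : Measurable v := hm.measurable_mk
  have huv := ae_restrict_of_ae (s := Ω) (ae_rat_translate hΩ hm.ae_eq_mk e)
  let ρ : ℕ → ℚ := fun j => 1 / ((j : ℚ) + 1)
  have hρ : Tendsto (fun j => (ρ j : ℝ)) atTop (𝓝[≠] 0) := by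
    refine tendsto_nhdsWithin_iff.2 ⟨?_, Eventually.of_forall fun j => ?_⟩
    · simpa [ρ] using tendsto_one_div_add_atTop_nhds_zero_nat (𝕜 := ℝ)
    · simp only [ρ, mem_compl_iff, mem_singleton_iff]
      push_cast
      positivity
  refine aemeasurable_of_tendsto_metrizable_ae' (f := fun j x =>
    (ρ j : ℝ)⁻¹ * (v (x + (ρ j : ℝ) • e) - v x)) (fun j =>
      (((hv.comp (measurable_id.add_const _)).sub hv).const_mul _).aemeasurable) ?_
  filter_upwards [hu, huv, ae_restrict_mem hΩ.measurableSet] with x hx hx1 hxΩ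
  have hd := (hx k).hasLineDerivAt
  rw [HasLineDerivAt, hasDerivAt_iff_tendsto_slope_zero] at hd
  refine (hd.comp hρ).congr' ?_
  have hline : Continuous fun t : ℝ => x + t • e := by fun_prop
  have hev : ∀ᶠ t : ℝ in 𝓝 0, x + t • e ∈ Ω :=
    (hΩ.preimage hline).mem_nhds (by simpa using hxΩ)
  filter_upwards [hρ.eventually (mem_nhdsWithin_of_mem_nhds hev)] with j hj
  have h0 := hx1 0
  simp only [Rat.cast_zero, zero_smul, add_zero] at h0
  simp only [Function.comp_apply, zero_add, zero_smul, add_zero, smul_eq_mul]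
  rw [show v (x + (ρ j : ℝ) • e) = _ from (hx1 _ hj).symm, show v x = _ from (h0 hxΩ).symm]

/-! ### Integration by parts on lines -/

/-- Integration by parts on a line, for a function that is absolutely continuous only on the
segments contained in an open set which contains the support of the test function. -/
lemma integral_mul_deriv_eq_neg {U : Set ℝ} (hU : IsOpen U) {f ψ : ℝ → ℝ}
    (hf : ∀ a b : ℝ, a ≤ b → Icc a b ⊆ U → AbsolutelyContinuousOnInterval f a b)
    (hψ : ContDiff ℝ 1 ψ) (hc : HasCompactSupport ψ) (hs : tsupport ψ ⊆ U) :
    ∫ z, f z * deriv ψ z = - ∫ z, deriv f z * ψ z := by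
  have hK : IsCompact (tsupport ψ) := hc
  obtain ⟨δ, hδ, hδU⟩ := hK.exists_cthickening_subset_open hU hs
  obtain ⟨R, hR0, hR⟩ := hK.isBounded.subset_ball_lt 0 0
  obtain ⟨N, hN⟩ := exists_nat_gt (2 * R / δ)
  have hN0 : 0 < (N : ℝ) := lt_of_le_of_lt (by positivity) hN
  have hψ0 : ∀ z ∉ tsupport ψ, ψ z = 0 := fun z hz => image_eq_zero_of_notMem_tsupport hz
  have hψ'0 : ∀ z ∉ tsupport ψ, deriv ψ z = 0 := fun z hz =>
    image_eq_zero_of_notMem_tsupport fun h => hz (tsupport_deriv_subset (𝕜 := ℝ) h)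
  -- each piece of the subdivision has length less than `δ`: it lies in `U` or misses the support
  let p : ℕ → ℝ := fun i => -R + i * (2 * R / N)
  have hp : ∀ i, p i ≤ p (i + 1) := fun i => by
    simp only [p]; push_cast; nlinarith [show 0 ≤ 2 * R / N by positivity]
  have hlen : ∀ i, p (i + 1) - p i ≤ δ := fun i => by
    have h1 : 2 * R / N ≤ δ := by
      rw [div_le_iff₀ hN0, mul_comm δ]; exact ((div_lt_iff₀ hδ).1 hN).le
    calc p (i + 1) - p i = 2 * R / N := by simp only [p]; push_cast; ring
      _ ≤ δ := h1
  have hp0 : p 0 = -R := by simp [p]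
  have hpN : p N = R := by simp only [p]; field_simp; ring
  have hpiece : ∀ i, IntervalIntegrable (fun z => f z * deriv ψ z) volume (p i) (p (i + 1)) ∧
      IntervalIntegrable (fun z => deriv f z * ψ z) volume (p i) (p (i + 1)) ∧
      ∫ z in p i..p (i + 1), f z * deriv ψ z = f (p (i + 1)) * ψ (p (i + 1)) - f (p i) * ψ (p i)
        - ∫ z in p i..p (i + 1), deriv f z * ψ z := by
    intro i
    by_cases hmeet : ∃ z ∈ Icc (p i) (p (i + 1)), z ∈ tsupport ψ
    · obtain ⟨z, hz, hzs⟩ := hmeet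
      have hsub : Icc (p i) (p (i + 1)) ⊆ U := fun s hs' => hδU <| by
        refine Metric.mem_cthickening_of_dist_le s z δ _ hzs ?_
        rw [Real.dist_eq, abs_le]
        constructor <;> linarith [hs'.1, hs'.2, hz.1, hz.2, hlen i]
      have hac := hf _ _ (hp i) hsub
      have hacψ : AbsolutelyContinuousOnInterval ψ (p i) (p (i + 1)) :=
        hψ.contDiffOn.absolutelyContinuousOnInterval
      refine ⟨?_, ?_, hac.integral_mul_deriv_eq_deriv_mul hacψ⟩
      · exact (hac.continuousOn.mul (hψ.continuous_deriv le_rfl).continuousOn).intervalIntegrable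
      · exact hac.intervalIntegrable_deriv.mul_continuousOn hψ.continuous.continuousOn
    · push Not at hmeet
      have h1 : EqOn (fun z => f z * deriv ψ z) 0 (uIcc (p i) (p (i + 1))) := fun z hz => by
        rw [uIcc_of_le (hp i)] at hz
        simp [hψ'0 z (hmeet z hz)]
      have h2 : EqOn (fun z => deriv f z * ψ z) 0 (uIcc (p i) (p (i + 1))) := fun z hz => by
        rw [uIcc_of_le (hp i)] at hz
        simp [hψ0 z (hmeet z hz)]
      refine ⟨?_, ?_, ?_⟩
      · exact (intervalIntegrable_const (c := (0 : ℝ))).congr fun z hz =>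
          (h1 (uIoc_subset_uIcc hz)).symm
      · exact (intervalIntegrable_const (c := (0 : ℝ))).congr fun z hz =>
          (h2 (uIoc_subset_uIcc hz)).symm
      · rw [intervalIntegral.integral_congr h1, intervalIntegral.integral_congr h2,
          hψ0 _ (hmeet _ (left_mem_Icc.2 (hp i))), hψ0 _ (hmeet _ (right_mem_Icc.2 (hp i)))]
        simp
  have hR' : tsupport ψ ⊆ Ioo (-R) R := by simpa [Real.ball_eq_Ioo] using hR
  have hIoc : ∀ g : ℝ → ℝ, (∀ z ∉ tsupport ψ, g z = 0) → ∫ z, g z = ∫ z in (-R)..R, g z := by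
    intro g hg
    rw [intervalIntegral.integral_of_le (by linarith), ← integral_Icc_eq_integral_Ioc]
    exact (setIntegral_eq_integral_of_forall_compl_eq_zero fun z hz =>
      hg z fun h => hz (Ioo_subset_Icc_self (hR' h))).symm
  rw [hIoc _ fun z hz => by simp [hψ'0 z hz], hIoc _ fun z hz => by simp [hψ0 z hz], ← hp0, ← hpN,
    ← intervalIntegral.sum_integral_adjacent_intervals fun i _ => (hpiece i).1,
    ← intervalIntegral.sum_integral_adjacent_intervals fun i _ => (hpiece i).2.1]
  rw [Finset.sum_congr rfl fun i _ => (hpiece i).2.2, Finset.sum_sub_distrib,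
    Finset.sum_range_sub (fun i => f (p i) * ψ (p i))]
  rw [hp0, hpN, hψ0 R fun h => lt_irrefl _ (hR' h).2, hψ0 (-R) fun h => lt_irrefl _ (hR' h).1]
  simp

/-! ### Weak gradients -/

lemma integrable_mul_of_tsupport_subset {f ψ : Space n → ℝ} (hf : LocallyIntegrableOn f Ω)
    (hψ : Continuous ψ) (hc : HasCompactSupport ψ) (hs : tsupport ψ ⊆ Ω) :
    Integrable (fun x => f x * ψ x) := by
  have h1 : IntegrableOn (fun x => f x * ψ x) (tsupport ψ) :=
    (hf.integrableOn_compact_subset hs hc).mul_continuousOn hψ.continuousOn hc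
  refine (integrableOn_iff_integrable_of_support_subset ?_).1 h1
  exact (Function.support_mul_subset_right f ψ).trans (subset_tsupport ψ)

lemma setIntegral_mul_eq {f ψ : Space n → ℝ} (hs : tsupport ψ ⊆ Ω) :
    ∫ x in Ω, f x * ψ x = ∫ x, f x * ψ x :=
  setIntegral_eq_integral_of_forall_compl_eq_zero fun x hx => by
    rw [image_eq_zero_of_notMem_tsupport fun h => hx (hs h), mul_zero]

lemma _root_.MeasureTheory.LocallyIntegrableOn.component {g : Space n → Space n}
    (hg : LocallyIntegrableOn g Ω) (k : Fin (n + 1)) : LocallyIntegrableOn (fun x => g x k) Ω := by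
  intro x hx
  obtain ⟨U, hU, hUi⟩ := hg x hx
  exact ⟨U, hU, (EuclideanSpace.proj k : Space n →L[ℝ] ℝ).integrable_comp hUi⟩

lemma tsupport_partialDeriv_subset (ψ : Space n → ℝ) (e : Space n) :
    tsupport (fun x => fderiv ℝ ψ x e) ⊆ tsupport ψ := by
  refine closure_minimal (fun x hx => ?_) isClosed_closure
  by_contra h
  exact hx (by simp [image_eq_zero_of_notMem_tsupport (fun h' => h (tsupport_fderiv_subset ℝ h'))])

lemma IsWeakGradient.sub {u v : Space n → ℝ} {g h : Space n → Space n}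
    (hu : IsWeakGradient Ω u g) (hv : IsWeakGradient Ω v h) :
    IsWeakGradient Ω (u - v) (g - h) := by
  refine ⟨hu.1.sub hv.1, hu.2.1.sub hv.2.1, fun k ψ hψ hc hs => ?_⟩
  have h1 := hu.2.2 k ψ hψ hc hs
  have h2 := hv.2.2 k ψ hψ hc hs
  have hs' := (tsupport_partialDeriv_subset ψ (EuclideanSpace.single k 1)).trans hs
  have hψ' : Continuous fun x => fderiv ℝ ψ x (EuclideanSpace.single k 1) :=
    (hψ.continuous_fderiv (by simp)).clm_apply continuous_const
  have hc' : HasCompactSupport fun x => fderiv ℝ ψ x (EuclideanSpace.single k 1) :=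
    hc.of_isClosed_subset (isClosed_tsupport _) (tsupport_partialDeriv_subset _ _)
  simp only [Pi.sub_apply, PiLp.sub_apply, sub_mul]
  rw [integral_sub, integral_sub, h1, h2]
  · ring
  · exact (integrable_mul_of_tsupport_subset (hu.2.1.component k) hψ.continuous hc hs).restrict
  · exact (integrable_mul_of_tsupport_subset (hv.2.1.component k) hψ.continuous hc hs).restrict
  · exact (integrable_mul_of_tsupport_subset hu.1 hψ' hc' hs').restrict
  · exact (integrable_mul_of_tsupport_subset hv.1 hψ' hc' hs').restrict

lemma IsWeakGradient.ae_eq (hΩ : IsOpen Ω) {u : Space n → ℝ} {g h : Space n → Space n}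
    (hg : IsWeakGradient Ω u g) (hh : IsWeakGradient Ω u h) : g =ᵐ[volume.restrict Ω] h := by
  have hk : ∀ k, ∀ᵐ x, x ∈ Ω → g x k - h x k = 0 := by
    intro k
    refine hΩ.ae_eq_zero_of_integral_contDiff_smul_eq_zero
      ((hg.2.1.component k).sub (hh.2.1.component k)) fun ψ hψ hc hs => ?_
    have h1 := hg.2.2 k ψ hψ hc hs
    rw [hh.2.2 k ψ hψ hc hs, neg_inj, setIntegral_mul_eq hs, setIntegral_mul_eq hs] at h1
    simp only [smul_eq_mul, sub_mul, mul_comm (ψ _)]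
    rw [integral_sub, h1, sub_self]
    · exact integrable_mul_of_tsupport_subset (hg.2.1.component k) hψ.continuous hc hs
    · exact integrable_mul_of_tsupport_subset (hh.2.1.component k) hψ.continuous hc hs
  rw [EventuallyEq, ae_restrict_iff' hΩ.measurableSet]
  filter_upwards [ae_all_iff.2 hk] with x hx hxΩ
  ext k
  exact sub_eq_zero.1 (hx k hxΩ)

lemma IsWeakGradient.congr {u v : Space n → ℝ} {g : Space n → Space n}
    (hg : IsWeakGradient Ω v g) (hu : LocallyIntegrableOn u Ω)
    (h : u =ᵐ[volume.restrict Ω] v) : IsWeakGradient Ω u g := by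
  refine ⟨hu, hg.2.1, fun k ψ hψ hc hs => ?_⟩
  rw [← hg.2.2 k ψ hψ hc hs]
  refine integral_congr_ae ?_
  filter_upwards [h] with x hx
  rw [hx]

lemma hasDerivAt_insertCoord (k : Fin (n + 1)) (y : Fin n → ℝ) (z : ℝ) :
    HasDerivAt (insertCoord k y) (EuclideanSpace.single k 1) z := by
  have h : insertCoord k y = fun z => insertCoord k y 0 + z • EuclideanSpace.single k 1 := by
    ext1 z
    rw [← insertCoord_add, zero_add]
  rw [h]
  simpa using ((hasDerivAt_id z).smul_const (EuclideanSpace.single k (1 : ℝ))).const_add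
    (insertCoord k y 0)

lemma contDiff_insertCoord (k : Fin (n + 1)) (y : Fin n → ℝ) :
    ContDiff ℝ 1 (insertCoord k y) := by
  have h : insertCoord k y = fun z => insertCoord k y 0 + z • EuclideanSpace.single k 1 := by
    ext1 z
    rw [← insertCoord_add, zero_add]
  rw [h]
  exact contDiff_const.add (contDiff_id.smul contDiff_const)

lemma integral_insertCoord (k : Fin (n + 1)) {f : Space n → ℝ} (hf : Integrable f) :
    ∫ x, f x = ∫ y : Fin n → ℝ, ∫ z : ℝ, f (insertCoord k y z) := by
  have hmp := measurePreserving_insertCoord k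
  have h1 : Integrable (fun p : (Fin n → ℝ) × ℝ => f (insertCoord k p.1 p.2))
      (volume.prod volume) := hmp.integrable_comp_of_integrable hf
  rw [← integral_prod _ h1]
  conv_lhs => rw [← hmp.map_eq]
  exact integral_map hmp.measurable.aemeasurable (by rw [hmp.map_eq]; exact hf.aestronglyMeasurable)

/-- The classical gradient of a function in `ACL(Ω)` is its weak gradient, if both are locally
integrable. -/
lemma ACL.isWeakGradient (hΩ : IsOpen Ω) {u : Space n → ℝ} (hu : u ∈ ACL Ω)
    (hloc : LocallyIntegrableOn u Ω) (hg : LocallyIntegrableOn (classicalGradient u) Ω) :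
    IsWeakGradient Ω u (classicalGradient u) := by
  refine ⟨hloc, hg, fun k ψ hψ hc hs => ?_⟩
  have hs' := (tsupport_partialDeriv_subset ψ (EuclideanSpace.single k 1)).trans hs
  have hψ' : Continuous fun x => fderiv ℝ ψ x (EuclideanSpace.single k 1) :=
    (hψ.continuous_fderiv (by simp)).clm_apply continuous_const
  have hc' : HasCompactSupport fun x => fderiv ℝ ψ x (EuclideanSpace.single k 1) :=
    hc.of_isClosed_subset (isClosed_tsupport _) (tsupport_partialDeriv_subset _ _)
  rw [setIntegral_mul_eq hs', setIntegral_mul_eq hs,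
    integral_insertCoord k (integrable_mul_of_tsupport_subset hloc hψ' hc' hs'),
    integral_insertCoord k
      (integrable_mul_of_tsupport_subset (hg.component k) hψ.continuous hc hs), ← integral_neg]
  refine integral_congr_ae ?_
  filter_upwards [hu k] with y hy
  have hcont := (isometry_insertCoord k y).continuous
  have hder : ∀ z, deriv (fun s => ψ (insertCoord k y s)) z =
      fderiv ℝ ψ (insertCoord k y z) (EuclideanSpace.single k 1) := fun z =>
    (((hψ.differentiable (by simp)) _).hasFDerivAt.comp_hasDerivAt z
      (hasDerivAt_insertCoord k y z)).deriv
  have := integral_mul_deriv_eq_neg (hΩ.preimage hcont) (f := fun s => u (insertCoord k y s))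
    (ψ := fun s => ψ (insertCoord k y s)) (fun a b hab h => hy a b hab h)
    ((hψ.of_le (by simp)).comp (contDiff_insertCoord k y))
    (hc.comp_isClosedEmbedding (isometry_insertCoord k y).isClosedEmbedding)
    ((tsupport_comp_subset_preimage ψ hcont).trans (preimage_mono hs))
  simp only [hder] at this
  rw [this]
  simp only [classicalGradient, lineDeriv_insertCoord]

lemma mem_ACL_of_contDiffOn {v : Space n → ℝ} (hv : ContDiffOn ℝ 1 v Ω) : v ∈ ACL Ω := by
  refine fun k => Eventually.of_forall fun y a b hab h => ?_
  refine ContDiffOn.absolutelyContinuousOnInterval ?_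
  rw [uIcc_of_le hab]
  exact hv.comp (contDiff_insertCoord k y).contDiffOn h

lemma classicalGradient_eq_of_differentiableAt {v : Space n → ℝ} {x : Space n}
    (h : DifferentiableAt ℝ v x) (k : Fin (n + 1)) :
    classicalGradient v x k = fderiv ℝ v x (EuclideanSpace.single k 1) := by
  simp [classicalGradient, h.lineDeriv_eq_fderiv]

lemma continuousOn_classicalGradient (hΩ : IsOpen Ω) {v : Space n → ℝ}
    (hv : ContDiffOn ℝ 1 v Ω) : ContinuousOn (classicalGradient v) Ω := by
  have h1 : ContinuousOn (fun x => WithLp.toLp 2 fun k : Fin (n + 1) =>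
      fderiv ℝ v x (EuclideanSpace.single k 1)) Ω := by
    refine (PiLp.continuous_toLp 2 _).comp_continuousOn (continuousOn_pi.2 fun k => ?_)
    exact (hv.continuousOn_fderiv_of_isOpen hΩ le_rfl).clm_apply continuousOn_const
  refine h1.congr fun x hx => ?_
  ext k
  exact classicalGradient_eq_of_differentiableAt
    ((hv.differentiableOn one_ne_zero).differentiableAt (hΩ.mem_nhds hx)) k

lemma fderiv_apply_eq_inner {v : Space n → ℝ} {x : Space n} (h : DifferentiableAt ℝ v x)
    (e : Space n) : fderiv ℝ v x e = inner ℝ (classicalGradient v x) e := by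
  conv_lhs => rw [← sum_smul_single e]
  rw [map_sum, PiLp.inner_apply]
  refine Finset.sum_congr rfl fun k _ => ?_
  rw [map_smul, ← classicalGradient_eq_of_differentiableAt h]
  simp

lemma norm_fderiv_le {v : Space n → ℝ} {x : Space n} (h : DifferentiableAt ℝ v x) :
    ‖fderiv ℝ v x‖ ≤ ‖classicalGradient v x‖ := by
  refine ContinuousLinearMap.opNorm_le_bound _ (norm_nonneg _) fun e => ?_
  rw [fderiv_apply_eq_inner h]
  exact norm_inner_le_norm _ _

lemma isWeakGradient_of_contDiffOn (hΩ : IsOpen Ω) {v : Space n → ℝ} (hv : ContDiffOn ℝ 1 v Ω) :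
    IsWeakGradient Ω v (classicalGradient v) :=
  ACL.isWeakGradient hΩ (mem_ACL_of_contDiffOn hv)
    (hv.continuousOn.locallyIntegrableOn hΩ.measurableSet)
    ((continuousOn_classicalGradient hΩ hv).locallyIntegrableOn hΩ.measurableSet)

/-! ### Functions along rectifiable curves -/

/-- A bound of the increments by the integral of an integrable function implies absolute
continuity. -/
lemma absolutelyContinuousOnInterval_of_edist_le {f : ℝ → ℝ} {a b : ℝ} (hab : a ≤ b)
    {h : ℝ → ℝ≥0∞} (hint : ∫⁻ r in Icc a b, h r ≠ ⊤)
    (hf : ∀ s t, a ≤ s → s ≤ t → t ≤ b → edist (f s) (f t) ≤ ∫⁻ r in Icc s t, h r) :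
    AbsolutelyContinuousOnInterval f a b := by
  rw [absolutelyContinuousOnInterval_iff]
  intro ε hε
  obtain ⟨δ, hδ, H⟩ := exists_pos_setLIntegral_lt_of_measure_lt hint
    (ENNReal.ofReal_pos.2 hε).ne'
  obtain ⟨δ', hδ'0, hδ'⟩ := ENNReal.lt_iff_exists_real_btwn.1 hδ
  refine ⟨δ', ENNReal.ofReal_pos.1 hδ'.1, fun E hE hEδ => ?_⟩
  set I : ℕ → Set ℝ := fun i => uIoc (E.2 i).1 (E.2 i).2
  have hmem := hE.1
  rw [uIcc_of_le hab] at hmem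
  have hI : ∀ i ∈ Finset.range E.1, I i ⊆ Icc a b := fun i hi t ht => by
    have := hmem i hi
    simp only [I, mem_uIoc] at ht
    simp only [mem_Icc] at this ⊢
    grind
  have hIm : ∀ i ∈ Finset.range E.1, MeasurableSet (I i) := fun i _ => measurableSet_uIoc
  have hone : ∀ i ∈ Finset.range E.1, edist (f (E.2 i).1) (f (E.2 i).2) ≤ ∫⁻ r in I i, h r := by
    intro i hi
    have h1 := hmem i hi
    rcases le_total (E.2 i).1 (E.2 i).2 with hle | hle
    · simp only [I, uIoc_of_le hle]
      rw [restrict_Ioc_eq_restrict_Icc]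
      exact hf _ _ h1.1.1 hle h1.2.2
    · simp only [I, uIoc_of_ge hle]
      rw [restrict_Ioc_eq_restrict_Icc, edist_comm]
      exact hf _ _ h1.2.1 hle h1.1.2
  have hsub : (⋃ i ∈ Finset.range E.1, I i) ⊆ Icc a b := iUnion₂_subset hI
  have hvol : (volume.restrict (Icc a b)) (⋃ i ∈ Finset.range E.1, I i) < δ := by
    rw [Measure.restrict_apply (Finset.measurableSet_biUnion _ hIm),
      inter_eq_self_of_subset_left hsub, measure_biUnion_finset hE.2 hIm]
    refine lt_of_le_of_lt (le_of_eq ?_) ((ENNReal.ofReal_lt_ofReal_iff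
      (ENNReal.ofReal_pos.1 hδ'.1)).2 hEδ |>.trans hδ'.2)
    rw [ENNReal.ofReal_sum_of_nonneg fun i _ => dist_nonneg]
    refine Finset.sum_congr rfl fun i _ => ?_
    simp [uIoc, Real.dist_eq, max_sub_min_eq_abs, abs_sub_comm]
  have hsum : ∑ i ∈ Finset.range E.1, edist (f (E.2 i).1) (f (E.2 i).2) < ENNReal.ofReal ε := by
    refine lt_of_le_of_lt (Finset.sum_le_sum hone) ?_
    rw [← lintegral_biUnion_finset hE.2 hIm h]
    have := H _ hvol
    rwa [Measure.restrict_restrict (Finset.measurableSet_biUnion _ hIm),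
      inter_eq_self_of_subset_left hsub] at this
  simp_rw [edist_dist] at hsum
  rw [← ENNReal.ofReal_sum_of_nonneg fun i _ => dist_nonneg] at hsum
  exact (ENNReal.ofReal_lt_ofReal_iff hε).1 hsum

/-- The mean value inequality along a curve of speed at most one. -/
lemma edist_le_lintegral_classicalGradient {U : Set (Space n)} (hU : IsOpen U) {f : Space n → ℝ}
    (hf : ContDiffOn ℝ 1 f U) {c : ℝ → Space n} (hc : LipschitzWith 1 c) (hcU : ∀ r, c r ∈ U)
    {s t : ℝ} (hst : s ≤ t) :
    edist (f (c s)) (f (c t)) ≤ ∫⁻ r in Icc s t, ‖classicalGradient f (c r)‖ₑ := by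
  have hG : Continuous fun r => classicalGradient f (c r) :=
    (continuousOn_classicalGradient hU hf).comp_continuous hc.continuous hcU
  have hfc : Continuous fun r => f (c r) := hf.continuousOn.comp_continuous hc.continuous hcU
  have hB : ∀ x, HasDerivAt (fun x => ∫ r in s..x, ‖classicalGradient f (c r)‖)
      ‖classicalGradient f (c x)‖ x := fun x =>
    (hG.norm.integral_hasStrictDerivAt s x).hasDerivAt
  have key : ‖f (c t) - f (c s)‖ ≤ ∫ r in s..t, ‖classicalGradient f (c r)‖ := by
    refine image_le_of_liminf_slope_right_le_deriv_boundary
      (f := fun r => ‖f (c r) - f (c s)‖) (a := s) (b := t)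
      (hfc.sub continuous_const).norm.continuousOn (by simp)
      (fun x _ => (hB x).continuousAt.continuousWithinAt) (fun x _ => (hB x).hasDerivWithinAt)
      (fun x _ r hr => ?_) (right_mem_Icc.2 hst)
    have hd : DifferentiableAt ℝ f (c x) :=
      (hf.differentiableOn one_ne_zero).differentiableAt (hU.mem_nhds (hcU x))
    obtain ⟨r', hr1, hr2⟩ := exists_between hr
    have hD : ‖fderiv ℝ f (c x)‖ < r' := (norm_fderiv_le hd).trans_lt hr1
    have h1 : ∀ᶠ y in 𝓝 (c x), ‖f y - f (c x)‖ ≤ r' * ‖y - c x‖ := by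
      have := hd.hasFDerivAt.isLittleO.def (sub_pos.2 hD)
      filter_upwards [this] with y hy
      calc ‖f y - f (c x)‖ ≤ ‖f y - f (c x) - fderiv ℝ f (c x) (y - c x)‖ +
            ‖fderiv ℝ f (c x) (y - c x)‖ := by
            simpa using norm_add_le (f y - f (c x) - fderiv ℝ f (c x) (y - c x))
              (fderiv ℝ f (c x) (y - c x))
        _ ≤ (r' - ‖fderiv ℝ f (c x)‖) * ‖y - c x‖ + ‖fderiv ℝ f (c x)‖ * ‖y - c x‖ :=
            add_le_add hy (ContinuousLinearMap.le_opNorm _ _)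
        _ = r' * ‖y - c x‖ := by ring
    refine Eventually.frequently ?_
    filter_upwards [mem_nhdsWithin_of_mem_nhds (hc.continuous.continuousAt.eventually h1),
      self_mem_nhdsWithin] with z hz hxz
    have hxz : 0 < z - x := sub_pos.2 hxz
    have hr'0 : 0 ≤ r' := (norm_nonneg _).trans hD.le
    rw [slope_def_field, div_lt_iff₀ hxz]
    have hcz : ‖c z - c x‖ ≤ z - x := by
      have := hc.dist_le_mul z x
      rw [dist_eq_norm, Real.dist_eq, abs_of_pos hxz] at this
      simpa using this
    calc ‖f (c z) - f (c s)‖ - ‖f (c x) - f (c s)‖ ≤ ‖f (c z) - f (c x)‖ := by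
          simpa using norm_sub_norm_le (f (c z) - f (c s)) (f (c x) - f (c s))
      _ ≤ r' * ‖c z - c x‖ := hz
      _ ≤ r' * (z - x) := by gcongr
      _ < r * (z - x) := by gcongr
  rw [edist_comm, edist_eq_enorm_sub, ← ofReal_norm]
  refine (ENNReal.ofReal_le_ofReal key).trans (le_of_eq ?_)
  rw [intervalIntegral.integral_of_le hst, ← integral_Icc_eq_integral_Ioc]
  exact ofReal_integral_norm_eq_lintegral_enorm hG.continuousOn.integrableOn_Icc

/-- The extension of a rectifiable curve to `ℝ` that is constant outside `[0, len]`. -/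
def RectCurve.extend (γ : RectCurve Ω) (r : ℝ) : Space n :=
  γ.toFun (projIcc 0 γ.len γ.len_nonneg r)

lemma RectCurve.extend_of_mem (γ : RectCurve Ω) {r : ℝ} (hr : r ∈ Icc 0 γ.len) :
    γ.extend r = γ.toFun r := by
  rw [extend, projIcc_of_mem _ hr]

lemma RectCurve.extend_mem (γ : RectCurve Ω) (r : ℝ) : γ.extend r ∈ Ω :=
  γ.mapsTo (projIcc 0 γ.len γ.len_nonneg r).2

lemma RectCurve.lipschitzWith_extend (γ : RectCurve Ω) : LipschitzWith 1 γ.extend := by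
  have h1 : LipschitzOnWith 1 γ.toFun (Icc 0 γ.len) := by
    intro s hs t ht
    wlog hst : s ≤ t generalizing s t
    · rw [edist_comm, edist_comm s]
      exact this ht hs (not_le.1 hst).le
    have h2 := γ.unitSpeed hs ht
    have h3 := eVariationOn.edist_le γ.toFun (s := Icc 0 γ.len ∩ Icc s t)
      ⟨hs, left_mem_Icc.2 hst⟩ ⟨ht, right_mem_Icc.2 hst⟩
    rw [h2] at h3
    refine h3.trans (le_of_eq ?_)
    rw [edist_comm, edist_dist, Real.dist_eq, abs_of_nonneg (sub_nonneg.2 hst)]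
    simp
  have := h1.to_restrict.comp (LipschitzWith.projIcc γ.len_nonneg)
  rw [one_mul] at this
  exact this

lemma RectCurve.integral_eq_extend (γ : RectCurve Ω) (w : Space n → ℝ≥0∞) :
    γ.integral w = ∫⁻ t in Icc 0 γ.len, w (γ.extend t) :=
  setLIntegral_congr_fun measurableSet_Icc fun t ht => by rw [γ.extend_of_mem ht]

lemma RectCurve.exists_extend_mem (γ : RectCurve Ω) {U : ℕ → Set (Space n)}
    (hU : ∀ m, IsOpen (U m)) (hmono : Monotone U) (hUΩ : ⋃ m, U m = Ω) :
    ∃ M, ∀ r, γ.extend r ∈ U M := by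
  have hK : IsCompact (γ.extend '' Icc 0 γ.len) :=
    isCompact_Icc.image γ.lipschitzWith_extend.continuous
  obtain ⟨M, hM⟩ := hK.elim_directed_cover U hU (by
    rw [hUΩ]; rintro _ ⟨r, -, rfl⟩; exact γ.extend_mem r) hmono.directed_le
  refine ⟨M, fun r => hM ⟨projIcc 0 γ.len γ.len_nonneg r, Subtype.prop _, ?_⟩⟩
  simp [extend]

lemma RectCurve.absolutelyContinuous_of_edist_le (γ : RectCurve Ω) {w : Space n → ℝ}
    {h : ℝ → ℝ≥0∞} (hint : ∫⁻ r in Icc 0 γ.len, h r ≠ ⊤)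
    (hf : ∀ s t, 0 ≤ s → s ≤ t → t ≤ γ.len →
      edist (w (γ.extend s)) (w (γ.extend t)) ≤ ∫⁻ r in Icc s t, h r) :
    AbsolutelyContinuousOnInterval (w ∘ γ.toFun) 0 γ.len := by
  refine absolutelyContinuousOnInterval_of_edist_le γ.len_nonneg hint fun s t hs hst ht => ?_
  have := hf s t hs hst ht
  rwa [γ.extend_of_mem ⟨hs, hst.trans ht⟩, γ.extend_of_mem ⟨hs.trans hst, ht⟩] at this

/-- A family of curves along which a function with finite modular has infinite integral has modulus
zero. -/
lemma modulus_eq_zero (hφ : IsWeakPhi Ω φ) (hΩ : IsOpen Ω) {Γ : Set (RectCurve Ω)}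
    {w : Space n → ℝ≥0∞} (hw : Measurable w) (hmod : modular Ω φ w < ⊤)
    (hΓ : ∀ γ ∈ Γ, γ.integral w = ⊤) : modulus φ Γ = 0 := by
  obtain ⟨L, hL, hLm⟩ := modular_mul_le hφ hΩ
  set A : ℝ≥0 := (modular Ω φ w).toNNReal
  have hA : modular Ω φ w = A := (ENNReal.coe_toNNReal hmod.ne).symm
  have hl0 : (0 : ℝ≥0) < L * A + 1 := by positivity
  have hl : modular Ω φ (fun x => w x / (L * A + 1 : ℝ≥0)) ≤ 1 := by
    have h1 := hLm (L * A + 1)⁻¹ (inv_le_one_of_one_le₀ (by simp)) w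
    simp_rw [div_eq_mul_inv, mul_comm (w _), ← ENNReal.coe_inv hl0.ne']
    refine h1.trans ?_
    rw [hA]
    norm_cast
    rw [mul_right_comm]
    refine (mul_inv_le_iff₀ hl0).2 ?_
    simp
  have hN : ∀ N : ℕ, modulus φ Γ ≤ ((L * A + 1) / (N + 1) : ℝ≥0) := by
    intro N
    have hN0 : (0 : ℝ≥0) < N + 1 := by positivity
    refine (iInf₂_le (fun x => w x / (N + 1 : ℝ≥0)) ⟨?_, fun γ hγ => ?_⟩).trans
      (luxNorm_div_le hl0 hl hN0)
    · exact (hw.div_const _).comp measurable_subtype_coe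
    · have h2 : γ.integral (fun x => w x / (N + 1 : ℝ≥0)) = γ.integral w * (N + 1 : ℝ≥0)⁻¹ := by
        simp only [RectCurve.integral, div_eq_mul_inv]
        rw [lintegral_mul_const' _ _ (by simp), ENNReal.coe_inv hN0.ne']
      rw [h2, hΓ γ hγ, ENNReal.top_mul (by simp)]
      exact le_top
  refine le_antisymm (ge_of_tendsto' (x := atTop) ?_ hN) zero_le
  rw [← ENNReal.coe_zero]
  refine ENNReal.tendsto_coe.2 ?_
  have h := (tendsto_one_div_add_atTop_nhds_zero_nat (𝕜 := ℝ≥0)).const_mul (L * A + 1)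
  simpa [div_eq_mul_inv] using h

/-! ### Limits of smooth approximations along curves -/

/-- Fubini's theorem for an almost everywhere equality between measurable functions on `Ω`. -/
lemma ae_eq_of_ae_ae_insertCoord (hΩ : IsOpen Ω) (k : Fin (n + 1)) {f g : Space n → ℝ}
    (hf : AEMeasurable f (volume.restrict Ω)) (hg : AEMeasurable g (volume.restrict Ω))
    (h : ∀ᵐ y : Fin n → ℝ, ∀ᵐ z : ℝ, insertCoord k y z ∈ Ω →
      f (insertCoord k y z) = g (insertCoord k y z)) : f =ᵐ[volume.restrict Ω] g := by
  have hf' : ∀ᵐ x, x ∈ Ω → f x = hf.mk f x := (ae_restrict_iff' hΩ.measurableSet).1 hf.ae_eq_mk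
  have hg' : ∀ᵐ x, x ∈ Ω → g x = hg.mk g x := (ae_restrict_iff' hΩ.measurableSet).1 hg.ae_eq_mk
  have hmk : ∀ᵐ x, x ∈ Ω → hf.mk f x = hg.mk g x := by
    refine ae_of_ae_ae_insertCoord k ?_ ?_
    · have := hΩ.measurableSet.compl.union
        (measurableSet_eq_fun hf.measurable_mk hg.measurable_mk)
      convert this using 1
      ext x
      simp [imp_iff_not_or]
    · filter_upwards [h, ae_ae_insertCoord k hf', ae_ae_insertCoord k hg'] with y h1 h2 h3
      filter_upwards [h1, h2, h3] with z h1 h2 h3 hz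
      rw [← h2 hz, h1 hz, h3 hz]
  rw [EventuallyEq, ae_restrict_iff' hΩ.measurableSet]
  filter_upwards [hf', hg', hmk] with x h1 h2 h3 hx
  rw [h1 hx, h3 hx, h2 hx]

/-- Rapid modular convergence implies convergence almost everywhere. -/
lemma ae_tendsto_of_modular_le {E : Type*} [NormedAddCommGroup E] (hφ : IsWeakPhi Ω φ)
    (hΩ : IsOpen Ω) (h0 : WeakA0 Ω φ) {U : ℕ → Set (Space n)} (hmono : Monotone U)
    (hUΩ : ⋃ m, U m = Ω) {v : ℕ → Space n → E} {u : Space n → E}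
    (hm : ∀ m, AEMeasurable ((U m).indicator fun x => 2 ^ (m + 4) * ‖v m x - u x‖ₑ)
      (volume.restrict Ω))
    (h : ∀ m, modular Ω φ ((U m).indicator fun x => 2 ^ (m + 4) * ‖v m x - u x‖ₑ) ≤ 2⁻¹ ^ m) :
    ∀ᵐ x ∂(volume.restrict Ω), Tendsto (fun m => v m x) atTop (𝓝 (u x)) := by
  obtain ⟨C, hC⟩ := hφ.exists_le_extendPhi hΩ h0
  set a : ℕ → Space n → ℝ≥0∞ := fun m => (U m).indicator fun x => 2 ^ (m + 4) * ‖v m x - u x‖ₑ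
  have hsum : ∀ᵐ x ∂(volume.restrict Ω), ∑' m, extendPhi φ x (a m x) < ⊤ := by
    refine ae_lt_top' (AEMeasurable.tsum fun m => hφ.measurable _ (hm m)) ?_
    rw [lintegral_tsum fun m => hφ.measurable _ (hm m)]
    refine ((ENNReal.tsum_le_tsum h).trans_lt ?_).ne
    rw [ENNReal.tsum_geometric, ENNReal.one_sub_inv_two, inv_inv]
    finiteness
  filter_upwards [hC, hsum, ae_restrict_mem hΩ.measurableSet] with x hCx hx hxΩ
  obtain ⟨M, hM⟩ := mem_iUnion.1 (hUΩ ▸ hxΩ : x ∈ ⋃ m, U m)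
  set S := ∑' m, extendPhi φ x (a m x)
  have hle : ∀ m ≥ M, edist (v m x) (u x) ≤ 2⁻¹ ^ (m + 4) * (C * (1 + S)) := by
    intro m hmM
    have h1 : a m x = 2 ^ (m + 4) * ‖v m x - u x‖ₑ := indicator_of_mem (hmono hmM hM) _
    have h2 : 2 ^ (m + 4) * ‖v m x - u x‖ₑ ≤ C * (1 + S) := by
      rw [← h1]
      refine (hCx _).trans ?_
      gcongr
      exact ENNReal.le_tsum m
    calc edist (v m x) (u x) = 2⁻¹ ^ (m + 4) * (2 ^ (m + 4) * ‖v m x - u x‖ₑ) := by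
          rw [← mul_assoc, ← mul_pow, ENNReal.inv_mul_cancel (by simp) (by simp), one_pow, one_mul,
            edist_eq_enorm_sub]
      _ ≤ _ := by gcongr
  rw [tendsto_iff_edist_tendsto_0]
  refine tendsto_of_tendsto_of_tendsto_of_le_of_le' tendsto_const_nhds ?_
    (Eventually.of_forall fun _ => zero_le) ((eventually_ge_atTop M).mono hle)
  have h3 : Tendsto (fun m : ℕ => (2⁻¹ : ℝ≥0∞) ^ (m + 4)) atTop (𝓝 0) :=
    (ENNReal.tendsto_pow_atTop_nhds_zero_of_lt_one (by simp)).comp (tendsto_add_atTop_nat 4)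
  have h4 := ENNReal.Tendsto.mul_const (b := C * (1 + S)) h3 (Or.inr (by finiteness))
  simpa using h4

/-- The difference of the consecutive approximations `v m` and `v (m + 1)` on `U m`, together with
that of their gradients. -/
def gap (U : ℕ → Set (Space n)) (v : ℕ → Space n → ℝ) (m : ℕ) : Space n → ℝ≥0∞ :=
  (U m).indicator fun x => ‖v m x - v (m + 1) x‖ₑ +
    ‖classicalGradient (v m) x - classicalGradient (v (m + 1)) x‖ₑ

/-- The sum of the gaps. The exceptional curves are those along which it has infinite integral. -/
def gapSum (U : ℕ → Set (Space n)) (v : ℕ → Space n → ℝ) (x : Space n) : ℝ≥0∞ :=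
  ∑' m, gap U v m x

lemma measurable_indicator_of_continuousOn {f : Space n → ℝ≥0∞} {U : Set (Space n)}
    (hU : IsOpen U) (hf : ContinuousOn f U) : Measurable (U.indicator f) := by
  classical
  rw [← piecewise_eq_indicator]
  exact hf.measurable_piecewise continuousOn_const hU.measurableSet

section Approximation

variable {U : ℕ → Set (Space n)} {v : ℕ → Space n → ℝ}

lemma measurable_gap (hU : ∀ m, IsOpen (U m)) (hmono : Monotone U)
    (hv : ∀ m, ContDiffOn ℝ 1 (v m) (U m)) (m : ℕ) : Measurable (gap U v m) := by
  refine measurable_indicator_of_continuousOn (hU m) ?_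
  have hv' : ContDiffOn ℝ 1 (v (m + 1)) (U m) := (hv (m + 1)).mono (hmono m.le_succ)
  exact ((hv m).continuousOn.sub hv'.continuousOn).enorm.add
    ((continuousOn_classicalGradient (hU m) (hv m)).sub
      (continuousOn_classicalGradient (hU m) hv')).enorm

lemma measurable_gapSum (hU : ∀ m, IsOpen (U m)) (hmono : Monotone U)
    (hv : ∀ m, ContDiffOn ℝ 1 (v m) (U m)) : Measurable (gapSum U v) :=
  Measurable.tsum fun m => measurable_gap hU hmono hv m

lemma modular_gapSum_lt_top (hφ : IsWeakPhi Ω φ) (hΩ : IsOpen Ω) (hmono : Monotone U)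
    {u : Space n → ℝ} {g : Space n → Space n}
    (hm1 : ∀ m, AEMeasurable ((U m).indicator fun x => 2 ^ (m + 4) * ‖v m x - u x‖ₑ)
      (volume.restrict Ω))
    (hm2 : ∀ m, AEMeasurable ((U m).indicator fun x =>
      2 ^ (m + 4) * ‖classicalGradient (v m) x - g x‖ₑ) (volume.restrict Ω))
    (h1 : ∀ m, modular Ω φ ((U m).indicator fun x => 2 ^ (m + 4) * ‖v m x - u x‖ₑ) ≤ 2⁻¹ ^ m)
    (h2 : ∀ m, modular Ω φ ((U m).indicator fun x =>
      2 ^ (m + 4) * ‖classicalGradient (v m) x - g x‖ₑ) ≤ 2⁻¹ ^ m) :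
    modular Ω φ (gapSum U v) < ⊤ := by
  set a : ℕ → Space n → ℝ≥0∞ := fun m => (U m).indicator fun x => 2 ^ (m + 4) * ‖v m x - u x‖ₑ
  set b : ℕ → Space n → ℝ≥0∞ := fun m => (U m).indicator fun x =>
    2 ^ (m + 4) * ‖classicalGradient (v m) x - g x‖ₑ
  -- the error at stage `m`, normalized so that the total error is at most twice the weighted sum
  set e : ℕ → Space n → ℝ≥0∞ := fun m x => 2⁻¹ * a m x + 2⁻¹ * b m x
  have hinv : ∀ t : ℝ≥0∞, 2 * (2⁻¹ * t) = t := fun t => by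
    rw [← mul_assoc, ENNReal.mul_inv_cancel (by simp) (by simp), one_mul]
  have he : ∀ m, modular Ω φ (e m) ≤ 2⁻¹ ^ m + 2⁻¹ ^ m := fun m => by
    refine (modular_add_le hφ hΩ ((hm1 m).const_mul _)).trans ?_
    simp only [hinv]
    exact add_le_add (h1 m) (h2 m)
  have hpow : ∀ (m : ℕ) (t : ℝ≥0∞), 2⁻¹ ^ (m + 2) * (2⁻¹ * (2 ^ (m + 4) * t)) = 2 * t := by
    intro m t
    have : (2 : ℝ≥0∞)⁻¹ ^ (m + 3) * 2 ^ (m + 3) = 1 := by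
      rw [← mul_pow, ENNReal.inv_mul_cancel (by simp) (by simp), one_pow]
    calc (2 : ℝ≥0∞)⁻¹ ^ (m + 2) * (2⁻¹ * (2 ^ (m + 4) * t)) =
          (2⁻¹ ^ (m + 3) * 2 ^ (m + 3)) * (2 * t) := by ring
      _ = 2 * t := by rw [this, one_mul]
  have hle : ∀ x, gapSum U v x ≤ ∑' m, 2⁻¹ ^ (m + 2) * e m x := by
    intro x
    set E : ℕ → ℝ≥0∞ := fun m => (U m).indicator (fun x => ‖v m x - u x‖ₑ +
      ‖classicalGradient (v m) x - g x‖ₑ) x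
    have hE : ∀ m, 2⁻¹ ^ (m + 2) * e m x = 2 * E m := fun m => by
      by_cases hx : x ∈ U m
      · simp only [e, a, b, E, indicator_of_mem hx, mul_add, hpow]
      · simp [e, a, b, E, indicator_of_notMem hx]
    simp_rw [hE]
    calc gapSum U v x ≤ ∑' m, (E m + E (m + 1)) := by
          refine ENNReal.tsum_le_tsum fun m => ?_
          by_cases hx : x ∈ U m
          · have hx' : x ∈ U (m + 1) := hmono m.le_succ hx
            simp only [gap, E, indicator_of_mem hx, indicator_of_mem hx', ← edist_eq_enorm_sub]
            calc _ ≤ (edist (v m x) (u x) + edist (v (m + 1) x) (u x)) +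
                  (edist (classicalGradient (v m) x) (g x) +
                    edist (classicalGradient (v (m + 1)) x) (g x)) :=
                  add_le_add (edist_triangle_right _ _ _) (edist_triangle_right _ _ _)
              _ = _ := by ring
          · simp [gap, indicator_of_notMem hx]
      _ = ∑' m, E m + ∑' m, E (m + 1) := ENNReal.tsum_add
      _ ≤ ∑' m, E m + ∑' m, E m := by
          refine add_le_add le_rfl ?_
          exact ENNReal.tsum_comp_le_tsum_of_injective (add_left_injective 1) E
      _ = ∑' m, 2 * E m := by rw [ENNReal.tsum_mul_left, two_mul]
  calc modular Ω φ (gapSum U v) ≤ modular Ω φ (fun x => ∑' m, 2⁻¹ ^ (m + 2) * e m x) :=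
        modular_mono_ae hφ hΩ (Eventually.of_forall hle)
    _ ≤ ∑' m, modular Ω φ (e m) :=
        modular_tsum_le hφ hΩ fun m => ((hm1 m).const_mul _).add ((hm2 m).const_mul _)
    _ ≤ ∑' m, ((2⁻¹ : ℝ≥0∞) ^ m + 2⁻¹ ^ m) := ENNReal.tsum_le_tsum he
    _ < ⊤ := by
        rw [ENNReal.tsum_add, ENNReal.tsum_geometric, ENNReal.one_sub_inv_two, inv_inv]
        finiteness

lemma enorm_classicalGradient_le (hmono : Monotone U) {M : ℕ} {x : Space n} (hx : x ∈ U M) {j : ℕ}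
    (hj : M ≤ j) :
    ‖classicalGradient (v j) x‖ₑ ≤ ‖classicalGradient (v M) x‖ₑ + gapSum U v x := by
  have h1 : ‖classicalGradient (v j) x‖ₑ ≤
      ‖classicalGradient (v M) x‖ₑ + ∑ m ∈ Finset.range j, gap U v m x := by
    induction j, hj using Nat.le_induction with
    | base => exact le_self_add
    | succ j hj ih =>
      rw [Finset.sum_range_succ, ← add_assoc]
      have hd : ‖classicalGradient (v (j + 1)) x - classicalGradient (v j) x‖ₑ ≤ gap U v j x := by
        simp only [gap, indicator_of_mem (hmono hj hx)]
        rw [← edist_eq_enorm_sub, edist_comm, edist_eq_enorm_sub]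
        exact le_add_self
      calc ‖classicalGradient (v (j + 1)) x‖ₑ ≤ ‖classicalGradient (v j) x‖ₑ +
            ‖classicalGradient (v (j + 1)) x - classicalGradient (v j) x‖ₑ := by
            simpa using enorm_add_le (classicalGradient (v j) x)
              (classicalGradient (v (j + 1)) x - classicalGradient (v j) x)
        _ ≤ _ := add_le_add ih hd
  refine h1.trans ?_
  gcongr
  exact ENNReal.sum_le_tsum _

lemma classicalGradient_sub {f g : Space n → ℝ} {x : Space n} (hf : DifferentiableAt ℝ f x)
    (hg : DifferentiableAt ℝ g x) :
    classicalGradient (fun x => f x - g x) x = classicalGradient f x - classicalGradient g x := by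
  ext k
  rw [PiLp.sub_apply, classicalGradient_eq_of_differentiableAt hf,
    classicalGradient_eq_of_differentiableAt hg,
    classicalGradient_eq_of_differentiableAt (hf.fun_sub hg), fderiv_fun_sub hf hg]
  rfl

/-- Along a curve of positive length with finite integral of `gapSum`, the approximations
converge. -/
lemma tendsto_along_curve (hU : ∀ m, IsOpen (U m)) (hmono : Monotone U) (hUΩ : ⋃ m, U m = Ω)
    (hv : ∀ m, ContDiffOn ℝ 1 (v m) (U m)) {γ : RectCurve Ω} (hlen : 0 < γ.len)
    (hγ : γ.integral (gapSum U v) ≠ ⊤) {t : ℝ} (ht : t ∈ Icc 0 γ.len) :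
    Tendsto (fun m => v m (γ.extend t)) atTop (𝓝 (limUnder atTop fun m => v m (γ.extend t))) := by
  obtain ⟨M, hM⟩ := γ.exists_extend_mem hU hmono hUΩ
  have hlip := γ.lipschitzWith_extend
  have hmeas := measurable_gapSum hU hmono hv
  have hdm := measurable_gap hU hmono hv
  set d := gap U v
  rw [γ.integral_eq_extend] at hγ
  -- one point at which the approximations converge
  obtain ⟨t₀, ht₀, hfin⟩ : ∃ t₀ ∈ Icc 0 γ.len, gapSum U v (γ.extend t₀) < ⊤ := by
    have h1 := ae_lt_top (hmeas.comp hlip.continuous.measurable) hγ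
    have h2 : ∀ᵐ r ∂(volume.restrict (Icc 0 γ.len)), r ∈ Icc 0 γ.len :=
      ae_restrict_mem measurableSet_Icc
    have hne : (ae (volume.restrict (Icc 0 γ.len))).NeBot := by
      rw [ae_neBot, Ne, Measure.restrict_eq_zero]
      simp [hlen]
    obtain ⟨t₀, ht1, ht2⟩ := (h2.and h1).exists
    exact ⟨t₀, ht1, ht2⟩
  suffices hcau : CauchySeq fun j => v (M + j) (γ.extend t) by
    have hcau' : CauchySeq fun m => v m (γ.extend t) := by
      obtain ⟨l, hl⟩ := cauchySeq_tendsto_of_complete hcau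
      simp_rw [add_comm M] at hl
      exact ((tendsto_add_atTop_iff_nat M).1 hl).cauchySeq
    exact hcau'.tendsto_limUnder
  refine cauchySeq_of_edist_le_of_tsum_ne_top
    (fun j => d (M + j) (γ.extend t₀) + ∫⁻ r in Icc 0 γ.len, d (M + j) (γ.extend r)) ?_ ?_
  · intro j
    set m := M + j
    have hUm : ∀ r, γ.extend r ∈ U m := fun r => hmono (Nat.le_add_right M j) (hM r)
    have hv' : ContDiffOn ℝ 1 (v (m + 1)) (U m) := (hv (m + 1)).mono (hmono m.le_succ)
    have hdiff : ∀ {f : Space n → ℝ}, ContDiffOn ℝ 1 f (U m) → ∀ r,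
        DifferentiableAt ℝ f (γ.extend r) := fun hf r =>
      (hf.differentiableOn one_ne_zero).differentiableAt ((hU m).mem_nhds (hUm r))
    have hmain : ∀ s s' : ℝ, s ∈ Icc 0 γ.len → s' ∈ Icc 0 γ.len → s ≤ s' →
        edist (v m (γ.extend s) - v (m + 1) (γ.extend s))
          (v m (γ.extend s') - v (m + 1) (γ.extend s')) ≤
        ∫⁻ r in Icc 0 γ.len, d m (γ.extend r) := by
      intro s s' hs hs' hss'
      refine (edist_le_lintegral_classicalGradient (hU m)
        (f := fun x => v m x - v (m + 1) x) ((hv m).sub hv') hlip hUm hss').trans ?_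
      refine (lintegral_mono_set (Icc_subset_Icc hs.1 hs'.2)).trans (lintegral_mono fun r => ?_)
      rw [classicalGradient_sub (hdiff (hv m) r) (hdiff hv' r)]
      simp only [d, gap, indicator_of_mem (hUm r)]
      exact le_add_self
    have hdist : edist (v m (γ.extend t) - v (m + 1) (γ.extend t))
        (v m (γ.extend t₀) - v (m + 1) (γ.extend t₀)) ≤
        ∫⁻ r in Icc 0 γ.len, d m (γ.extend r) := by
      rcases le_total t t₀ with h | h
      · exact hmain t t₀ ht ht₀ h
      · rw [edist_comm]
        exact hmain t₀ t ht₀ ht h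
    have hd0 : edist (v m (γ.extend t₀) - v (m + 1) (γ.extend t₀)) 0 ≤ d m (γ.extend t₀) := by
      simp only [d, gap, indicator_of_mem (hUm t₀), edist_zero_right]
      exact le_self_add
    calc edist (v m (γ.extend t)) (v (m + 1) (γ.extend t))
        = edist (v m (γ.extend t) - v (m + 1) (γ.extend t)) 0 := by
          rw [edist_eq_enorm_sub, edist_zero_right]
      _ ≤ _ := (edist_triangle _ _ _).trans (add_le_add hdist hd0)
      _ = _ := add_comm _ _
  · have hinj : Function.Injective fun j => M + j := add_right_injective M
    rw [ENNReal.tsum_add]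
    refine ENNReal.add_ne_top.2 ⟨?_, ?_⟩
    · exact ((ENNReal.tsum_comp_le_tsum_of_injective hinj fun m => d m (γ.extend t₀)).trans_lt
        hfin).ne
    · refine ((ENNReal.tsum_comp_le_tsum_of_injective hinj fun m =>
        ∫⁻ r in Icc 0 γ.len, d m (γ.extend r)).trans_lt (lt_top_iff_ne_top.2 ?_)).ne
      have hdγ : ∀ m, Measurable fun r => d m (γ.extend r) := fun m =>
        (hdm m).comp hlip.continuous.measurable
      rwa [← lintegral_tsum fun m => (hdγ m).aemeasurable]

/-- Along a curve with finite integral of `gapSum`, the limit of the approximations is absolutely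
continuous. -/
lemma absolutelyContinuous_limUnder (hU : ∀ m, IsOpen (U m)) (hmono : Monotone U)
    (hUΩ : ⋃ m, U m = Ω) (hv : ∀ m, ContDiffOn ℝ 1 (v m) (U m)) {γ : RectCurve Ω}
    (hγ : γ.integral (gapSum U v) ≠ ⊤) :
    AbsolutelyContinuousOnInterval ((fun x => limUnder atTop fun m => v m x) ∘ γ.toFun) 0
      γ.len := by
  obtain ⟨M, hM⟩ := γ.exists_extend_mem hU hmono hUΩ
  have hlip := γ.lipschitzWith_extend
  have hG : Continuous fun r => classicalGradient (v M) (γ.extend r) :=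
    (continuousOn_classicalGradient (hU M) (hv M)).comp_continuous hlip.continuous hM
  refine γ.absolutelyContinuous_of_edist_le
    (h := fun r => ‖classicalGradient (v M) (γ.extend r)‖ₑ + gapSum U v (γ.extend r)) ?_ ?_
  · rw [lintegral_add_left hG.enorm.measurable, ← γ.integral_eq_extend]
    exact ENNReal.add_ne_top.2 ⟨(hG.continuousOn.integrableOn_Icc.hasFiniteIntegral).ne, hγ⟩
  · intro s t hs hst ht
    rcases γ.len_nonneg.eq_or_lt with hlen | hlen
    · rw [show s = t by linarith]
      simp
    refine le_of_tendsto ((tendsto_along_curve hU hmono hUΩ hv hlen hγ ⟨hs, hst.trans ht⟩).edist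
      (tendsto_along_curve hU hmono hUΩ hv hlen hγ ⟨hs.trans hst, ht⟩)) ?_
    filter_upwards [eventually_ge_atTop M] with j hj
    refine (edist_le_lintegral_classicalGradient (hU j) (hv j) hlip
      (fun r => hmono hj (hM r)) hst).trans (lintegral_mono fun r => ?_)
    exact enorm_classicalGradient_le hmono (hM r) hj

end Approximation

section Approximation

variable {U : ℕ → Set (Space n)} {v : ℕ → Space n → ℝ}

/-- On a segment that is not exceptional, the limit of the approximations is the primitive of the
limit of their partial derivatives. -/
lemma sub_eq_integral_of_segment (hU : ∀ m, IsOpen (U m)) (hmono : Monotone U)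
    (hUΩ : ⋃ m, U m = Ω) (hv : ∀ m, ContDiffOn ℝ 1 (v m) (U m)) {g : Space n → Space n}
    (k : Fin (n + 1)) {y : Fin n → ℝ} {a b : ℝ} (hab : a < b)
    (hseg : ∀ z ∈ Icc a b, insertCoord k y z ∈ Ω)
    (hγ : (segmentCurve k y a b hab.le hseg).integral (gapSum U v) ≠ ⊤)
    (hg : ∀ᵐ z : ℝ, insertCoord k y z ∈ Ω → Tendsto (fun m => classicalGradient (v m)
      (insertCoord k y z)) atTop (𝓝 (g (insertCoord k y z)))) :
    IntervalIntegrable (fun z => g (insertCoord k y z) k) volume a b ∧ ∀ t ∈ Icc a b,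
      (limUnder atTop fun m => v m (insertCoord k y t)) -
        (limUnder atTop fun m => v m (insertCoord k y a)) =
      ∫ z in a..t, g (insertCoord k y z) k := by
  set γ := segmentCurve k y a b hab.le hseg with hγdef
  have hext : ∀ z ∈ Icc a b, γ.extend (z - a) = insertCoord k y z := fun z hz => by
    have h1 : z - a ∈ Icc 0 γ.len := ⟨sub_nonneg.2 hz.1, sub_le_sub_right hz.2 a⟩
    rw [γ.extend_of_mem h1]
    simp [γ, segmentCurve]
  have hlen : 0 < γ.len := sub_pos.2 hab
  obtain ⟨M, hM⟩ := γ.exists_extend_mem hU hmono hUΩ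
  have hMz : ∀ z ∈ Icc a b, insertCoord k y z ∈ U M := fun z hz => hext z hz ▸ hM _
  have hlim : ∀ t ∈ Icc a b, Tendsto (fun m => v m (insertCoord k y t)) atTop
      (𝓝 (limUnder atTop fun m => v m (insertCoord k y t))) := fun t ht => by
    have := tendsto_along_curve hU hmono hUΩ hv hlen hγ (t := t - a)
      ⟨sub_nonneg.2 ht.1, sub_le_sub_right ht.2 a⟩
    rwa [hext t ht] at this
  have hcont : ∀ j ≥ M, ContinuousOn (fun z => classicalGradient (v j) (insertCoord k y z))
      (Icc a b) := fun j hj => (continuousOn_classicalGradient (hU j) (hv j)).comp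
    (isometry_insertCoord k y).continuous.continuousOn fun z hz => hmono hj (hMz z hz)
  have hcontk : ∀ j ≥ M, ContinuousOn (fun z => classicalGradient (v j) (insertCoord k y z) k)
      (Icc a b) := fun j hj =>
    (EuclideanSpace.proj k : Space n →L[ℝ] ℝ).continuous.comp_continuousOn (hcont j hj)
  -- the common bound for the partial derivatives
  set B : ℝ → ℝ≥0∞ := fun z => ‖classicalGradient (v M) (insertCoord k y z)‖ₑ +
    gapSum U v (insertCoord k y z)
  have hBm : AEMeasurable B (volume.restrict (Icc a b)) :=
    ((hcont M le_rfl).enorm.aemeasurable measurableSet_Icc).add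
      ((measurable_gapSum hU hmono hv).comp
        (isometry_insertCoord k y).continuous.measurable).aemeasurable
  have hBint : ∫⁻ z in Icc a b, B z ≠ ⊤ := by
    rw [lintegral_add_left' ((hcont M le_rfl).enorm.aemeasurable measurableSet_Icc),
      ← segmentCurve_integral k y a b hab.le hseg]
    exact ENNReal.add_ne_top.2 ⟨((hcont M le_rfl).integrableOn_Icc.hasFiniteIntegral).ne, hγ⟩
  have hBfin : ∀ᵐ z, z ∈ Icc a b → B z < ⊤ :=
    (ae_restrict_iff' measurableSet_Icc).1 (ae_lt_top' hBm hBint)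
  have hBreal : IntegrableOn (fun z => (B z).toReal) (Icc a b) :=
    integrable_toReal_of_lintegral_ne_top hBm hBint
  have hle : ∀ j ≥ M, ∀ᵐ z, z ∈ Icc a b →
      ‖classicalGradient (v j) (insertCoord k y z) k‖ ≤ (B z).toReal := fun j hj => by
    filter_upwards [hBfin] with z hz hzab
    have h1 := enorm_classicalGradient_le (v := v) hmono (hMz z hzab) hj
    have h2 := ENNReal.toReal_mono (hz hzab).ne h1
    rw [toReal_enorm] at h2
    exact (PiLp.norm_apply_le _ k).trans h2
  have hgk : ∀ᵐ z, z ∈ Icc a b → Tendsto (fun m => classicalGradient (v m) (insertCoord k y z) k)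
      atTop (𝓝 (g (insertCoord k y z) k)) := by
    filter_upwards [hg] with z hz hzab
    exact ((EuclideanSpace.proj k : Space n →L[ℝ] ℝ).continuous.tendsto _).comp
      (hz (hseg z hzab))
  have hgint : IntegrableOn (fun z => g (insertCoord k y z) k) (Icc a b) := by
    refine Integrable.mono' hBreal ?_ ?_
    · refine aestronglyMeasurable_of_tendsto_ae atTop
        (f := fun j z => classicalGradient (v (j + M)) (insertCoord k y z) k)
        (fun j => (hcontk _ (Nat.le_add_left M j)).aestronglyMeasurable measurableSet_Icc) ?_
      rw [ae_restrict_iff' measurableSet_Icc]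
      filter_upwards [hgk] with z hz hzab
      exact (hz hzab).comp (tendsto_add_atTop_nat M)
    · rw [ae_restrict_iff' measurableSet_Icc]
      have hall : ∀ᵐ z, ∀ j ≥ M, z ∈ Icc a b →
          ‖classicalGradient (v j) (insertCoord k y z) k‖ ≤ (B z).toReal := by
        refine ae_all_iff.2 fun j => ?_
        by_cases hj : M ≤ j
        · filter_upwards [hle j hj] with z hz _ using hz
        · exact Eventually.of_forall fun z h => absurd h hj
      filter_upwards [hgk, hall] with z hz hz' hzab
      refine le_of_tendsto (hz hzab).norm ?_
      filter_upwards [eventually_ge_atTop M] with j hj using hz' j hj hzab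
  refine ⟨(intervalIntegrable_iff_integrableOn_Icc_of_le hab.le).2 hgint, fun t ht => ?_⟩
  have hsub : uIoc a t ⊆ Icc a b := by
    rw [uIoc_of_le ht.1]
    exact fun z hz => ⟨hz.1.le, hz.2.trans ht.2⟩
  have hsub' : uIcc a t ⊆ Icc a b := by
    rw [uIcc_of_le ht.1]
    exact Icc_subset_Icc_right ht.2
  have hftc : ∀ j ≥ M, ∫ z in a..t, classicalGradient (v j) (insertCoord k y z) k =
      v j (insertCoord k y t) - v j (insertCoord k y a) := by
    intro j hj
    refine intervalIntegral.integral_eq_sub_of_hasDerivAt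
      (f := fun z => v j (insertCoord k y z)) (fun z hz => ?_)
      ((hcontk j hj).mono hsub').intervalIntegrable
    have hd : DifferentiableAt ℝ (v j) (insertCoord k y z) :=
      ((hv j).differentiableOn one_ne_zero).differentiableAt
        ((hU j).mem_nhds (hmono hj (hMz z (hsub' hz))))
    rw [classicalGradient_eq_of_differentiableAt hd]
    exact hd.hasFDerivAt.comp_hasDerivAt z (hasDerivAt_insertCoord k y z)
  have hdct : Tendsto (fun j => ∫ z in a..t, classicalGradient (v j) (insertCoord k y z) k) atTop
      (𝓝 (∫ z in a..t, g (insertCoord k y z) k)) := by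
    refine intervalIntegral.tendsto_integral_filter_of_dominated_convergence
      (fun z => (B z).toReal) ?_ ?_ ?_ ?_
    · filter_upwards [eventually_ge_atTop M] with j hj
      exact ((hcontk j hj).mono hsub).aestronglyMeasurable measurableSet_uIoc
    · filter_upwards [eventually_ge_atTop M] with j hj
      filter_upwards [hle j hj] with z hz hzt using hz (hsub hzt)
    · exact (intervalIntegrable_iff_integrableOn_Icc_of_le ht.1).2
        (hBreal.mono_set (Icc_subset_Icc_right ht.2))
    · filter_upwards [hgk] with z hz hzt using hz (hsub hzt)
  refine tendsto_nhds_unique ((hlim t ht).sub (hlim a (left_mem_Icc.2 hab.le))) (hdct.congr' ?_)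
  filter_upwards [eventually_ge_atTop M] with j hj using hftc j hj

/-- On a line without exceptional segments, the limit of the approximations has partial derivative
`g x k` at almost every point, by Lebesgue's differentiation theorem. -/
lemma ae_lineDeriv_limUnder (hΩ : IsOpen Ω) (hU : ∀ m, IsOpen (U m)) (hmono : Monotone U)
    (hUΩ : ⋃ m, U m = Ω) (hv : ∀ m, ContDiffOn ℝ 1 (v m) (U m)) {g : Space n → Space n}
    (k : Fin (n + 1)) {y : Fin n → ℝ}
    (hγ : ∀ (a b : ℝ) (hab : a ≤ b) (hseg : ∀ z ∈ Icc a b, insertCoord k y z ∈ Ω),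
      (segmentCurve k y a b hab hseg).integral (gapSum U v) ≠ ⊤)
    (hg : ∀ᵐ z : ℝ, insertCoord k y z ∈ Ω → Tendsto (fun m => classicalGradient (v m)
      (insertCoord k y z)) atTop (𝓝 (g (insertCoord k y z)))) :
    ∀ᵐ z : ℝ, insertCoord k y z ∈ Ω →
      lineDeriv ℝ (fun x => limUnder atTop fun m => v m x) (insertCoord k y z)
        (EuclideanSpace.single k 1) = g (insertCoord k y z) k := by
  set w : Space n → ℝ := fun x => limUnder atTop fun m => v m x
  have h1 : ∀ a b : ℚ, ∀ᵐ z : ℝ, (∀ s ∈ Icc (a : ℝ) b, insertCoord k y s ∈ Ω) →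
      z ∈ Ioo (a : ℝ) b → deriv (fun s => w (insertCoord k y s)) z = g (insertCoord k y z) k := by
    intro a b
    by_cases hab : (a : ℝ) < b ∧ ∀ s ∈ Icc (a : ℝ) b, insertCoord k y s ∈ Ω
    · obtain ⟨hint, hsub⟩ := sub_eq_integral_of_segment hU hmono hUΩ hv k hab.1 hab.2
        (hγ a b hab.1.le hab.2) hg
      filter_upwards [hint.ae_hasDerivAt_integral] with z hz _ hzab
      have h2 := (hz (by rw [uIcc_of_le hab.1.le]; exact Ioo_subset_Icc_self hzab) a (by simp))
        |>.const_add (w (insertCoord k y a))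
      refine (h2.congr_of_eventuallyEq ?_).deriv
      filter_upwards [isOpen_Ioo.mem_nhds hzab] with t ht
      rw [← hsub t (Ioo_subset_Icc_self ht)]
      simp [w]
    · refine Eventually.of_forall fun z h h' => absurd ⟨h'.1.trans h'.2, h⟩ hab
  filter_upwards [ae_all_iff.2 fun a => ae_all_iff.2 fun b => h1 a b] with z hz hzΩ
  obtain ⟨a, b, haz, hzb, hab⟩ := exists_Icc_insertCoord_subset hΩ k hzΩ
  rw [lineDeriv_insertCoord]
  exact hz a b hab ⟨haz, hzb⟩

end Approximation

/-- A function which, together with a vector field `g`, is rapidly approximated by `C¹` functions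
and their gradients has a representative that is absolutely continuous on almost every curve and
has classical gradient `g`. The approximations need only be defined on an exhaustion of `Ω`. -/
theorem exists_mem_ACC_of_approximation (hφ : IsWeakPhi Ω φ) (hΩ : IsOpen Ω) (h0 : WeakA0 Ω φ)
    {U : ℕ → Set (Space n)} {v : ℕ → Space n → ℝ} (hU : ∀ m, IsOpen (U m)) (hmono : Monotone U)
    (hUΩ : ⋃ m, U m = Ω) (hv : ∀ m, ContDiffOn ℝ 1 (v m) (U m))
    {u : Space n → ℝ} {g : Space n → Space n} (hu : AEMeasurable u (volume.restrict Ω))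
    (hg : AEMeasurable g (volume.restrict Ω))
    (h1 : ∀ m, modular Ω φ ((U m).indicator fun x => 2 ^ (m + 4) * ‖v m x - u x‖ₑ) ≤ 2⁻¹ ^ m)
    (h2 : ∀ m, modular Ω φ ((U m).indicator fun x =>
      2 ^ (m + 4) * ‖classicalGradient (v m) x - g x‖ₑ) ≤ 2⁻¹ ^ m) :
    ∃ w ∈ ACC Ω φ, u =ᵐ[volume.restrict Ω] w ∧ classicalGradient w =ᵐ[volume.restrict Ω] g := by
  have hsub : ∀ m, (volume.restrict Ω).restrict (U m) = volume.restrict (U m) := fun m => by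
    rw [Measure.restrict_restrict (hU m).measurableSet,
      inter_eq_self_of_subset_left (hUΩ ▸ subset_iUnion U m)]
  have hle : ∀ m, volume.restrict (U m) ≤ volume.restrict Ω := fun m =>
    Measure.restrict_mono (hUΩ ▸ subset_iUnion U m) le_rfl
  have hm1 : ∀ m, AEMeasurable ((U m).indicator fun x => 2 ^ (m + 4) * ‖v m x - u x‖ₑ)
      (volume.restrict Ω) := fun m => by
    rw [aemeasurable_indicator_iff (hU m).measurableSet, hsub]
    exact ((((hv m).continuousOn.aemeasurable (hU m).measurableSet).sub
      (hu.mono_measure (hle m))).enorm).const_mul _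
  have hm2 : ∀ m, AEMeasurable ((U m).indicator fun x =>
      2 ^ (m + 4) * ‖classicalGradient (v m) x - g x‖ₑ) (volume.restrict Ω) := fun m => by
    rw [aemeasurable_indicator_iff (hU m).measurableSet, hsub]
    exact (((((continuousOn_classicalGradient (hU m) (hv m))).aemeasurable
      (hU m).measurableSet).sub (hg.mono_measure (hle m))).enorm).const_mul _
  set w : Space n → ℝ := fun x => limUnder atTop fun m => v m x
  have hmod := modular_gapSum_lt_top hφ hΩ hmono hm1 hm2 h1 h2
  have hmeas := measurable_gapSum hU hmono hv
  have hexc : modulus φ {γ : RectCurve Ω | γ.integral (gapSum U v) = ⊤} = 0 :=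
    modulus_eq_zero hφ hΩ hmeas hmod fun γ hγ => hγ
  have hACC : w ∈ ACC Ω φ := by
    refine modulus_eq_zero hφ hΩ hmeas hmod fun γ hγ => ?_
    by_contra h
    exact hγ (absolutelyContinuous_limUnder hU hmono hUΩ hv h)
  have huw : u =ᵐ[volume.restrict Ω] w := by
    filter_upwards [ae_tendsto_of_modular_le hφ hΩ h0 hmono hUΩ hm1 h1] with x hx
    exact hx.limUnder_eq.symm
  refine ⟨w, hACC, huw, ?_⟩
  have hACL := ACC_subset_ACL hφ hΩ h0 hACC
  have hwm : AEMeasurable w (volume.restrict Ω) := hu.congr huw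
  have hcg := aemeasurable_classicalGradient hΩ hwm (ACL.hasGradientAE hΩ hACL hwm)
  have hgrad : ∀ᵐ x, x ∈ Ω → Tendsto (fun m => classicalGradient (v m) x) atTop (𝓝 (g x)) :=
    (ae_restrict_iff' hΩ.measurableSet).1 (ae_tendsto_of_modular_le hφ hΩ h0 hmono hUΩ hm2 h2)
  have hk : ∀ k : Fin (n + 1), (fun x => classicalGradient w x k) =ᵐ[volume.restrict Ω]
      fun x => g x k := by
    intro k
    refine ae_eq_of_ae_ae_insertCoord hΩ k
      ((EuclideanSpace.proj k : Space n →L[ℝ] ℝ).measurable.comp_aemeasurable hcg)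
      ((EuclideanSpace.proj k : Space n →L[ℝ] ℝ).measurable.comp_aemeasurable hg) ?_
    filter_upwards [ae_segmentCurve_notMem hφ hΩ h0 hexc k, ae_ae_insertCoord k hgrad]
      with y hy hy'
    exact ae_lineDeriv_limUnder hΩ hU hmono hUΩ hv k hy hy'
  filter_upwards [ae_all_iff.2 hk] with x hx
  ext k
  exact hx k

/-! ### A Jensen type inequality under (A1) -/

/-- Under (A1), the left-inverses `φ⁻¹(x, T)` for `x` in a ball are comparable with a constant. -/
lemma exists_ae_leftInv_le (hA1 : A1 Ω φ) :
    ∃ β : ℝ≥0, 0 < β ∧ β < 1 ∧ ∀ (c : Space n) (r : ℝ), 0 < r → ∀ T : ℝ≥0∞, 1 ≤ T →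
      T ≤ 1 / volume (Metric.ball c r) → ∃ m : ℝ≥0∞,
        ∀ᵐ x ∂(volume.restrict (Metric.ball c r ∩ Ω)),
          β * leftInv φ x T ≤ m ∧ m ≤ leftInv φ x T := by
  obtain ⟨β, hβ, hβ1, h⟩ := hA1
  refine ⟨β, hβ, hβ1, fun c r hr T hT hT' =>
    ⟨essInf (fun x => leftInv φ x T) (volume.restrict (Metric.ball c r ∩ Ω)), ?_⟩⟩
  filter_upwards [h c r hr, ae_essInf_le (f := fun x => leftInv φ x T)
    (μ := volume.restrict (Metric.ball c r ∩ Ω))] with x hx hx'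
  refine ⟨?_, hx'⟩
  refine le_essInf_of_ae_le _ ?_
  filter_upwards [hx] with y hy using hy T hT hT'

/-- A Jensen type inequality: if `φ⁻¹(y, T) ≤ m / β` for almost every `y`, and the average of
`φ(y, h(y))` is at most `T`, then the average of `h` is at most a multiple of `m`. It holds since,
above each level `M > m / β`, the function `φ(y, ·)` takes values at least `T` and, up to a
constant, grows at least linearly. -/
lemma IsWeakPhi.exists_lintegral_le (hφ : IsWeakPhi Ω φ) :
    ∃ L : ℝ≥0, ∀ (ν : Measure (Space n)) (β : ℝ≥0) (T : ℝ≥0) (m : ℝ≥0∞) (h : Space n → ℝ≥0∞),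
      ν univ ≤ 1 → 0 < β → 0 < T → (∀ᵐ y ∂ν, y ∈ Ω ∧ β * leftInv φ y T ≤ m) →
      ∫⁻ y, extendPhi φ y (h y) ∂ν ≤ T → β * ∫⁻ y, h y ∂ν ≤ (1 + L) * m := by
  obtain ⟨L, hL, hinc⟩ := hφ.almostInc
  have hL0 : 0 < L := zero_lt_one.trans_le hL
  refine ⟨L, fun ν β T m h hν hβ hT hm hint => ?_⟩
  have hβ' : (β : ℝ≥0∞) ≠ 0 := by simpa using hβ.ne'
  have hT' : (T : ℝ≥0∞) ≠ 0 := by simpa using hT.ne'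
  have hL1 : (1 + L : ℝ≥0∞) ≠ 0 := by simp
  have key : ∀ M : ℝ≥0, m < β * M → ∫⁻ y, h y ∂ν ≤ (1 + L) * M := by
    intro M hM
    have hM0 : 0 < M := by
      by_contra h0
      have : M = 0 := by simpa using h0
      simp [this] at hM
    have hM0' : (M : ℝ≥0∞) ≠ 0 := by simpa using hM0.ne'
    have hpt : ∀ᵐ y ∂ν, h y ≤ M + (L * M / T : ℝ≥0) * extendPhi φ y (h y) := by
      filter_upwards [hm] with y hy
      rcases le_or_gt (h y) M with hle | hlt
      · exact hle.trans le_self_add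
      rcases eq_or_ne (h y) ⊤ with htop | htop
      · have : ((L * M / T : ℝ≥0) : ℝ≥0∞) ≠ 0 := by
          exact_mod_cast (by positivity : L * M / T ≠ 0)
        rw [htop, extendPhi_top, ENNReal.mul_top this]
        simp
      refine le_trans ?_ le_add_self
      lift h y to ℝ≥0 using htop with s hs
      have hMs : M < s := by exact_mod_cast hlt
      have h1 : leftInv φ y T < M := by
        by_contra hcon
        exact hM.not_ge (le_trans (by gcongr; exact not_lt.1 hcon) hy.2)
      simp only [leftInv, iInf_lt_iff] at h1
      obtain ⟨t, hTt, htM⟩ := h1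
      have h2 : (T : ℝ≥0∞) ≤ φ y M := hTt.trans (hφ.mono y hy.1 (by exact_mod_cast htM.le))
      have h3 := hinc y hy.1 M s hM0 hMs.le
      have hs' : (s : ℝ≥0∞) ≠ 0 := by simpa using (hM0.trans hMs).ne'
      rw [extendPhi_coe]
      calc (s : ℝ≥0∞) = s / T * T := (ENNReal.div_mul_cancel hT' ENNReal.coe_ne_top).symm
        _ ≤ s / T * φ y M := by gcongr
        _ ≤ s / T * (L * (φ y s / s) * M) := by
            gcongr
            exact (ENNReal.div_le_iff hM0' ENNReal.coe_ne_top).1 h3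
        _ = (L * M / T) * (φ y s / s * s) := by
            simp only [div_eq_mul_inv]; ring
        _ = (L * M / T : ℝ≥0) * φ y s := by
            rw [ENNReal.div_mul_cancel hs' ENNReal.coe_ne_top, ENNReal.coe_div hT.ne',
              ENNReal.coe_mul]
    calc ∫⁻ y, h y ∂ν ≤ ∫⁻ y, (M + (L * M / T : ℝ≥0) * extendPhi φ y (h y)) ∂ν :=
          lintegral_mono_ae hpt
      _ = M * ν univ + (L * M / T : ℝ≥0) * ∫⁻ y, extendPhi φ y (h y) ∂ν := by
          rw [lintegral_add_left measurable_const, lintegral_const_mul' _ _ ENNReal.coe_ne_top,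
            lintegral_const]
      _ ≤ M * 1 + (L * M / T : ℝ≥0) * T := by gcongr
      _ = (1 + L) * M := by
          norm_cast
          field_simp
  rw [mul_comm (1 + _ : ℝ≥0∞), ← ENNReal.div_le_iff hL1 (by finiteness)]
  refine le_of_forall_gt_imp_ge_of_dense fun a ha => ?_
  rcases eq_or_ne a ⊤ with rfl | hatop
  · exact le_top
  lift a to ℝ≥0 using hatop
  have haβ : (β : ℝ≥0∞) * (a / β : ℝ≥0) = a := by
    rw [← ENNReal.coe_mul, mul_div_cancel₀ _ hβ.ne']
  rw [ENNReal.div_le_iff hL1 (by finiteness)]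
  calc (β : ℝ≥0∞) * ∫⁻ y, h y ∂ν ≤ β * ((1 + L) * (a / β : ℝ≥0)) := by
        gcongr
        exact key _ (by rwa [haβ])
    _ = (β * (a / β : ℝ≥0)) * (1 + L) := by ring
    _ = a * (1 + L) := by rw [haβ]

/-- An upper bound for `φ` from a lower bound for its left-inverse. The factor `1 / 2` makes the
argument strictly smaller than the infimum that defines `φ⁻¹(x, T)`. -/
lemma IsWeakPhi.extendPhi_half_le (hφ : IsWeakPhi Ω φ) {x : Space n} (hx : x ∈ Ω) {T : ℝ≥0}
    {m s : ℝ≥0∞} (hm : m ≤ leftInv φ x T) (hs : s ≤ 2⁻¹ * m) : extendPhi φ x s ≤ T := by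
  rcases eq_or_ne m 0 with rfl | hm0
  · rw [mul_zero, nonpos_iff_eq_zero] at hs
    simp [hs, hφ.extendPhi_zero hx]
  have hmtop : m ≠ ⊤ := by
    rintro rfl
    obtain ⟨t, ht⟩ := ((hφ.tendsto_top x hx).eventually
      (le_mem_nhds (ENNReal.coe_lt_top (r := T)))).exists
    have : leftInv φ x T ≤ t := iInf₂_le t ht
    exact absurd (hm.trans this) (by simp)
  have hsm : s < m := hs.trans_lt (by
    rw [mul_comm, ← div_eq_mul_inv]; exact ENNReal.half_lt_self hm0 hmtop)
  lift s to ℝ≥0 using (hsm.trans_le le_top).ne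
  rw [extendPhi_coe]
  by_contra hcon
  exact (hsm.trans_le hm).not_ge (iInf₂_le s (not_le.1 hcon).le)

/-- Under (aDec), `φ` is doubling at every scale. -/
lemma exists_extendPhi_mul_le_of_ADec (hφ : IsWeakPhi Ω φ) (hΩ : IsOpen Ω) (hdec : ADec Ω φ)
    (B : ℝ≥0) : ∃ C : ℝ≥0, ∀ᵐ x ∂(volume.restrict Ω), ∀ t : ℝ≥0∞,
      extendPhi φ x (B * t) ≤ C * extendPhi φ x t := by
  obtain ⟨q, L, hq, hL, h⟩ := hdec
  have hL0 : 0 < L := zero_lt_one.trans_le hL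
  have hq0 : 0 ≤ q := by linarith
  set B' := max B 1
  have hB' : 0 < B' := zero_lt_one.trans_le (le_max_right _ _)
  refine ⟨L * B' ^ q, ?_⟩
  filter_upwards [h, ae_restrict_mem hΩ.measurableSet] with x hx hxΩ t
  refine (hφ.extendPhi_mono hxΩ
    (mul_le_mul_left (ENNReal.coe_le_coe.2 (le_max_left B 1)) t)).trans ?_
  have hC : ((L * B' ^ q : ℝ≥0) : ℝ≥0∞) ≠ 0 := by
    have := NNReal.rpow_pos (p := q) hB'
    exact_mod_cast (by positivity : L * B' ^ q ≠ 0)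
  rcases eq_or_ne t ⊤ with rfl | ht
  · rw [extendPhi_top, ENNReal.mul_top hC]; exact le_top
  lift t to ℝ≥0 using ht
  rcases eq_or_ne t 0 with rfl | ht0
  · simp [hφ.extendPhi_zero hxΩ]
  have ht0' : 0 < t := pos_iff_ne_zero.2 ht0
  have h1 := hx t (B' * t) ht0' (le_mul_of_one_le_left' (le_max_right _ _))
  have hpos : (0 : ℝ≥0) < t ^ q := NNReal.rpow_pos ht0'
  have hpos' : (0 : ℝ≥0) < (B' * t) ^ q := NNReal.rpow_pos (by positivity)
  rw [← ENNReal.coe_rpow_of_nonneg _ hq0, ← ENNReal.coe_rpow_of_nonneg _ hq0] at h1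
  have hne : ((t ^ q : ℝ≥0) : ℝ≥0∞) ≠ 0 := by exact_mod_cast hpos.ne'
  have hne' : (((B' * t) ^ q : ℝ≥0) : ℝ≥0∞) ≠ 0 := by exact_mod_cast hpos'.ne'
  change extendPhi φ x ((B' : ℝ≥0) * (t : ℝ≥0∞)) ≤ _
  rw [← ENNReal.coe_mul, extendPhi_coe, extendPhi_coe]
  calc φ x (B' * t) ≤ L * (φ x t / (t ^ q : ℝ≥0)) * ((B' * t) ^ q : ℝ≥0) :=
        (ENNReal.div_le_iff hne' ENNReal.coe_ne_top).1 h1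
    _ = L * (φ x t / (t ^ q : ℝ≥0)) * ((B' ^ q : ℝ≥0) * (t ^ q : ℝ≥0)) := by
        rw [NNReal.mul_rpow, ENNReal.coe_mul]
    _ = L * (B' ^ q : ℝ≥0) * (φ x t / (t ^ q : ℝ≥0) * (t ^ q : ℝ≥0)) := by ring
    _ = (L * B' ^ q : ℝ≥0) * φ x t := by
        rw [ENNReal.div_mul_cancel hne ENNReal.coe_ne_top, ENNReal.coe_mul]

lemma IsWeakPhi.tendsto_extendPhi_zero (hφ : IsWeakPhi Ω φ) {x : Space n} (hx : x ∈ Ω) :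
    Tendsto (extendPhi φ x) (𝓝 0) (𝓝 0) := by
  rw [ENNReal.tendsto_nhds_zero]
  intro ε hε
  obtain ⟨t, ht, ht0⟩ := (((hφ.tendsto_zero x hx).eventually (ge_mem_nhds hε)).and
    self_mem_nhdsWithin).exists
  have ht0 : 0 < t := ht0
  filter_upwards [ge_mem_nhds (ENNReal.coe_pos.2 ht0)] with s hs
  exact (hφ.extendPhi_mono hx hs).trans (by simpa using ht)

/-- A dominated convergence theorem with converging bounds. -/
lemma tendsto_lintegral_zero_of_le {α : Type*} [MeasurableSpace α] {μ : Measure α}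
    {F G : ℕ → α → ℝ≥0∞} {g : α → ℝ≥0∞} (hF : ∀ j, AEMeasurable (F j) μ)
    (hG : ∀ j, AEMeasurable (G j) μ) (hFG : ∀ j, ∀ᵐ x ∂μ, F j x ≤ G j x)
    (hGg : ∀ᵐ x ∂μ, Tendsto (fun j => G j x) atTop (𝓝 (g x)))
    (hint : ∀ j, ∫⁻ x, G j x ∂μ = ∫⁻ x, g x ∂μ) (hfin : ∫⁻ x, g x ∂μ ≠ ⊤)
    (hF0 : ∀ᵐ x ∂μ, Tendsto (fun j => F j x) atTop (𝓝 0)) :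
    Tendsto (fun j => ∫⁻ x, F j x ∂μ) atTop (𝓝 0) := by
  set I := ∫⁻ x, g x ∂μ
  have hFI : ∀ j, ∫⁻ x, F j x ∂μ ≤ I := fun j => (lintegral_mono_ae (hFG j)).trans (hint j).le
  have h1 : I ≤ liminf (fun j => I - ∫⁻ x, F j x ∂μ) atTop := by
    calc I = ∫⁻ x, liminf (fun j => G j x - F j x) atTop ∂μ := by
          refine lintegral_congr_ae ?_
          filter_upwards [hGg, hF0] with x h1 h2
          have := ENNReal.Tendsto.sub h1 h2 (Or.inr ENNReal.zero_ne_top)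
          rw [tsub_zero] at this
          exact this.liminf_eq.symm
      _ ≤ liminf (fun j => ∫⁻ x, (G j x - F j x) ∂μ) atTop :=
          lintegral_liminf_le' fun j => (hG j).sub (hF j)
      _ = liminf (fun j => I - ∫⁻ x, F j x ∂μ) atTop := by
          congr with j
          rw [lintegral_sub' (hF j) ((hFI j).trans_lt (lt_top_iff_ne_top.2 hfin)).ne (hFG j),
            hint j]
  rw [ENNReal.liminf_const_sub atTop _ hfin] at h1
  have h2 : limsup (fun j => ∫⁻ x, F j x ∂μ) atTop ≤ I :=
    limsup_le_of_le (by isBoundedDefault) (Eventually.of_forall hFI)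
  have h3 : limsup (fun j => ∫⁻ x, F j x ∂μ) atTop = 0 := by
    by_contra h0
    rcases eq_or_ne I 0 with hI | hI
    · exact h0 (le_antisymm (hI ▸ h2) zero_le)
    · exact (ENNReal.sub_lt_self hfin hI h0).not_ge h1
  exact tendsto_of_le_liminf_of_limsup_le zero_le h3.le

/-! ### Mollification -/

/-- A smooth bump function supported in the ball of radius `r` and constant on half that ball. -/
def bump (n : ℕ) (r : ℝ) (hr : 0 < r) : ContDiffBump (0 : Space n) :=
  ⟨r / 2, r, by linarith, by linarith⟩

/-- The mollifier of radius `r`: a smooth probability density on the ball of radius `r`. -/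
def mollifier (n : ℕ) (r : ℝ) (hr : 0 < r) : Space n → ℝ := (bump n r hr).normed volume

/-- The mollification of a `[0, ∞]`-valued function. -/
def lmollify (r : ℝ) (hr : 0 < r) (h : Space n → ℝ≥0∞) (x : Space n) : ℝ≥0∞ :=
  ∫⁻ y, ENNReal.ofReal (mollifier n r hr (x - y)) * h y

/-- The mollification of a real function. -/
def mollify (r : ℝ) (hr : 0 < r) (f : Space n → ℝ) : Space n → ℝ :=
  convolution (mollifier n r hr) f (ContinuousLinearMap.lsmul ℝ ℝ) volume

section Mollifier

variable (r : ℝ) (hr : 0 < r)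

lemma mollifier_nonneg (x : Space n) : 0 ≤ mollifier n r hr x :=
  ContDiffBump.nonneg_normed _ _

lemma contDiff_mollifier : ContDiff ℝ ∞ (mollifier n r hr) :=
  ContDiffBump.contDiff_normed (n := ⊤) _

lemma continuous_mollifier : Continuous (mollifier n r hr) := ContDiffBump.continuous_normed _

lemma hasCompactSupport_mollifier : HasCompactSupport (mollifier n r hr) :=
  ContDiffBump.hasCompactSupport_normed _

lemma mollifier_eq_zero {x : Space n} (hx : x ∉ Metric.ball 0 r) : mollifier n r hr x = 0 := by
  have : x ∉ Function.support (mollifier n r hr) := by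
    rw [mollifier, ContDiffBump.support_normed_eq]
    exact hx
  simpa using this

lemma measurable_mollifier_sub (x : Space n) :
    Measurable fun y => ENNReal.ofReal (mollifier n r hr (x - y)) :=
  ((continuous_mollifier r hr).comp (continuous_const.sub continuous_id)).measurable.ennreal_ofReal

lemma lintegral_mollifier : ∫⁻ x, ENNReal.ofReal (mollifier n r hr x) = 1 := by
  have hint : Integrable (mollifier n r hr) := ContDiffBump.integrable_normed _
  rw [← ofReal_integral_eq_lintegral_ofReal hint
    (Eventually.of_forall fun x => mollifier_nonneg r hr x)]
  simp [mollifier, ContDiffBump.integral_normed]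

lemma measurable_lmollify {h : Space n → ℝ≥0∞} (hm : Measurable h) :
    Measurable (lmollify r hr h) := by
  have h1 : Measurable fun p : Space n × Space n =>
      ENNReal.ofReal (mollifier n r hr (p.1 - p.2)) * h p.2 :=
    (((continuous_mollifier r hr).comp (continuous_fst.sub continuous_snd)).measurable
      |>.ennreal_ofReal).mul (hm.comp measurable_snd)
  exact h1.lintegral_prod_right'

lemma lintegral_lmollify {h : Space n → ℝ≥0∞} (hm : Measurable h) :
    ∫⁻ x, lmollify r hr h x = ∫⁻ y, h y := by
  have h1 : Measurable fun p : Space n × Space n =>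
      ENNReal.ofReal (mollifier n r hr (p.1 - p.2)) * h p.2 :=
    (((continuous_mollifier r hr).comp (continuous_fst.sub continuous_snd)).measurable
      |>.ennreal_ofReal).mul (hm.comp measurable_snd)
  unfold lmollify
  rw [lintegral_lintegral_swap h1.aemeasurable]
  refine lintegral_congr fun y => ?_
  have h2 : Measurable fun x : Space n => ENNReal.ofReal (mollifier n r hr (x - y)) :=
    ((continuous_mollifier r hr).comp (continuous_id.sub continuous_const)).measurable
      |>.ennreal_ofReal
  rw [lintegral_mul_const _ h2,
    lintegral_sub_right_eq_self (fun x => ENNReal.ofReal (mollifier n r hr x)) y,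
    lintegral_mollifier, one_mul]

lemma lmollify_congr {h h' : Space n → ℝ≥0∞} (hh : h =ᵐ[volume] h') (x : Space n) :
    lmollify r hr h x = lmollify r hr h' x :=
  lintegral_congr_ae (hh.mono fun y hy => by simp only [hy])

lemma mollify_eq_integral (f : Space n → ℝ) (x : Space n) :
    mollify r hr f x = ∫ y, mollifier n r hr (x - y) * f y := by
  rw [mollify, convolution_eq_swap]
  simp

lemma enorm_mollify_le (f : Space n → ℝ) (x : Space n) :
    ‖mollify r hr f x‖ₑ ≤ lmollify r hr (fun y => ‖f y‖ₑ) x := by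
  rw [mollify_eq_integral]
  refine (enorm_integral_le_lintegral_enorm _).trans (lintegral_mono fun y => ?_)
  rw [enorm_mul, Real.enorm_eq_ofReal (mollifier_nonneg r hr _)]

lemma ofReal_mollifier_le (x : Space n) :
    ENNReal.ofReal (mollifier n r hr x) ≤ (volume (Metric.closedBall (0 : Space n) (r / 2)))⁻¹ := by
  have h1 : mollifier n r hr x ≤ 1 / volume.real (Metric.closedBall (0 : Space n) (r / 2)) :=
    (bump n r hr).normed_le_div_measure_closedBall_rIn volume x
  have hpos : 0 < volume.real (Metric.closedBall (0 : Space n) (r / 2)) :=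
    ENNReal.toReal_pos (Metric.measure_closedBall_pos _ _ (by linarith)).ne'
      measure_closedBall_lt_top.ne
  refine (ENNReal.ofReal_le_ofReal h1).trans (le_of_eq ?_)
  rw [one_div, ENNReal.ofReal_inv_of_pos hpos]
  congr 1
  exact ENNReal.ofReal_toReal measure_closedBall_lt_top.ne

lemma lmollify_le (h : Space n → ℝ≥0∞) (x : Space n) : lmollify r hr h x ≤
    (volume (Metric.closedBall (0 : Space n) (r / 2)))⁻¹ * ∫⁻ y, h y := by
  have hne : (volume (Metric.closedBall (0 : Space n) (r / 2)))⁻¹ ≠ ⊤ :=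
    ENNReal.inv_ne_top.2 (Metric.measure_closedBall_pos _ _ (by linarith)).ne'
  rw [← lintegral_const_mul' _ _ hne]
  exact lintegral_mono fun y => mul_le_mul_left (ofReal_mollifier_le r hr _) _

lemma volume_ball_two_mul : volume (Metric.ball (0 : Space n) (2 * r)) =
    4 ^ (n + 1) * volume (Metric.closedBall (0 : Space n) (r / 2)) := by
  rw [Measure.addHaar_closedBall_eq_addHaar_ball, show 2 * r = 4 * (r / 2) by ring,
    Measure.addHaar_ball_mul volume (0 : Space n) (by norm_num : (0 : ℝ) ≤ 4) (r / 2)]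
  congr 1
  rw [finrank_euclideanSpace_fin, ENNReal.ofReal_pow (by norm_num)]
  norm_num

/-- Mollification as integration against a probability measure. -/
lemma lmollify_eq_lintegral_withDensity (h : Space n → ℝ≥0∞) (x : Space n) :
    lmollify r hr h x =
      ∫⁻ y, h y ∂(volume.withDensity fun y => ENNReal.ofReal (mollifier n r hr (x - y))) := by
  rw [lintegral_withDensity_eq_lintegral_mul_non_measurable _ (measurable_mollifier_sub r hr x)
    (Eventually.of_forall fun _ => ENNReal.ofReal_lt_top)]
  rfl

end Mollifier

/-- The key estimate: under (A1), `φ` of a small multiple of a mollification is bounded by the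
mollification of `φ`, up to an additive constant, for functions with small modular. -/
lemma exists_extendPhi_lmollify_le (hφ : IsWeakPhi Ω φ) (hΩ : IsOpen Ω) (hA1 : A1 Ω φ) :
    ∃ c : ℝ≥0, 0 < c ∧ c ≤ 1 ∧ ∀ (r : ℕ → ℝ) (hr : ∀ j, 0 < r j),
      (∀ j, volume (Metric.ball (0 : Space n) (2 * r j)) ≤ 2⁻¹) →
      ∀ᵐ x ∂(volume.restrict Ω), ∀ j, Metric.ball x (r j) ⊆ Ω → ∀ h : Space n → ℝ≥0∞,
        modular Ω φ h ≤ (2 * 4 ^ (n + 1))⁻¹ →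
        extendPhi φ x (c * lmollify (r j) (hr j) h x) ≤
          lmollify (r j) (hr j) (Ω.indicator fun y => extendPhi φ y (h y)) x + 1 := by
  obtain ⟨β, hβ, hβ1, hm⟩ := exists_ae_leftInv_le hA1
  obtain ⟨L, hJ⟩ := hφ.exists_lintegral_le
  have hL1 : (0 : ℝ≥0) < 1 + L := by positivity
  refine ⟨2⁻¹ * (β / (1 + L)), by positivity, ?_, fun r hr hvol => ?_⟩
  · calc 2⁻¹ * (β / (1 + L)) ≤ 1 * (1 / 1) := by
          gcongr
          · exact inv_le_one_of_one_le₀ one_le_two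
          · simp
      _ = 1 := by simp
  -- countably many balls and levels suffice
  have hm' : ∀ i j T : ℕ, ∃ m : ℝ≥0∞, ∀ᵐ x, x ∈ Ω →
      1 ≤ T → (T : ℝ≥0∞) ≤ (volume (Metric.ball (0 : Space n) (2 * r j)))⁻¹ →
      x ∈ Metric.ball (TopologicalSpace.denseSeq (Space n) i) (2 * r j) →
      β * leftInv φ x T ≤ m ∧ m ≤ leftInv φ x T := by
    intro i j T
    set c := TopologicalSpace.denseSeq (Space n) i
    by_cases hT : 1 ≤ T ∧ (T : ℝ≥0∞) ≤ (volume (Metric.ball (0 : Space n) (2 * r j)))⁻¹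
    · obtain ⟨m, h1⟩ := hm c (2 * r j) (by linarith [hr j]) T (by exact_mod_cast hT.1) (by
        rw [one_div, Measure.addHaar_ball_center]; exact hT.2)
      rw [ae_restrict_iff' (measurableSet_ball.inter hΩ.measurableSet)] at h1
      refine ⟨m, ?_⟩
      filter_upwards [h1] with x hx hxΩ _ _ hxc using hx ⟨hxc, hxΩ⟩
    · exact ⟨0, Eventually.of_forall fun x _ h h' => absurd ⟨h, h'⟩ hT⟩
  choose m hm' using hm'
  have hall := ae_all_iff.2 fun i => ae_all_iff.2 fun j => ae_all_iff.2 fun T => hm' i j T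
  rw [ae_restrict_iff' hΩ.measurableSet]
  filter_upwards [hall] with x hx hxΩ j hball h hmod
  set ν := volume.withDensity fun y => ENNReal.ofReal (mollifier n (r j) (hr j) (x - y))
  set I := lmollify (r j) (hr j) (Ω.indicator fun y => extendPhi φ y (h y)) x
  set V := volume (Metric.ball (0 : Space n) (2 * r j))
  have hV0 : V ≠ 0 := (Metric.measure_ball_pos _ _ (by linarith [hr j])).ne'
  have hVtop : V ≠ ⊤ := measure_ball_lt_top.ne
  have hI : I ≤ (2 * V)⁻¹ := by
    refine (lmollify_le _ _ _ _).trans ?_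
    rw [lintegral_indicator hΩ.measurableSet]
    calc _ ≤ (volume (Metric.closedBall (0 : Space n) (r j / 2)))⁻¹ * (2 * 4 ^ (n + 1))⁻¹ := by
          gcongr
          exact hmod
      _ = (2 * V)⁻¹ := by
          simp only [V]
          rw [volume_ball_two_mul, ← mul_assoc,
            ENNReal.mul_inv (Or.inr measure_closedBall_lt_top.ne) (Or.inl (by finiteness)),
            mul_comm]
  have hItop : I ≠ ⊤ := (hI.trans_lt (ENNReal.inv_lt_top.2 (by simpa using hV0.bot_lt))).ne
  -- the level: the natural number in `(I, I + 1]`; it is at most `1 / V` since `I` and `1` are at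
  -- most `1 / (2 V)`
  set T : ℕ := ⌊I.toReal⌋₊ + 1
  have hIT : I ≤ T := by
    rw [← ENNReal.ofReal_toReal hItop, ← ENNReal.ofReal_natCast]
    refine ENNReal.ofReal_le_ofReal ?_
    simp only [T]
    push_cast
    exact (Nat.lt_floor_add_one _).le
  have hTI : (T : ℝ≥0∞) ≤ I + 1 := by
    simp only [T]
    push_cast
    gcongr
    conv_rhs => rw [← ENNReal.ofReal_toReal hItop]
    rw [← ENNReal.ofReal_natCast]
    exact ENNReal.ofReal_le_ofReal (Nat.floor_le ENNReal.toReal_nonneg)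
  have hTV : (T : ℝ≥0∞) ≤ V⁻¹ := by
    have h1 : (1 : ℝ≥0∞) ≤ (2 * V)⁻¹ := by
      rw [ENNReal.one_le_inv]
      calc 2 * V ≤ 2 * 2⁻¹ := by gcongr; exact hvol j
        _ = 1 := ENNReal.mul_inv_cancel (by simp) (by simp)
    calc (T : ℝ≥0∞) ≤ (2 * V)⁻¹ + (2 * V)⁻¹ := hTI.trans (add_le_add hI h1)
      _ = V⁻¹ := by
          rw [← two_mul, ENNReal.mul_inv (by simp) (by simp), ← mul_assoc,
            ENNReal.mul_inv_cancel (by simp) (by simp), one_mul]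
  obtain ⟨i, hi⟩ : ∃ i, dist x (TopologicalSpace.denseSeq (Space n) i) < r j := by
    obtain ⟨_, ⟨i, rfl⟩, hi⟩ := Metric.mem_closure_iff.1
      (TopologicalSpace.denseRange_denseSeq (Space n) x) (r j) (hr j)
    exact ⟨i, hi⟩
  have hT1 : 1 ≤ T := Nat.le_add_left 1 _
  have hxm := (hx i j T hxΩ hT1 hTV (Metric.mem_ball.2 (by linarith [hr j]))).2
  have hνball : ∀ᵐ y ∂ν, y ∈ Metric.ball x (r j) := by
    rw [ae_withDensity_iff (measurable_mollifier_sub _ _ x)]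
    refine Eventually.of_forall fun y hy => ?_
    by_contra hcon
    refine hy ?_
    rw [mollifier_eq_zero _ _ (by
      simpa [dist_eq_norm, norm_sub_rev, Metric.mem_ball] using hcon), ENNReal.ofReal_zero]
  have hνae : ∀ᵐ y ∂ν, y ∈ Ω ∧ β * leftInv φ y ((T : ℝ≥0) : ℝ≥0∞) ≤ m i j T := by
    have h1 : ∀ᵐ y ∂ν, ∀ i j T : ℕ, y ∈ Ω → 1 ≤ T → (T : ℝ≥0∞) ≤
        (volume (Metric.ball (0 : Space n) (2 * r j)))⁻¹ →
        y ∈ Metric.ball (TopologicalSpace.denseSeq (Space n) i) (2 * r j) →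
        β * leftInv φ y T ≤ m i j T ∧ m i j T ≤ leftInv φ y T :=
      (withDensity_absolutelyContinuous _ _).ae_le hall
    filter_upwards [h1, hνball] with y hy hyx
    have hyΩ := hball hyx
    refine ⟨hyΩ, ?_⟩
    have := (hy i j T hyΩ hT1 hTV ?_).1
    · simpa using this
    · rw [Metric.mem_ball] at hyx ⊢
      linarith [dist_triangle y x (TopologicalSpace.denseSeq (Space n) i)]
  have hν1 : ν univ ≤ 1 := by
    rw [withDensity_apply _ MeasurableSet.univ, Measure.restrict_univ,
      lintegral_sub_left_eq_self (fun y => ENNReal.ofReal (mollifier n (r j) (hr j) y)) x,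
      lintegral_mollifier]
  have hνint : ∫⁻ y, extendPhi φ y (h y) ∂ν ≤ (T : ℝ≥0) := by
    have : ∫⁻ y, extendPhi φ y (h y) ∂ν = I := by
      simp only [I]
      rw [lmollify_eq_lintegral_withDensity]
      refine lintegral_congr_ae ?_
      filter_upwards [hνae] with y hy
      rw [indicator_of_mem hy.1]
    rw [this]
    simpa using hIT
  have hfinal := hJ ν β T (m i j T) h hν1 hβ (by exact_mod_cast hT1) hνae hνint
  rw [← lmollify_eq_lintegral_withDensity] at hfinal
  refine (hφ.extendPhi_half_le hxΩ (T := T) (m := m i j T) (by simpa using hxm) ?_).trans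
    (by simpa using hTI)
  rw [ENNReal.coe_mul, ENNReal.coe_div hL1.ne', mul_assoc, ENNReal.coe_inv two_ne_zero]
  refine mul_le_mul_right ?_ _
  rw [div_eq_mul_inv, mul_right_comm, ← div_eq_mul_inv]
  refine ENNReal.div_le_of_le_mul ?_
  rw [mul_comm (m i j T)]
  simpa using hfinal

/-! ### Approximation by mollifications -/

section Mollifier

variable (r : ℝ) (hr : 0 < r)

lemma contDiff_mollify {f : Space n → ℝ} (hf : LocallyIntegrable f) :
    ContDiff ℝ 1 (mollify r hr f) :=
  (hasCompactSupport_mollifier r hr).contDiff_convolution_left _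
    ((contDiff_mollifier r hr).of_le (by simp)) hf

/-- Where the function has a weak gradient, differentiation commutes with mollification. -/
lemma classicalGradient_mollify {u : Space n → ℝ} {g : Space n → Space n}
    (hw : IsWeakGradient Ω u g) {K' : Set (Space n)} (hK' : IsCompact K') (hK'Ω : K' ⊆ Ω)
    {x : Space n} (hx : Metric.closedBall x r ⊆ K') (k : Fin (n + 1)) :
    classicalGradient (mollify r hr (K'.indicator u)) x k =
      mollify r hr (K'.indicator fun y => g y k) x := by
  have hF : LocallyIntegrable (K'.indicator u) :=
    ((hw.1.integrableOn_compact_subset hK'Ω hK').integrable_indicator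
      hK'.measurableSet).locallyIntegrable
  have hd := (hasCompactSupport_mollifier r hr).hasFDerivAt_convolution_left
    (ContinuousLinearMap.lsmul ℝ ℝ) ((contDiff_mollifier (n := n) r hr).of_le (by simp)) hF x
  have hd' : HasFDerivAt (mollify r hr (K'.indicator u)) _ x := hd
  rw [classicalGradient_eq_of_differentiableAt hd'.differentiableAt, hd'.fderiv]
  have hcs : HasCompactSupport (fderiv ℝ (mollifier n r hr)) :=
    (hasCompactSupport_mollifier r hr).fderiv ℝ
  have hex := hcs.convolutionExists_left
    ((ContinuousLinearMap.lsmul ℝ ℝ : ℝ →L[ℝ] ℝ →L[ℝ] ℝ).precompL (Space n))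
    ((contDiff_mollifier (n := n) r hr).continuous_fderiv (by simp)) hF x
  rw [convolution, ContinuousLinearMap.integral_apply hex, mollify_eq_integral]
  -- the mollifier centred at `x` is a test function
  set ψ : Space n → ℝ := fun y => mollifier n r hr (x - y) with hψ
  set e : Space n := EuclideanSpace.single k 1
  have hψs : ContDiff ℝ ∞ ψ := (contDiff_mollifier r hr).comp (contDiff_const.sub contDiff_id)
  have hψK : tsupport ψ ⊆ K' := by
    refine Subset.trans (closure_minimal (fun y hy => ?_) Metric.isClosed_closedBall) hx
    by_contra hcon
    refine hy (mollifier_eq_zero r hr fun h => hcon (Metric.ball_subset_closedBall ?_))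
    simpa [dist_eq_norm, norm_sub_rev, Metric.mem_ball] using h
  have hψc : HasCompactSupport ψ := hK'.of_isClosed_subset (isClosed_tsupport _) hψK
  have hψd : ∀ y, fderiv ℝ ψ y e = - fderiv ℝ (mollifier n r hr) (x - y) e := by
    intro y
    have h1 : HasFDerivAt (fun y => x - y) (-ContinuousLinearMap.id ℝ (Space n)) y :=
      (hasFDerivAt_id y).const_sub x
    have h2 := (((contDiff_mollifier (n := n) r hr).differentiable (by simp)
      (x - y)).hasFDerivAt).comp y h1
    rw [hψ]
    erw [h2.fderiv]
    simp
  have hmain := hw.2.2 k ψ hψs hψc (hψK.trans hK'Ω)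
  have hs' := (tsupport_partialDeriv_subset ψ e).trans hψK
  rw [setIntegral_mul_eq (hs'.trans hK'Ω), setIntegral_mul_eq (hψK.trans hK'Ω)] at hmain
  have hind : ∀ (f m : Space n → ℝ), tsupport m ⊆ K' → ∀ y, K'.indicator f y * m y = f y * m y := by
    intro f m hm y
    by_cases hy : y ∈ K'
    · rw [indicator_of_mem hy]
    · rw [image_eq_zero_of_notMem_tsupport fun h => hy (hm h), mul_zero, mul_zero]
  calc _ = ∫ t, fderiv ℝ (mollifier n r hr) t e * K'.indicator u (x - t) := by
        simp
    _ = ∫ y, fderiv ℝ (mollifier n r hr) (x - y) e * K'.indicator u y := by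
        rw [← integral_sub_left_eq_self _ _ x]
        simp
    _ = ∫ y, -(u y * fderiv ℝ ψ y e) := by
        refine integral_congr_ae (Eventually.of_forall fun y => ?_)
        dsimp only
        rw [← hind u _ hs' y, hψd]
        ring
    _ = ∫ y, g y k * ψ y := by rw [integral_neg, hmain, neg_neg]
    _ = _ := by
        refine integral_congr_ae (Eventually.of_forall fun y => ?_)
        dsimp only
        rw [← hind (fun y => g y k) _ hψK y, mul_comm]

end Mollifier

section Convergence

variable {r : ℕ → ℝ} (hr : ∀ j, 0 < r j)

lemma ae_tendsto_mollify (hr0 : Tendsto r atTop (𝓝 0)) {f : Space n → ℝ}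
    (hf : LocallyIntegrable f) :
    ∀ᵐ x, Tendsto (fun j => mollify (r j) (hr j) f x) atTop (𝓝 (f x)) :=
  ContDiffBump.ae_convolution_tendsto_right_of_locallyIntegrable (K := 2)
    (φ := fun j => bump n (r j) (hr j)) hr0
    (Eventually.of_forall fun j => by simp only [bump]; linarith) hf

lemma ae_tendsto_lmollify (hr0 : Tendsto r atTop (𝓝 0)) {h : Space n → ℝ≥0∞}
    (hm : Measurable h) (hfin : ∫⁻ x, h x ≠ ⊤) :
    ∀ᵐ x, Tendsto (fun j => lmollify (r j) (hr j) h x) atTop (𝓝 (h x)) := by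
  have hint : Integrable fun x => (h x).toReal :=
    integrable_toReal_of_lintegral_ne_top hm.aemeasurable hfin
  have hlt := ae_lt_top hm hfin
  filter_upwards [ae_tendsto_mollify hr hr0 hint.locallyIntegrable, hlt] with x hx hxlt
  have h1 := ENNReal.tendsto_ofReal hx
  rw [ENNReal.ofReal_toReal hxlt.ne] at h1
  refine h1.congr fun j => ?_
  have hc : Continuous fun y => mollifier n (r j) (hr j) (x - y) :=
    (continuous_mollifier _ _).comp (continuous_const.sub continuous_id)
  obtain ⟨C, hC⟩ := (hasCompactSupport_mollifier (n := n) (r j) (hr j)).exists_bound_of_continuous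
    (continuous_mollifier _ _)
  rw [mollify_eq_integral, ofReal_integral_eq_lintegral_ofReal
    (hint.bdd_mul hc.aestronglyMeasurable (Eventually.of_forall fun y => hC (x - y)))
    (Eventually.of_forall fun y => mul_nonneg (mollifier_nonneg _ _ _) ENNReal.toReal_nonneg)]
  refine lintegral_congr_ae ?_
  filter_upwards [hlt] with y hy
  rw [ENNReal.ofReal_mul (mollifier_nonneg _ _ _), ENNReal.ofReal_toReal hy.ne]

/-- Under (A1) and (aDec), mollifications converge in modular on compact sets: a bound for
`φ(x, ·)` of the mollifications is given by the mollifications of an integrable function, whose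
integrals converge. -/
lemma tendsto_modular_mollify_sub (hφ : IsWeakPhi Ω φ) (hΩ : IsOpen Ω) (hA1 : A1 Ω φ)
    (hdec : ADec Ω φ) {f : Space n → ℝ} (hf : MemLphi Ω φ f) (hloc : LocallyIntegrableOn f Ω)
    {K K' : Set (Space n)} (hK : MeasurableSet K) (hK' : IsCompact K') (hK'Ω : K' ⊆ Ω)
    (hr0 : Tendsto r atTop (𝓝 0))
    (hvol : ∀ j, volume (Metric.ball (0 : Space n) (2 * r j)) ≤ 2⁻¹)
    (hball : ∀ x ∈ K, ∀ j, Metric.ball x (r j) ⊆ K') (A : ℝ≥0) :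
    Tendsto (fun j => modular Ω φ (K.indicator fun x =>
      A * ‖mollify (r j) (hr j) (K'.indicator f) x - f x‖ₑ)) atTop (𝓝 0) := by
  obtain ⟨c₁, hc₁, hc₁', hkey⟩ := exists_extendPhi_lmollify_le hφ hΩ hA1
  obtain ⟨c₀, hc₀, hmod⟩ := hf.exists_modular_le (δ := (2 * 4 ^ (n + 1))⁻¹)
    (ENNReal.inv_pos.2 (by finiteness))
  have hKK' : K ⊆ K' := fun x hx => hball x hx 0 (Metric.mem_ball_self (hr 0))
  set F := K'.indicator f
  have hF : Integrable F :=
    (hloc.integrableOn_compact_subset hK'Ω hK').integrable_indicator hK'.measurableSet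
  set h : Space n → ℝ≥0∞ := fun x => c₀ * ‖F x‖ₑ
  have hmodh : modular Ω φ h ≤ (2 * 4 ^ (n + 1))⁻¹ := by
    refine (modular_mono_ae hφ hΩ (Eventually.of_forall fun x => ?_)).trans hmod
    simp only [h, F]
    gcongr
    exact enorm_indicator_le_enorm_self _ _
  have hΦm : AEMeasurable (Ω.indicator fun y => extendPhi φ y (h y)) :=
    (aemeasurable_indicator_iff hΩ.measurableSet).2
      (hφ.measurable h (hF.1.aemeasurable.enorm.const_mul _).restrict)
  set Φ := hΦm.mk _
  have hΦ : (Ω.indicator fun y => extendPhi φ y (h y)) =ᵐ[volume] Φ := hΦm.ae_eq_mk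
  have hΦmeas : Measurable Φ := hΦm.measurable_mk
  have hΦfin : ∫⁻ x, Φ x ≠ ⊤ := by
    rw [← lintegral_congr_ae hΦ, lintegral_indicator hΩ.measurableSet]
    exact (hmodh.trans_lt (ENNReal.inv_lt_top.2 (by positivity))).ne
  set c₂ : ℝ≥0 := c₁ * c₀ / 2
  have hc₂ : 0 < c₂ := by positivity
  have hc2 : (2 : ℝ≥0∞) * c₂ = c₁ * c₀ := by
    simp only [c₂]
    exact_mod_cast mul_div_cancel₀ (c₁ * c₀) (two_ne_zero (α := ℝ≥0))
  -- by (aDec), it suffices to consider one multiple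
  suffices hmain : Tendsto (fun j => modular Ω φ (K.indicator fun x =>
      c₂ * ‖mollify (r j) (hr j) F x - f x‖ₑ)) atTop (𝓝 0) by
    obtain ⟨C, hC⟩ := exists_extendPhi_mul_le_of_ADec hφ hΩ hdec (A / c₂)
    have h1 := ENNReal.Tendsto.const_mul (a := (C : ℝ≥0∞)) hmain (Or.inr ENNReal.coe_ne_top)
    rw [mul_zero] at h1
    refine tendsto_of_tendsto_of_tendsto_of_le_of_le tendsto_const_nhds h1 (fun _ => zero_le)
      fun j => ?_
    unfold modular
    dsimp only
    rw [← lintegral_const_mul' _ _ ENNReal.coe_ne_top]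
    refine lintegral_mono_ae ?_
    filter_upwards [hC] with x hx
    refine le_trans (le_of_eq ?_) (hx _)
    congr 1
    by_cases hxK : x ∈ K
    · simp only [indicator_of_mem hxK]
      rw [← mul_assoc, ← ENNReal.coe_mul, div_mul_cancel₀ _ hc₂.ne']
    · simp [indicator_of_notMem hxK]
  have hMm : ∀ j, AEMeasurable (K.indicator fun x => (c₂ : ℝ≥0∞) *
      ‖mollify (r j) (hr j) F x - f x‖ₑ) (volume.restrict Ω) := fun j =>
    ((((contDiff_mollify _ _ hF.locallyIntegrable).continuous.measurable.aemeasurable.sub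
      hf.1).enorm).const_mul _).indicator hK
  have hKfin : volume K ≠ ⊤ := ((measure_mono hKK').trans_lt hK'.measure_lt_top).ne
  have hgoal : ∀ j, modular Ω φ (K.indicator fun x => c₂ * ‖mollify (r j) (hr j) F x - f x‖ₑ) =
      ∫⁻ x, Ω.indicator (fun x => extendPhi φ x (K.indicator (fun x => c₂ *
        ‖mollify (r j) (hr j) F x - f x‖ₑ) x)) x := fun j =>
    (lintegral_indicator hΩ.measurableSet _).symm
  simp only [hgoal]
  have hkey' := hkey r hr hvol
  rw [ae_restrict_iff' hΩ.measurableSet] at hkey'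
  refine tendsto_lintegral_zero_of_le
    (G := fun j x => lmollify (r j) (hr j) Φ x + K.indicator (fun x => 1 + Φ x) x)
    (g := fun x => Φ x + K.indicator (fun x => 1 + Φ x) x) ?_ ?_ ?_ ?_ ?_ ?_ ?_
  · exact fun j => (aemeasurable_indicator_iff hΩ.measurableSet).2 (hφ.measurable _ (hMm j))
  · exact fun j => ((measurable_lmollify _ _ hΦmeas).add
      ((measurable_const.add hΦmeas).indicator hK)).aemeasurable
  · intro j
    filter_upwards [hkey', hΦ] with x hx hxΦ
    by_cases hxΩ : x ∈ Ω
    swap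
    · simp [indicator_of_notMem hxΩ]
    by_cases hxK : x ∈ K
    swap
    · simp [indicator_of_notMem hxK, indicator_of_mem hxΩ, hφ.extendPhi_zero hxΩ]
    rw [indicator_of_mem hxΩ] at hxΦ
    simp only [indicator_of_mem hxΩ, indicator_of_mem hxK]
    have h1 := hx hxΩ j ((hball x hxK j).trans hK'Ω) h hmodh
    rw [lmollify_congr _ _ hΦ] at h1
    have h2 : (c₀ : ℝ≥0∞) * ‖mollify (r j) (hr j) F x‖ₑ ≤ lmollify (r j) (hr j) h x := by
      calc _ ≤ c₀ * lmollify (r j) (hr j) (fun y => ‖F y‖ₑ) x := by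
            gcongr
            exact enorm_mollify_le _ _ _ _
        _ = _ := by
            unfold lmollify
            rw [← lintegral_const_mul' _ _ ENNReal.coe_ne_top]
            refine lintegral_congr fun y => ?_
            simp only [h]
            ring
    calc _ ≤ extendPhi φ x (c₂ * ‖mollify (r j) (hr j) F x‖ₑ + c₂ * ‖f x‖ₑ) := by
          refine hφ.extendPhi_mono hxΩ ?_
          rw [← mul_add]
          gcongr
          exact enorm_sub_le
      _ ≤ _ := hφ.extendPhi_add hxΩ _ _
      _ ≤ (lmollify (r j) (hr j) Φ x + 1) + Φ x := by
          refine add_le_add ((hφ.extendPhi_mono hxΩ ?_).trans h1) ?_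
          · rw [← mul_assoc, hc2, mul_assoc]
            gcongr
          · rw [← hxΦ]
            refine hφ.extendPhi_mono hxΩ ?_
            simp only [h, F]
            rw [indicator_of_mem (hKK' hxK), ← mul_assoc, hc2]
            gcongr
            exact_mod_cast mul_le_of_le_one_left' hc₁'
      _ = _ := add_assoc _ _ _
  · filter_upwards [ae_tendsto_lmollify hr hr0 hΦmeas hΦfin] with x hx
    exact hx.add_const _
  · intro j
    rw [lintegral_add_left (measurable_lmollify _ _ hΦmeas), lintegral_add_left hΦmeas,
      lintegral_lmollify _ _ hΦmeas]
  · rw [lintegral_add_left hΦmeas, lintegral_indicator hK, lintegral_add_left measurable_const,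
      setLIntegral_const, one_mul]
    refine ENNReal.add_ne_top.2 ⟨hΦfin, ENNReal.add_ne_top.2 ⟨hKfin, ?_⟩⟩
    exact ((setLIntegral_le_lintegral _ _).trans_lt hΦfin.lt_top).ne
  · filter_upwards [ae_tendsto_mollify hr hr0 hF.locallyIntegrable] with x hx
    by_cases hxΩ : x ∈ Ω
    swap
    · simp [indicator_of_notMem hxΩ]
    by_cases hxK : x ∈ K
    swap
    · simp [indicator_of_notMem hxK, indicator_of_mem hxΩ, hφ.extendPhi_zero hxΩ]
    simp only [indicator_of_mem hxΩ, indicator_of_mem hxK]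
    refine (hφ.tendsto_extendPhi_zero hxΩ).comp ?_
    have h1 : Tendsto (fun j => mollify (r j) (hr j) F x - f x) atTop (𝓝 0) := by
      have : F x = f x := indicator_of_mem (hKK' hxK) _
      rw [← sub_self (f x)]
      nth_rw 2 [← this]
      exact hx.sub_const _
    have h2 := ENNReal.Tendsto.const_mul (a := (c₂ : ℝ≥0∞)) h1.enorm (Or.inr ENNReal.coe_ne_top)
    simpa using h2

end Convergence

lemma modular_sum_le (hφ : IsWeakPhi Ω φ) (hΩ : IsOpen Ω) {a : Fin (n + 1) → Space n → ℝ≥0∞}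
    (ha : ∀ k, AEMeasurable (a k) (volume.restrict Ω)) :
    modular Ω φ (fun x => ∑ k, a k x) ≤ ∑ k, modular Ω φ fun x => ((n + 1 : ℕ) : ℝ≥0) * a k x := by
  unfold modular
  rw [← lintegral_finsetSum' _ fun k _ => hφ.measurable _ ((ha k).const_mul _)]
  refine lintegral_mono_ae ?_
  filter_upwards [ae_restrict_mem hΩ.measurableSet] with x hx
  obtain ⟨k, -, hk⟩ := Finset.exists_max_image Finset.univ (fun k => a k x) Finset.univ_nonempty
  refine (hφ.extendPhi_mono hx ?_).trans (Finset.single_le_sum_of_canonicallyOrdered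
    (f := fun k => extendPhi φ x (((n + 1 : ℕ) : ℝ≥0) * a k x)) (Finset.mem_univ k))
  refine (Finset.sum_le_card_nsmul _ _ _ hk).trans (le_of_eq ?_)
  simp

lemma exists_volume_ball_two_mul_le (n : ℕ) :
    ∃ ρ : ℝ, 0 < ρ ∧ volume (Metric.ball (0 : Space n) (2 * ρ)) ≤ 2⁻¹ := by
  have h1 : Tendsto (fun ρ : ℝ => ENNReal.ofReal ((2 * ρ) ^ (n + 1)) *
      volume (Metric.ball (0 : Space n) 1)) (𝓝[>] 0) (𝓝 0) := by
    have h2 : Tendsto (fun ρ : ℝ => (2 * ρ) ^ (n + 1)) (𝓝[>] 0) (𝓝 0) := by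
      refine tendsto_nhdsWithin_of_tendsto_nhds ?_
      have : Continuous fun ρ : ℝ => (2 * ρ) ^ (n + 1) := by fun_prop
      simpa using this.tendsto 0
    have h3 := ENNReal.Tendsto.mul_const (b := volume (Metric.ball (0 : Space n) 1))
      (ENNReal.tendsto_ofReal h2) (Or.inr measure_ball_lt_top.ne)
    simpa using h3
  obtain ⟨ρ, hρ, hρ0⟩ := ((h1.eventually (ge_mem_nhds (show (0 : ℝ≥0∞) < 2⁻¹ by simp))).and
    self_mem_nhdsWithin).exists
  have hρ0 : 0 < ρ := hρ0
  refine ⟨ρ, hρ0, ?_⟩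
  have h4 := Measure.addHaar_ball_mul volume (0 : Space n) (by positivity : 0 ≤ 2 * ρ) 1
  rw [mul_one, finrank_euclideanSpace_fin] at h4
  rw [h4]
  exact hρ

/-- Under (A1) and (aDec), a function in `W^{1,φ}(Ω)` and its weak gradient are approximated in
modular on compact sets by smooth functions. -/
lemma exists_contDiff_modular_le (hφ : IsWeakPhi Ω φ) (hΩ : IsOpen Ω) (hA1 : A1 Ω φ)
    (hdec : ADec Ω φ) {u : Space n → ℝ} {g : Space n → Space n} (hw : IsWeakGradient Ω u g)
    (hu : MemLphi Ω φ u) (hg : ∀ k, MemLphi Ω φ fun x => g x k) {K : Set (Space n)}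
    (hK : IsCompact K) (hKΩ : K ⊆ Ω) (A : ℝ≥0) {δ : ℝ≥0∞} (hδ : 0 < δ) :
    ∃ v : Space n → ℝ, ContDiff ℝ 1 v ∧
      modular Ω φ (K.indicator fun x => A * ‖v x - u x‖ₑ) ≤ δ ∧
      modular Ω φ (K.indicator fun x => A * ‖classicalGradient v x - g x‖ₑ) ≤ δ := by
  obtain ⟨d, hd, hdΩ⟩ := hK.exists_cthickening_subset_open hΩ hKΩ
  obtain ⟨ρ, hρ, hvol⟩ := exists_volume_ball_two_mul_le n
  set K' := Metric.cthickening d K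
  have hK' : IsCompact K' := hK.cthickening
  set r : ℕ → ℝ := fun j => min d ρ / (j + 1)
  have hmin : 0 < min d ρ := lt_min hd hρ
  have hr : ∀ j, 0 < r j := fun j => by positivity
  have hr0 : Tendsto r atTop (𝓝 0) := by
    simpa [r, Function.comp_def] using
      (tendsto_const_div_atTop_nhds_zero_nat (min d ρ)).comp (tendsto_add_atTop_nat 1)
  have hrle : ∀ j, r j ≤ min d ρ := fun j => div_le_self hmin.le (by simp)
  have hvol' : ∀ j, volume (Metric.ball (0 : Space n) (2 * r j)) ≤ 2⁻¹ := fun j =>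
    (measure_mono (Metric.ball_subset_ball
      (by linarith [hrle j, min_le_right d ρ]))).trans hvol
  have hcball : ∀ x ∈ K, ∀ j, Metric.closedBall x (r j) ⊆ K' := fun x hx j =>
    (Metric.closedBall_subset_closedBall ((hrle j).trans (min_le_left _ _))).trans
      (Metric.closedBall_subset_cthickening hx d)
  have hball : ∀ x ∈ K, ∀ j, Metric.ball x (r j) ⊆ K' := fun x hx j =>
    Metric.ball_subset_closedBall.trans (hcball x hx j)
  have h1 := tendsto_modular_mollify_sub hr hφ hΩ hA1 hdec hu hw.1 hK.measurableSet hK' hdΩ hr0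
    hvol' hball A
  have h2 := tendsto_finsetSum Finset.univ fun k _ =>
    tendsto_modular_mollify_sub hr hφ hΩ hA1 hdec (hg k) (hw.2.1.component k) hK.measurableSet hK'
      hdΩ hr0 hvol' hball (((n + 1 : ℕ) : ℝ≥0) * A)
  rw [Finset.sum_const_zero] at h2
  obtain ⟨j, hj1, hj2⟩ := ((h1.eventually (ge_mem_nhds hδ)).and
    (h2.eventually (ge_mem_nhds hδ))).exists
  have hF : Integrable (K'.indicator u) :=
    (hw.1.integrableOn_compact_subset hdΩ hK').integrable_indicator hK'.measurableSet
  have hG : ∀ k, Integrable (K'.indicator fun x => g x k) := fun k =>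
    ((hw.2.1.component k).integrableOn_compact_subset hdΩ hK').integrable_indicator
      hK'.measurableSet
  refine ⟨mollify (r j) (hr j) (K'.indicator u), contDiff_mollify _ _ hF.locallyIntegrable, hj1, ?_⟩
  set G : Fin (n + 1) → Space n → ℝ := fun k x =>
    mollify (r j) (hr j) (K'.indicator fun x => g x k) x - g x k
  have hGm : ∀ k, AEMeasurable (K.indicator fun x => (A : ℝ≥0∞) * ‖G k x‖ₑ)
      (volume.restrict Ω) := fun k =>
    ((((contDiff_mollify _ _ (hG k).locallyIntegrable).continuous.measurable.aemeasurable.sub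
      (hg k).1).enorm).const_mul _).indicator hK.measurableSet
  refine (modular_mono_ae hφ hΩ (Eventually.of_forall fun x => ?_)).trans
    ((modular_sum_le hφ hΩ hGm).trans (le_trans (le_of_eq ?_) hj2))
  · by_cases hx : x ∈ K
    swap
    · simp [indicator_of_notMem hx]
    simp only [indicator_of_mem hx]
    rw [← Finset.mul_sum]
    gcongr
    set w : Space n := classicalGradient (mollify (r j) (hr j) (K'.indicator u)) x - g x with hw'
    have hwk : ∀ k, w k = G k x := fun k => by
      rw [hw', PiLp.sub_apply, classicalGradient_mollify _ _ hw hK' hdΩ (hcball x hx j)]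
    simp only [← hwk, ← ofReal_norm]
    rw [← ENNReal.ofReal_sum_of_nonneg fun _ _ => norm_nonneg _]
    exact ENNReal.ofReal_le_ofReal (norm_le_sum_abs w)
  · refine Finset.sum_congr rfl fun k _ => ?_
    congr 1
    ext x
    by_cases hx : x ∈ K
    · simp only [indicator_of_mem hx]
      push_cast
      ring
    · simp [indicator_of_notMem hx]

/-! ### Good representatives of Sobolev functions -/

lemma A0.weakA0 (h : A0 Ω φ) : WeakA0 Ω φ := by
  obtain ⟨β, hβ, -, h⟩ := h
  exact ⟨1 / β, by positivity, h.mono fun x hx => hx.2⟩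

lemma IsWeakGradient.exists_mem_ACC_of_c1Dense (hφ : IsWeakPhi Ω φ) (hΩ : IsOpen Ω)
    (h0 : WeakA0 Ω φ) (hd : C1Dense Ω φ) {u : Space n → ℝ} {g : Space n → Space n} (hu : MemLphi Ω φ u)
    (hw : IsWeakGradient Ω u g) (hg : ∀ k, MemLphi Ω φ fun x => g x k) :
    ∃ w ∈ ACC Ω φ, u =ᵐ[volume.restrict Ω] w ∧ classicalGradient w =ᵐ[volume.restrict Ω] g := by
  have hv : ∀ m : ℕ, ∃ v, ContDiffOn ℝ 1 v Ω ∧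
      modular Ω φ (fun x => 2 ^ (m + 4) * ‖v x - u x‖ₑ) ≤ 2⁻¹ ^ m ∧
      modular Ω φ (fun x => 2 ^ (m + 4) * ‖classicalGradient v x - g x‖ₑ) ≤ 2⁻¹ ^ m := by
    intro m
    obtain ⟨ε, hε, h⟩ := exists_modular_le_of_luxNorm_lt hφ hΩ (2 ^ (m + 4))
      (δ := 2⁻¹ ^ m) (by positivity)
    push_cast at h
    obtain ⟨v, hv, -, hlt⟩ := hd u ⟨hu, g, hw, hg⟩ ε hε
    simp only [sobolevNorm, iInf_lt_iff] at hlt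
    obtain ⟨g', hg', hlt⟩ := hlt
    have heq := hg'.ae_eq hΩ (hw.sub (isWeakGradient_of_contDiffOn hΩ hv))
    refine ⟨v, hv, ?_, ?_⟩
    · have h1 := h _ (le_self_add.trans_lt hlt)
      simp only [Pi.sub_apply] at h1
      simpa only [enorm_sub_rev (v _)] using h1
    · refine le_trans (modular_mono_ae hφ hΩ ?_) (h _ (le_add_self.trans_lt hlt))
      filter_upwards [heq] with x hx
      rw [hx, Pi.sub_apply, enorm_sub_rev]
  choose v hvC h1 h2 using hv
  have hind : ∀ f : Space n → ℝ≥0∞, modular Ω φ (Ω.indicator f) ≤ modular Ω φ f := fun f =>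
    modular_mono_ae hφ hΩ (Eventually.of_forall fun x => indicator_le_self _ _ x)
  exact exists_mem_ACC_of_approximation hφ hΩ h0 (U := fun _ => Ω) (fun _ => hΩ)
    monotone_const (iUnion_const Ω) hvC hu.1 hw.2.1.aestronglyMeasurable.aemeasurable
    (fun m => (hind _).trans (h1 m)) (fun m => (hind _).trans (h2 m))

/-- An open set is exhausted by open sets that lie in compact subsets of it. -/
lemma exists_exhaustion (hΩ : IsOpen Ω) : ∃ U K : ℕ → Set (Space n), (∀ m, IsOpen (U m)) ∧
    Monotone U ∧ ⋃ m, U m = Ω ∧ ∀ m, U m ⊆ K m ∧ IsCompact (K m) ∧ K m ⊆ Ω := by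
  have hanti : Antitone fun m : ℕ => ((m : ℝ≥0∞) + 1)⁻¹ := fun a b hab => by
    dsimp only
    gcongr
  refine ⟨fun m => Metric.ball 0 (m + 1) ∩ {x | ((m : ℝ≥0∞) + 1)⁻¹ < Metric.infEDist x Ωᶜ},
    fun m => Metric.closedBall 0 (m + 1) ∩ {x | ((m : ℝ≥0∞) + 1)⁻¹ ≤ Metric.infEDist x Ωᶜ},
    fun m => Metric.isOpen_ball.inter (isOpen_lt continuous_const Metric.continuous_infEDist),
    fun a b hab => ?_, ?_, fun m => ⟨?_, ?_, ?_⟩⟩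
  · refine inter_subset_inter (Metric.ball_subset_ball (by gcongr)) fun x hx => ?_
    exact (hanti hab).trans_lt hx
  · refine Subset.antisymm (iUnion_subset fun m x hx => ?_) fun x hx => mem_iUnion.2 ?_
    · by_contra hxΩ
      have h1 : ((m : ℝ≥0∞) + 1)⁻¹ < Metric.infEDist x Ωᶜ := hx.2
      rw [Metric.infEDist_zero_of_mem (mem_compl hxΩ)] at h1
      exact not_lt_zero h1
    · have hpos : 0 < Metric.infEDist x Ωᶜ := by
        rw [pos_iff_ne_zero, Ne, ← Metric.mem_closure_iff_infEDist_zero,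
          hΩ.isClosed_compl.closure_eq]
        exact fun h => h hx
      obtain ⟨N, hN⟩ := ENNReal.exists_inv_nat_lt hpos.ne'
      obtain ⟨M, hM⟩ := exists_nat_gt ‖x‖
      refine ⟨max N M, ?_, ?_⟩
      · rw [mem_ball_zero_iff]
        calc ‖x‖ < M := hM
          _ ≤ (max N M : ℕ) := by exact_mod_cast le_max_right N M
          _ ≤ _ := by linarith
      · refine lt_of_le_of_lt ?_ hN
        have : (N : ℝ≥0∞) ≤ (max N M : ℕ) := by exact_mod_cast le_max_left N M
        exact ENNReal.inv_le_inv.2 (this.trans le_self_add)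
  · exact inter_subset_inter Metric.ball_subset_closedBall fun x hx => hx.out.le
  · exact (isCompact_closedBall _ _).inter_right
      (isClosed_le continuous_const Metric.continuous_infEDist)
  · intro x hx
    by_contra hxΩ
    have h1 : ((m : ℝ≥0∞) + 1)⁻¹ ≤ Metric.infEDist x Ωᶜ := hx.2
    rw [Metric.infEDist_zero_of_mem (mem_compl hxΩ), nonpos_iff_eq_zero,
      ENNReal.inv_eq_zero] at h1
    exact absurd h1 (by finiteness)

lemma IsWeakGradient.exists_mem_ACC_of_A1 (hφ : IsWeakPhi Ω φ) (hΩ : IsOpen Ω) (h0 : WeakA0 Ω φ)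
    (hA1 : A1 Ω φ) (hdec : ADec Ω φ) {u : Space n → ℝ} {g : Space n → Space n}
    (hu : MemLphi Ω φ u) (hw : IsWeakGradient Ω u g) (hg : ∀ k, MemLphi Ω φ fun x => g x k) :
    ∃ w ∈ ACC Ω φ, u =ᵐ[volume.restrict Ω] w ∧ classicalGradient w =ᵐ[volume.restrict Ω] g := by
  obtain ⟨U, K, hU, hmono, hUΩ, hK⟩ := exists_exhaustion hΩ
  choose v hv h1 h2 using fun m : ℕ => exists_contDiff_modular_le hφ hΩ hA1 hdec hw hu hg
    (hK m).2.1 (hK m).2.2 (2 ^ (m + 4)) (δ := 2⁻¹ ^ m)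
    (ENNReal.pow_pos (by simp) m)
  push_cast at h1 h2
  have hind : ∀ (m : ℕ) (f : Space n → ℝ≥0∞),
      modular Ω φ ((U m).indicator f) ≤ modular Ω φ ((K m).indicator f) := fun m f =>
    modular_mono_ae hφ hΩ (Eventually.of_forall fun x =>
      indicator_le_indicator_of_subset (hK m).1 (fun _ => zero_le) x)
  exact exists_mem_ACC_of_approximation hφ hΩ h0 hU hmono hUΩ (fun m => (hv m).contDiffOn)
    hu.1 hw.2.1.aestronglyMeasurable.aemeasurable
    (fun m => (hind m _).trans (h1 m)) (fun m => (hind m _).trans (h2 m))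

/-! ### The three spaces -/

lemma ACCphi_subset_ACLphi (hφ : IsWeakPhi Ω φ) (hΩ : IsOpen Ω) (h0 : WeakA0 Ω φ) :
    ACCphi Ω φ ⊆ ACLphi Ω φ :=
  fun _ hu => ⟨ACC_subset_ACL hφ hΩ h0 hu.1, hu.2⟩

lemma memSobolev_of_mem_ACLphi (hφ : IsWeakPhi Ω φ) (hΩ : IsOpen Ω) (h0 : WeakA0 Ω φ)
    {u v : Space n → ℝ} (hv : v ∈ ACLphi Ω φ) (hu : MemLphi Ω φ u)
    (huv : u =ᵐ[volume.restrict Ω] v) : MemSobolev Ω φ u := by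
  have hvm : AEMeasurable v (volume.restrict Ω) := hu.1.congr huv
  have hgm := aemeasurable_classicalGradient hΩ hvm (ACL.hasGradientAE hΩ hv.1 hvm)
  have hg := (memLphi_norm_iff hφ hΩ hgm).1 hv.2
  have hvL := hu.congr hφ hΩ huv.symm
  refine ⟨hu, classicalGradient v, IsWeakGradient.congr ?_ (hu.locallyIntegrableOn hφ hΩ h0) huv,
    hg⟩
  exact ACL.isWeakGradient hΩ hv.1 (hvL.locallyIntegrableOn hφ hΩ h0)
    (locallyIntegrableOn_of_components fun k => (hg k).locallyIntegrableOn hφ hΩ h0)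

lemma MemSobolev.exists_mem_ACCphi (hφ : IsWeakPhi Ω φ) (hΩ : IsOpen Ω)
    (h : (WeakA0 Ω φ ∧ C1Dense Ω φ) ∨ (A0 Ω φ ∧ A1 Ω φ ∧ A2 Ω φ ∧ ADec Ω φ))
    {u : Space n → ℝ} (hu : MemSobolev Ω φ u) :
    ∃ w ∈ ACCphi Ω φ, u =ᵐ[volume.restrict Ω] w := by
  obtain ⟨hu, g, hw, hg⟩ := hu
  obtain ⟨w, hwA, huw, hgw⟩ : ∃ w ∈ ACC Ω φ, u =ᵐ[volume.restrict Ω] w ∧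
      classicalGradient w =ᵐ[volume.restrict Ω] g := by
    rcases h with ⟨h0, hd⟩ | ⟨h0, hA1, -, hdec⟩
    · exact hw.exists_mem_ACC_of_c1Dense hφ hΩ h0 hd hu hg
    · exact hw.exists_mem_ACC_of_A1 hφ hΩ h0.weakA0 hA1 hdec hu hg
  have hgm : AEMeasurable g (volume.restrict Ω) := hw.2.1.aestronglyMeasurable.aemeasurable
  exact ⟨w, ⟨hwA, ((memLphi_norm_iff hφ hΩ hgm).2 hg).congr hφ hΩ
    (hgw.mono fun x hx => by simp only [hx])⟩, huw⟩

end GenOrlicz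

end

theorem corollary5p8 (n : ℕ) (Ω : Set (GenOrlicz.Space n)) (hΩ : IsOpen Ω)
    (φ : GenOrlicz.Space n → ℝ≥0 → ℝ≥0∞) (hφ : GenOrlicz.IsWeakPhi Ω φ)
    (h : (GenOrlicz.WeakA0 Ω φ ∧ GenOrlicz.C1Dense Ω φ) ∨
      (GenOrlicz.A0 Ω φ ∧ GenOrlicz.A1 Ω φ ∧ GenOrlicz.A2 Ω φ ∧ GenOrlicz.ADec Ω φ)) :
    (∀ u : GenOrlicz.Space n → ℝ, AEMeasurable u (volume.restrict Ω) →
      u ∈ GenOrlicz.ACL Ω ∪ GenOrlicz.ACC Ω φ → GenOrlicz.HasGradientAE Ω u) ∧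
    GenOrlicz.classes Ω (GenOrlicz.ACCphi Ω φ) ∩ GenOrlicz.Lphi Ω φ =
      GenOrlicz.classes Ω (GenOrlicz.ACLphi Ω φ) ∩ GenOrlicz.Lphi Ω φ ∧
    GenOrlicz.classes Ω (GenOrlicz.ACLphi Ω φ) ∩ GenOrlicz.Lphi Ω φ = GenOrlicz.W1phi Ω φ := by
  open GenOrlicz in
  have h0 : WeakA0 Ω φ := h.elim (fun h => h.1) fun h => h.1.weakA0
  have h1 : classes Ω (ACCphi Ω φ) ∩ Lphi Ω φ ⊆ classes Ω (ACLphi Ω φ) ∩ Lphi Ω φ :=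
    fun f ⟨⟨v, hv, hfv⟩, hf⟩ => ⟨⟨v, ACCphi_subset_ACLphi hφ hΩ h0 hv, hfv⟩, hf⟩
  have h2 : classes Ω (ACLphi Ω φ) ∩ Lphi Ω φ ⊆ W1phi Ω φ :=
    fun f ⟨⟨v, hv, hfv⟩, hf⟩ => memSobolev_of_mem_ACLphi hφ hΩ h0 hv hf hfv
  have h3 : W1phi Ω φ ⊆ classes Ω (ACCphi Ω φ) ∩ Lphi Ω φ :=
    fun f hf => ⟨MemSobolev.exists_mem_ACCphi hφ hΩ h hf, hf.1⟩
  refine ⟨fun u hm hu => ?_, h1.antisymm (h2.trans h3), h2.antisymm (h3.trans h1)⟩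
  exact ACL.hasGradientAE hΩ (hu.elim id fun hu => ACC_subset_ACL hφ hΩ h0 hu) hm
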